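/- Let $M\ge 1$, let $\nu_0=0$ and let $\nu_1,\dots,\nu_M$ be non-negative integers. For $x,y>0$ let $f$ and $g$ be the Meijer functions $$f(x)=G^{1,0}_{0,M+1}(x\,|\,-\nu_0,\dots,-\nu_M)=\frac1{2\pi i}\int_L\frac{\Gamma(-w)}{\prod_{j=1}^M\Gamma(1+\nu_j+w)}x^w\,dw,$$ $$g(y)=G^{M,0}_{0,M+1}(y\,|\,\nu_1,\dots,\nu_M,\nu_0)=\frac1{2\pi i}\int_L\frac{\prod_{j=1}^M\Gamma(\nu_j-w)}{\Gamma(1+w)}y^w\,dw,$$ where $L$ is a loop that begins and ends at $+\infty$ and encircles the points $0,1,2,\dots$ once in the negative direction. Let $\alpha_0,\dots,\alpha_M$ be defined by $\prod_{i=1}^M(X-\nu_i)=\sum_{i=0}^M\alpha_iX^i$, and for $0\le j\le M$ put $$\phi_j(x)=(-1)^{M-j+1}\Bigl(x\frac{d}{dx}\Bigr)^jf(x),\qquad \psi_j(y)=\sum_{i=0}^{M-j}\alpha_{i+j}\Bigl(y\frac{d}{dy}\Bigr)^ig(y).$$ Let $K_M(x,y)=\frac1{x-y}\sum_{j=0}^M\phi_j(x)\psi_j(y)$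 for $x\ne y$, with $K_M(x,x)=\sum_{j=0}^M\phi_j'(x)\psi_j(x)$ (L'Hospital's rule). For $s>0$ let $K_M$ and $K_M'$ also denote the integral operators on $(0,\infty)$ with kernels $K_M(x,y)\chi_{(0,s)}(y)$ and $K_M(y,x)\chi_{(0,s)}(y)$, and let $$F_M(s)=\det(1-K_M)=\sum_{n\ge0}\frac{(-1)^n}{n!}\int_{(0,\infty)^n}\det\bigl[K_M(t_i,t_j)\chi_{(0,s)}(t_j)\bigr]_{i,j=1}^n\,dt_1\cdots dt_n$$ be the Fredholm determinant; the integrals and the series converge for all $s>0$. We say that $u=(1-K_M)^{-1}h$ if $u$ is square integrable over $(0,s)$ and $u-K_Mu=h$ on $(0,\infty)$, and similarly for $K_M'$. If $F_M(s)\ne0$, then $(1-K_M)^{-1}\phi_j$ and $(1-K_M')^{-1}\psi_j$ exist and are unique on $(0,\infty)$ for $0\le j\le M$, and the following quantities are well defined, where the value at $s$ is the limit from inside $(0,s)$ and $e_k$ is the $k$-th elementary symmetric polynomial: $$x_j(s)=\sqrt{-1}\,\bigl[(1-K_M)^{-1}\phi_j\bigr](s),\qquad y_j(s)=\sqrt{-1}\,\bigl[(1-K_M')^{-1}\psi_j\bigr](s),$$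 $$\xi_j(s)=(-1)^M\int_0^s\phi_0\,(1-K_M')^{-1}\psi_j\,dx+(-1)^{M+1-j}e_{M+1-j}(\nu_0,\dots,\nu_M),$$ $$\eta_j(s)=(-1)^M\int_0^s\phi_j\,(1-K_M')^{-1}\psi_M\,dx .$$ **(A)** At every $s>0$ with $F_M(s)\neq 0$ these functions are differentiable and $$s x_j'=-\eta_jx_0-x_{j+1}\ (0\le j\le M-1),\qquad s x_M'=-\eta_Mx_0+(-1)^{M+1}s x_0+\sum_{i=0}^M\xi_ix_i,$$ $$s y_j'=-\xi_jy_M+y_{j-1}\ (1\le j\le M),\qquad s y_0'=-\xi_0y_M+(-1)^Ms y_M+\sum_{i=0}^M\eta_iy_i,$$ $$\xi_j'=(-1)^{M+1}x_0y_j,\qquad \eta_j'=(-1)^{M+1}x_jy_M\qquad(0\le j\le M).$$ **(B)** One has $F_M(s)\neq0$ for all sufficiently small $s>0$, and the initial conditions, for $0\le j\le M$ and as $s\to0^+$, are: the limit $\phi_j(0):=\lim_{s\to0^+}\phi_j(s)$ exists and $x_j(s)\to\sqrt{-1}\,\phi_j(0)$; $\ y_j(s)-\sqrt{-1}\,\psi_j(s)\to0$;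 $\ \eta_j(s)\to0$; $\ \xi_j(s)\to(-1)^{M+1-j}e_{M+1-j}(\nu_0,\dots,\nu_M)$. If $j\le1$ or at most one of $\nu_1,\dots,\nu_M$ is zero, then $\psi_j(0):=\lim_{s\to0^+}\psi_j(s)$ exists and hence $y_j(s)\to\sqrt{-1}\,\psi_j(0)$. If $s>0$ and $F_M(t)\ne0$ for all $t\in(0,s]$, then $\log(s/t)\,x_0(t)y_M(t)$ is integrable over $(0,s)$ and $$F_M(s)=\exp\Bigl((-1)^{M+1}\int_0^s\log\Bigl(\frac st\Bigr)x_0(t)\,y_M(t)\,dt\Bigr).$$ -/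

import Mathlib

open scoped Nat

noncomputable section

namespace GenBessel

/-- The integrand of the Meijer function `G^{m,0}_{0,q}(z | b_1, …, b_q)`. -/
def meijerIntegrand {q : ℕ} (m : ℕ) (b : Fin q → ℂ) (z : ℝ) (w : ℂ) : ℂ :=
  (∏ j with j.val < m, Complex.Gamma (b j - w)) /
    (∏ j with m ≤ j.val, Complex.Gamma (1 - b j + w)) * (z : ℂ) ^ w

/-- `(1 / 2πi) ∫ F(w) dw` over the loop that comes in from `+∞` along the line `Im w = -1`, goes up
the segment from `c - i` to `c + i`, and goes back to `+∞` along the line `Im w = 1`. -/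
def loopIntegral (c : ℝ) (F : ℂ → ℂ) : ℂ :=
  (1 / (2 * (Real.pi : ℂ) * Complex.I)) *
    (-(∫ r in Set.Ioi c, F ((r : ℂ) - Complex.I))
      + Complex.I * (∫ t in (-1 : ℝ)..1, F ((c : ℂ) + (t : ℂ) * Complex.I))
      + ∫ r in Set.Ioi c, F ((r : ℂ) + Complex.I))

/-- The Meijer function `G^{m,0}_{0,q}(z | b_1, …, b_q)` for `z > 0` and real `b_j`.
Here `c` is any number smaller than `b_1, …, b_m`, so that the loop encircles all
poles of the `Γ(b_j - w)`, `j ≤ m`, once in the negative direction. (The integral over the vertical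
line through `c` need not converge: it diverges for `m = 1`, `q ≥ 3`.) -/
def meijerG {q : ℕ} (m : ℕ) (b : Fin q → ℂ) (c : ℝ) (z : ℝ) : ℂ :=
  loopIntegral c (meijerIntegrand m b z)

variable {M : ℕ}

/-- `f(x) = G^{1,0}_{0,M+1}(x | -ν_0, -ν_1, …, -ν_M)`. -/
def f (ν : Fin (M + 1) → ℕ) (x : ℝ) : ℂ :=
  meijerG 1 (fun j => -(ν j : ℂ)) (-1 / 4) x

/-- `g(y) = G^{M,0}_{0,M+1}(y | ν_1, …, ν_M, ν_0)`. -/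
def g (ν : Fin (M + 1) → ℕ) (y : ℝ) : ℂ :=
  meijerG M (Fin.snoc (α := fun _ => ℂ) (fun i : Fin M => (ν i.succ : ℂ)) (ν 0 : ℂ)) (-1 / 4) y

/-- The Euler operator `x d/dx`. -/
def euler (h : ℝ → ℂ) (x : ℝ) : ℂ := (x : ℂ) * deriv h x

/-- The coefficients `α_i` of `∏_{i=1}^M (X - ν_i)`. -/
def alpha (ν : Fin (M + 1) → ℕ) (i : ℕ) : ℂ :=
  (∏ l : Fin M, (Polynomial.X - Polynomial.C (ν l.succ : ℂ))).coeff i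

/-- The elementary symmetric polynomial `e_k(ν_0, …, ν_M)`. -/
def esymmNu (ν : Fin (M + 1) → ℕ) (k : ℕ) : ℂ :=
  (Finset.univ.val.map (fun l : Fin (M + 1) => (ν l : ℂ))).esymm k

/-- `φ_j(x)`, for `0 ≤ j ≤ M`. -/
def phi (ν : Fin (M + 1) → ℕ) (j : ℕ) (x : ℝ) : ℂ :=
  (-1) ^ (M - j + 1) * (euler^[j] (f ν)) x

/-- `ψ_j(y)`, for `0 ≤ j ≤ M`. -/
def psi (ν : Fin (M + 1) → ℕ) (j : ℕ) (y : ℝ) : ℂ :=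
  ∑ i ∈ Finset.range (M - j + 1), alpha ν (i + j) * (euler^[i] (g ν)) y

/-- The generalized Bessel kernel `K_M(x,y)`; on the diagonal the quotient is resolved by
L'Hospital's rule in the variable `x`. -/
def K (ν : Fin (M + 1) → ℕ) (x y : ℝ) : ℂ :=
  if x = y then ∑ j ∈ Finset.range (M + 1), deriv (phi ν j) y * psi ν j y
  else (∑ j ∈ Finset.range (M + 1), phi ν j x * psi ν j y) / ((x : ℂ) - (y : ℂ))

/-- The kernel `K_M(x,y) χ_{(0,s)}(y)`. -/
def KJ (ν : Fin (M + 1) → ℕ) (s x y : ℝ) : ℂ :=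
  K ν x y * (Set.Ioo 0 s).indicator 1 y

/-- The kernel `K_M(y,x) χ_{(0,s)}(y)` of the operator `K_M'`. -/
def KJ' (ν : Fin (M + 1) → ℕ) (s x y : ℝ) : ℂ :=
  K ν y x * (Set.Ioo 0 s).indicator 1 y

/-- The integrand of the `n`-th term of the Fredholm series. -/
def fredholmIntegrand (k : ℝ → ℝ → ℂ) (n : ℕ) (x : Fin n → ℝ) : ℂ :=
  (Matrix.of fun i j => k (x i) (x j)).det

/-- The `n`-th term of the Fredholm series of the kernel `k` on `(0,∞)`. -/
def fredholmTerm (k : ℝ → ℝ → ℂ) (n : ℕ) : ℂ :=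
  (-1) ^ n / (n ! : ℂ) *
    ∫ x in Set.univ.pi (fun _ : Fin n => Set.Ioi (0 : ℝ)), fredholmIntegrand k n x

/-- The Fredholm determinant `det(1 - k)` of the integral operator with kernel `k` on `(0,∞)`. -/
def fredholmDet (k : ℝ → ℝ → ℂ) : ℂ := ∑' n, fredholmTerm k n

/-- The Fredholm determinant of `k` exists. -/
def FredholmDetExists (k : ℝ → ℝ → ℂ) : Prop :=
  (∀ n, MeasureTheory.IntegrableOn (fredholmIntegrand k n)
    (Set.univ.pi (fun _ : Fin n => Set.Ioi (0 : ℝ)))) ∧ Summable (fredholmTerm k)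

/-- `F_M(s) = det(1 - K_M)` for `J = (0,s)`. -/
def F (ν : Fin (M + 1) → ℕ) (s : ℝ) : ℂ := fredholmDet (KJ ν s)

/-- `u = (1 - k)^{-1} h`, for a kernel `k(x,y)` that vanishes unless `y ∈ (0,s)`: `u` is
square integrable over `(0,s)` and `u(x) - ∫_0^∞ k(x,y) u(y) dy = h(x)` for all `x > 0`.
(Square integrability over all of `(0,∞)` cannot be asked for, since the functions `φ_j` do not
have it in general.) -/
def IsResolventSol (k : ℝ → ℝ → ℂ) (s : ℝ) (h u : ℝ → ℂ) : Prop :=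
  MeasureTheory.MemLp u 2 (MeasureTheory.volume.restrict (Set.Ioo 0 s)) ∧
    ∀ x : ℝ, 0 < x → u x - ∫ y in Set.Ioi (0 : ℝ), k x y * u y = h x

/-- `(1 - k)^{-1} h`. -/
def resolventSol (k : ℝ → ℝ → ℂ) (s : ℝ) (h : ℝ → ℂ) : ℝ → ℂ :=
  Classical.epsilon (IsResolventSol k s h)

/-- `(1 - K_M)^{-1} φ_j`, for `J = (0,s)`. -/
def Q (ν : Fin (M + 1) → ℕ) (j : ℕ) (s : ℝ) : ℝ → ℂ := resolventSol (KJ ν s) s (phi ν j)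

/-- `(1 - K_M')^{-1} ψ_j`, for `J = (0,s)`. -/
def P (ν : Fin (M + 1) → ℕ) (j : ℕ) (s : ℝ) : ℝ → ℂ := resolventSol (KJ' ν s) s (psi ν j)

/-- `x_j(s) = √-1 (1 - K_M)^{-1} φ_j (s)`, the value at `s` being the limit from inside `(0,s)`. -/
def xf (ν : Fin (M + 1) → ℕ) (j : ℕ) (s : ℝ) : ℂ :=
  Complex.I * Filter.limUnder (nhdsWithin s (Set.Ioo 0 s)) (Q ν j s)

/-- `y_j(s) = √-1 (1 - K_M')^{-1} ψ_j (s)`, the value at `s` being the limit from inside `(0,s)`. -/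
def yf (ν : Fin (M + 1) → ℕ) (j : ℕ) (s : ℝ) : ℂ :=
  Complex.I * Filter.limUnder (nhdsWithin s (Set.Ioo 0 s)) (P ν j s)

/-- `ξ_j(s)`. -/
def xi (ν : Fin (M + 1) → ℕ) (j : ℕ) (s : ℝ) : ℂ :=
  (-1) ^ M * (∫ x in Set.Ioo 0 s, phi ν 0 x * P ν j s x)
    + (-1) ^ (M + 1 - j) * esymmNu ν (M + 1 - j)

/-- `η_j(s)`. -/
def eta (ν : Fin (M + 1) → ℕ) (j : ℕ) (s : ℝ) : ℂ :=
  (-1) ^ M * ∫ x in Set.Ioo 0 s, phi ν j x * P ν M s x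

/-- The quantities `x_j`, `y_j`, `ξ_j`, `η_j` are well defined at `s`: the equations that define
`(1 - K_M)^{-1} φ_j` and `(1 - K_M')^{-1} ψ_j` have exactly one solution on `(0,∞)`, these solutions
have limits at `s`, and the integrals in `ξ_j`, `η_j` converge. -/
def WellDefinedAt (ν : Fin (M + 1) → ℕ) (s : ℝ) : Prop :=
  ∀ j ≤ M,
    (IsResolventSol (KJ ν s) s (phi ν j) (Q ν j s) ∧
      (∀ u, IsResolventSol (KJ ν s) s (phi ν j) u → Set.EqOn u (Q ν j s) (Set.Ioi 0)) ∧
      ∃ l, Filter.Tendsto (Q ν j s) (nhdsWithin s (Set.Ioo 0 s)) (nhds l)) ∧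
    (IsResolventSol (KJ' ν s) s (psi ν j) (P ν j s) ∧
      (∀ u, IsResolventSol (KJ' ν s) s (psi ν j) u → Set.EqOn u (P ν j s) (Set.Ioi 0)) ∧
      ∃ l, Filter.Tendsto (P ν j s) (nhdsWithin s (Set.Ioo 0 s)) (nhds l)) ∧
    MeasureTheory.IntegrableOn (fun x => phi ν 0 x * P ν j s x) (Set.Ioo 0 s) ∧
    MeasureTheory.IntegrableOn (fun x => phi ν j x * P ν M s x) (Set.Ioo 0 s)

/-- The system of ordinary differential equations, at the point `s`. -/
def SatisfiesODE (M : ℕ) (x y ξ η : ℕ → ℝ → ℂ) (s : ℝ) : Prop :=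
  (∀ j ≤ M, DifferentiableAt ℝ (x j) s ∧ DifferentiableAt ℝ (y j) s ∧
    DifferentiableAt ℝ (ξ j) s ∧ DifferentiableAt ℝ (η j) s) ∧
  (∀ j < M, (s : ℂ) * deriv (x j) s = -(η j s * x 0 s) - x (j + 1) s) ∧
  ((s : ℂ) * deriv (x M) s = -(η M s * x 0 s) + (-1) ^ (M + 1) * (s : ℂ) * x 0 s
    + ∑ i ∈ Finset.range (M + 1), ξ i s * x i s) ∧
  (∀ j, 1 ≤ j → j ≤ M → (s : ℂ) * deriv (y j) s = -(ξ j s * y M s) + y (j - 1) s) ∧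
  ((s : ℂ) * deriv (y 0) s = -(ξ 0 s * y M s) + (-1) ^ M * (s : ℂ) * y M s
    + ∑ i ∈ Finset.range (M + 1), η i s * y i s) ∧
  (∀ j ≤ M, deriv (ξ j) s = (-1) ^ (M + 1) * x 0 s * y j s) ∧
  (∀ j ≤ M, deriv (η j) s = (-1) ^ (M + 1) * x j s * y M s)

end GenBessel

end

/-! Both Meijer functions are loop integrals of H(w) x^w, where the symbol H satisfies H(w) = D(w+1)
H(w+1) for a polynomial D. Since x d/dx multiplies the symbol by w, this recursion turns into the
differential equation D(x d/dx) T = x T, and it also forces H to decay faster than any exponential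
along the horizontal lines. Behaviour at the origin is read off by moving the left end of the loop
from -1/4 to 3/4 across the pole at 0.

Consequently the φ_j and the ψ_j satisfy first order systems under the Euler operator. These are
adjoint to each other up to one term (`sum_theta`): along the ray t ↦ (tx, ty) the sum Σ φ_j ψ_j has
derivative (x-y) f(tx) g(ty), and it tends to 0 with t. Hence K(x,y) = ∫_0^1 f(tx) g(ty) dt
(`K_eq_integral`), where f is continuous up to 0 and g is O(y^{-1/4}).

Rescale (0,s) to (0,1) and let the operator act on C([0,1]). Its kernel s K(su,sv) = ∫_0^s f(ru)
g(rv) dr depends on s only through the upper limit, so the operator T_s has derivative of rank one,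
f(su) ⊗ g(sv). Everything else is Fredholm theory for such a family. Hadamard's inequality gives
convergence of the determinant and its minors; the recursion of the minors gives Fredholm's identity
(1-T)(D+N) = D (`one_sub_mul_minor`), hence the resolvent R when D ≠ 0; differentiating the
determinants row by row gives D'/D = -⟨g(s·), R f(s·)⟩ (`hasDerivAt_detK`).

In these terms x_j is √-1 (R Φ_j)(1), with Φ_j(u) = φ_j(su); y_j is the value at s of the transposed
solution, again times √-1; and ξ_j, η_j are, up to signs and constants, pairings ∫_0^s φ_i (1-K')⁻¹
ψ_j. The equations for x_j and y_j follow from the product rule, R' = R T' R and the first order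
systems. The two end equations contain multiplication by the variable X, which is moved past R with
[X,T] = Σ Ψ_j ⊗ Φ_j, the rank M+1 form of the kernel's numerator (`commutator_apply`, `res_mulX`).
The equations for ξ_j, η_j come from comparing solutions for two lengths s, s'
(`integral_mul_solP_sub`). Finally s F'/F = η_0 and η_0' = (-1)^{M+1} x_0 y_M; with η_0 → 0 and F →
1 at 0, an integration by parts yields the formula with log(s/t). -/

noncomputable section

namespace GenBessel

open MeasureTheory Filter Topology Set

section

/-! ### Differentiation and decay of integrals of powers -/

/-- Decay along the positive real axis faster than every exponential. -/
def RapidDecay (h : ℝ → ℂ) : Prop :=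
  ∀ A : ℝ, ∃ C, ∀ r : ℝ, -1 ≤ r → ‖h r‖ ≤ C * Real.exp (-A * r)

lemma RapidDecay.add {h k : ℝ → ℂ} (hh : RapidDecay h) (hk : RapidDecay k) :
    RapidDecay (fun r => h r + k r) := by
  intro A
  obtain ⟨C, hC⟩ := hh A
  obtain ⟨C', hC'⟩ := hk A
  refine ⟨C + C', fun r hr => (norm_add_le _ _).trans ?_⟩
  rw [add_mul]
  exact add_le_add (hC r hr) (hC' r hr)

lemma RapidDecay.const_mul {h : ℝ → ℂ} (hh : RapidDecay h) (a : ℂ) :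
    RapidDecay (fun r => a * h r) := by
  intro A
  obtain ⟨C, hC⟩ := hh A
  refine ⟨‖a‖ * C, fun r hr => ?_⟩
  rw [norm_mul, mul_assoc]
  exact mul_le_mul_of_nonneg_left (hC r hr) (norm_nonneg _)

lemma abs_add_one_le_exp {r : ℝ} (hr : -1 ≤ r) : |r| + 1 ≤ 6 * Real.exp r := by
  rcases le_or_gt 0 r with h | h
  · rw [abs_of_nonneg h]
    have := Real.add_one_le_exp r
    have := Real.exp_pos r
    linarith
  · have h1 : Real.exp (-1) ≤ Real.exp r := Real.exp_le_exp.2 hr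
    have h2 : (1 : ℝ) / 3 ≤ Real.exp (-1) := by
      rw [Real.exp_neg, one_div]
      exact inv_anti₀ (Real.exp_pos 1) (by linarith [Real.exp_one_lt_d9])
    rw [abs_of_neg h]
    linarith

/-- The linear factor is dominated by a multiple of exp r, so it costs one unit of the exponent `A`.
-/
lemma RapidDecay.add_mul {h : ℝ → ℂ} (hh : RapidDecay h) (τ : ℂ) :
    RapidDecay (fun r => ((r : ℂ) + τ) * h r) := by
  intro A
  obtain ⟨C, hC⟩ := hh (A + 1)
  have hC0 : 0 ≤ C := by
    have := (norm_nonneg _).trans (hC 0 (by norm_num))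
    simpa using this
  refine ⟨(1 + ‖τ‖) * 6 * C, fun r hr => ?_⟩
  rw [norm_mul]
  have h1 : ‖(r : ℂ) + τ‖ ≤ (1 + ‖τ‖) * (6 * Real.exp r) := by
    have h2 := abs_add_one_le_exp hr
    calc ‖(r : ℂ) + τ‖ ≤ |r| + ‖τ‖ := by
          simpa using norm_add_le (r : ℂ) τ
      _ ≤ (1 + ‖τ‖) * (|r| + 1) := by nlinarith [abs_nonneg r, norm_nonneg τ]
      _ ≤ _ := by gcongr
  calc _ ≤ ((1 + ‖τ‖) * (6 * Real.exp r)) * (C * Real.exp (-(A + 1) * r)) :=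
        mul_le_mul h1 (hC r hr) (norm_nonneg _) (by positivity)
    _ = (1 + ‖τ‖) * 6 * C * (Real.exp r * Real.exp (-(A + 1) * r)) := by ring
    _ = _ := by rw [← Real.exp_add]; ring_nf

lemma RapidDecay.polynomial_mul {h : ℝ → ℂ} (hh : RapidDecay h) (τ : ℂ) (p : Polynomial ℂ) :
    RapidDecay (fun r => p.eval ((r : ℂ) + τ) * h r) := by
  induction p using Polynomial.induction_on with
  | C a => simpa using hh.const_mul a
  | add p q hp hq =>
    convert hp.add hq using 2 with r
    simp [_root_.add_mul]
  | monomial n a hn =>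
    convert hn.add_mul τ using 2 with r
    simp only [Polynomial.eval_mul, Polynomial.eval_C, Polynomial.eval_pow, Polynomial.eval_X]
    ring

lemma RapidDecay.integrableOn {h : ℝ → ℂ} (hh : RapidDecay h) (hc : Continuous h) {c : ℝ}
    (hc1 : -1 ≤ c) (A : ℝ) :
    IntegrableOn (fun r => h r * (Real.exp (A * r) : ℂ)) (Ioi c) := by
  obtain ⟨C, hC⟩ := hh (A + 1)
  refine Integrable.mono' (g := fun r => C * Real.exp (-1 * r)) ?_ ?_ ?_
  · exact (integrableOn_exp_mul_Ioi (by norm_num) c).const_mul C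
  · exact Continuous.aestronglyMeasurable (by fun_prop)
  · refine (ae_restrict_mem measurableSet_Ioi).mono fun r hr => ?_
    rw [norm_mul]
    have h1 := hC r (hc1.trans (le_of_lt hr))
    have h2 : ‖((Real.exp (A * r) : ℝ) : ℂ)‖ = Real.exp (A * r) := by
      rw [Complex.norm_real, Real.norm_of_nonneg (Real.exp_pos _).le]
    rw [h2]
    calc _ ≤ C * Real.exp (-(A + 1) * r) * Real.exp (A * r) := by gcongr
      _ = _ := by rw [mul_assoc, ← Real.exp_add]; ring_nf

lemma norm_ofReal_cpow {x : ℝ} (hx : 0 < x) (w : ℂ) :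
    ‖(x : ℂ) ^ w‖ = Real.exp (Real.log x * w.re) := by
  rw [Complex.norm_cpow_eq_rpow_re_of_pos hx, Real.rpow_def_of_pos hx]

/-- Valid for both signs of `t`. With `a`, `l`, `b` logarithms it dominates y^{ω} uniformly for y
near x, whatever the sign of Re ω. -/
lemma exp_mul_le_add {a b l t : ℝ} (h1 : a ≤ l) (h2 : l ≤ b) :
    Real.exp (l * t) ≤ Real.exp (a * t) + Real.exp (b * t) := by
  rcases le_total 0 t with h | h
  · have : Real.exp (l * t) ≤ Real.exp (b * t) :=
      Real.exp_le_exp.2 (mul_le_mul_of_nonneg_right h2 h)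
    linarith [Real.exp_pos (a * t)]
  · have : Real.exp (l * t) ≤ Real.exp (a * t) :=
      Real.exp_le_exp.2 (mul_le_mul_of_nonpos_right h1 h)
    linarith [Real.exp_pos (b * t)]

lemma hasDerivAt_ofReal_cpow {x : ℝ} (hx : 0 < x) (w : ℂ) :
    HasDerivAt (fun y : ℝ => (y : ℂ) ^ w) ((x : ℂ)⁻¹ * (w * (x : ℂ) ^ w)) x := by
  have h := ((hasDerivAt_id (x : ℂ)).cpow_const (c := w) (Or.inl (by simpa using hx))).comp_ofReal
  refine h.congr_deriv ?_
  simp only [id]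
  rw [Complex.cpow_sub _ _ (by exact_mod_cast hx.ne'), Complex.cpow_one]
  field_simp

/-- Differentiation of `x ↦ ∫ h(t) x^{ω(t)} dt`. -/
lemma hasDerivAt_integral_cpow {μ : Measure ℝ} {h ω : ℝ → ℂ}
    (hm : AEStronglyMeasurable h μ) (hω : Continuous ω)
    (h0 : ∀ A : ℝ, Integrable (fun t => h t * (Real.exp (A * (ω t).re) : ℂ)) μ)
    (h1 : ∀ A : ℝ, Integrable (fun t => ω t * h t * (Real.exp (A * (ω t).re) : ℂ)) μ)
    {x : ℝ} (hx : 0 < x) :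
    HasDerivAt (fun y : ℝ => ∫ t, h t * (y : ℂ) ^ ω t ∂μ)
      ((x : ℂ)⁻¹ * ∫ t, ω t * h t * (x : ℂ) ^ ω t ∂μ) x := by
  have hmeas : ∀ y : ℝ, 0 < y → AEStronglyMeasurable (fun t => (y : ℂ) ^ ω t) μ := by
    intro y hy
    refine Continuous.aestronglyMeasurable ?_
    exact hω.const_cpow (Or.inl (by exact_mod_cast hy.ne'))
  have hpos : ∀ y ∈ Ioo (x / 2) (2 * x), 0 < y := fun y hy => lt_trans (by linarith) hy.1
  have key := hasDerivAt_integral_of_dominated_loc_of_deriv_le (μ := μ) (𝕜 := ℝ)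
    (F := fun (y : ℝ) t => h t * (y : ℂ) ^ ω t)
    (F' := fun y t => (y : ℂ)⁻¹ * (ω t * h t * (y : ℂ) ^ ω t)) (x₀ := x)
    (s := Ioo (x / 2) (2 * x))
    (bound := fun t => (x / 2)⁻¹ * (‖ω t * h t * (Real.exp (Real.log (x / 2) * (ω t).re) : ℂ)‖ +
      ‖ω t * h t * (Real.exp (Real.log (2 * x) * (ω t).re) : ℂ)‖))
    (Ioo_mem_nhds (by linarith) (by linarith)) ?_ ?_ ?_ ?_ ?_ ?_
  · have := key.2
    rwa [integral_const_mul] at this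
  · filter_upwards [Ioi_mem_nhds hx] with y hy
    exact hm.mul (hmeas y hy)
  · refine ((h0 (Real.log x)).norm).mono' (hm.mul (hmeas x hx)) (ae_of_all _ fun t => ?_)
    rw [norm_mul, norm_mul, norm_ofReal_cpow hx, Complex.norm_real,
      Real.norm_of_nonneg (Real.exp_pos _).le]
  · exact ((hω.aestronglyMeasurable.mul hm).mul (hmeas x hx)).const_mul _
  · refine ae_of_all _ fun t y hy => ?_
    have hy0 := hpos y hy
    simp only [norm_mul, norm_inv, norm_ofReal_cpow hy0, Complex.norm_real, Real.norm_eq_abs,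
      abs_of_pos hy0, Real.abs_exp]
    rw [← mul_add]
    gcongr
    · exact hy.1.le
    · refine exp_mul_le_add (Real.log_le_log (by linarith) hy.1.le) (Real.log_le_log hy0 hy.2.le)
  · exact ((h1 _).norm.add (h1 _).norm).const_mul _
  · refine ae_of_all _ fun t y hy => ?_
    have := (hasDerivAt_ofReal_cpow (hpos y hy) (ω t)).const_mul (h t)
    refine this.congr_deriv ?_
    ring

/-! ### Symbols and their loop integrals -/

/-- The function `H` is holomorphic away from `0, 1, 2, …` and satisfies `H(w) = D(w+1) H(w+1)`
for a non-constant polynomial `D`. -/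
structure IsSymbol (D : Polynomial ℂ) (H : ℂ → ℂ) : Prop where
  diff : ∀ w : ℂ, (∀ n : ℕ, w ≠ n) → DifferentiableAt ℂ H w
  shift : ∀ w : ℂ, (∀ n : ℕ, w ≠ n) → w + 1 ≠ 0 → H w = D.eval (w + 1) * H (w + 1)
  deg : 0 < D.degree

/-- The loop integral of `p(w) H(w) x^w`. -/
def loopT (H : ℂ → ℂ) (c : ℝ) (p : Polynomial ℂ) (x : ℝ) : ℂ :=
  loopIntegral c (fun w => p.eval w * H w * (x : ℂ) ^ w)

lemma ne_natCast_of_im {w : ℂ} (h : w.im ≠ 0) (n : ℕ) : w ≠ n := by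
  rintro rfl; simp at h

lemma ne_natCast_of_re {w : ℂ} (h : ∀ n : ℕ, w.re ≠ n) (n : ℕ) : w ≠ n := by
  rintro rfl; simpa using h n

/-- A real number to the left of `1` that is not `0`. -/
lemma ne_natCast_of_lt_one {c : ℝ} (h1 : c < 1) (h0 : c ≠ 0) (n : ℕ) : c ≠ n := by
  rintro rfl
  have : n < 1 := by exact_mod_cast h1
  interval_cases n
  simp at h0

section Symbol

variable {D : Polynomial ℂ} {H : ℂ → ℂ}

lemma IsSymbol.continuous_line (hH : IsSymbol D H) {τ : ℂ} (hτ : τ.im ≠ 0) :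
    Continuous (fun r : ℝ => H (r + τ)) := by
  refine continuous_iff_continuousAt.2 fun r => ?_
  have h1 : ContinuousAt H ((r : ℂ) + τ) :=
    (hH.diff _ (ne_natCast_of_im (by simpa using hτ))).continuousAt
  exact ContinuousAt.comp (f := fun r : ℝ => (r : ℂ) + τ) h1 (by fun_prop)

lemma IsSymbol.continuous_segment (hH : IsSymbol D H) {c : ℝ} (h1 : c < 1) (h0 : c ≠ 0) :
    Continuous (fun t : ℝ => H (c + t * Complex.I)) := by
  refine continuous_iff_continuousAt.2 fun t => ?_
  have h1 : ContinuousAt H ((c : ℂ) + t * Complex.I) :=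
    (hH.diff _ (ne_natCast_of_re (by simpa using ne_natCast_of_lt_one h1 h0))).continuousAt
  exact ContinuousAt.comp (f := fun t : ℝ => (c : ℂ) + t * Complex.I) h1 (by fun_prop)

/-- Far to the right |D| ≥ exp A on the line, so by the shift relation a step of length 1 to the
right does not increase |H| exp(A r). The maximum over a compact interval that contains one full
step beyond this threshold is therefore a bound everywhere. -/
lemma IsSymbol.rapidDecay (hH : IsSymbol D H) {τ : ℂ} (hτ : τ.im ≠ 0) :
    RapidDecay (fun r : ℝ => H (r + τ)) := by
  intro A
  have hlim : Tendsto (fun r : ℝ => ‖D.eval ((r : ℂ) + τ + 1)‖) atTop atTop := by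
    refine D.tendsto_norm_atTop hH.deg ?_
    refine tendsto_atTop_mono (f := fun r : ℝ => r + (τ.re + 1)) (fun r => ?_)
      (tendsto_atTop_add_const_right _ _ tendsto_id)
    refine le_trans (le_of_eq ?_) (Complex.re_le_norm _)
    simp; ring
  obtain ⟨r₀, hr₀⟩ := eventually_atTop.1 (hlim.eventually_ge_atTop (Real.exp A))
  obtain ⟨C, hC⟩ := (isCompact_Icc (a := (-1 : ℝ)) (b := max r₀ (-1) + 1)).exists_bound_of_continuousOn
    (f := fun r : ℝ => H (r + τ) * (Real.exp (A * r) : ℂ))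
    (((hH.continuous_line hτ).mul (by fun_prop)).continuousOn)
  refine ⟨C, ?_⟩
  have hnorm : ∀ r : ℝ, ‖H (r + τ) * (Real.exp (A * r) : ℂ)‖ = ‖H (r + τ)‖ * Real.exp (A * r) := by
    intro r
    rw [norm_mul, Complex.norm_real, Real.norm_of_nonneg (Real.exp_pos _).le]
  have hind : ∀ n : ℕ, ∀ r : ℝ, -1 ≤ r → r ≤ max r₀ (-1) + 1 + n →
      ‖H (r + τ)‖ * Real.exp (A * r) ≤ C := by
    intro n
    induction n with
    | zero =>
      intro r h1 h2
      rw [← hnorm]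
      exact hC r ⟨h1, by simpa using h2⟩
    | succ n ih =>
      intro r h1 h2
      rcases le_or_gt r (max r₀ (-1) + 1) with h3 | h3
      · rw [← hnorm]
        exact hC r ⟨h1, h3⟩
      · have h4 := ih (r - 1) (by linarith [le_max_right r₀ (-1)]) (by push_cast at h2; linarith)
        have h5 := hr₀ (r - 1) (by linarith [le_max_left r₀ (-1)])
        have h6 := hH.shift (((r - 1 : ℝ) : ℂ) + τ) (ne_natCast_of_im (by simpa using hτ))
          (by intro h; apply hτ; simpa using congrArg Complex.im h)
        have h7 : ((r - 1 : ℝ) : ℂ) + τ + 1 = r + τ := by push_cast; ring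
        rw [h7] at h5 h6
        rw [h6, norm_mul] at h4
        refine le_trans ?_ h4
        have h8 : Real.exp (A * r) = Real.exp A * Real.exp (A * (r - 1)) := by
          rw [← Real.exp_add]; ring_nf
        rw [h8]
        have := mul_le_mul_of_nonneg_right h5
          (mul_nonneg (norm_nonneg (H (r + τ))) (Real.exp_pos (A * (r - 1))).le)
        linarith
  intro r hr
  obtain ⟨n, hn⟩ := exists_nat_ge (r - (max r₀ (-1) + 1))
  have := hind n r hr (by linarith)
  rw [neg_mul, Real.exp_neg, ← div_eq_mul_inv, le_div_iff₀ (Real.exp_pos _)]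
  exact this

lemma IsSymbol.integrableOn_line (hH : IsSymbol D H) {τ : ℂ} (hτ : τ.im ≠ 0) {c : ℝ}
    (hc : -1 ≤ c) (p : Polynomial ℂ) (A : ℝ) :
    IntegrableOn (fun r : ℝ => p.eval (r + τ) * H (r + τ) * (Real.exp (A * r) : ℂ)) (Ioi c) := by
  refine RapidDecay.integrableOn ((hH.rapidDecay hτ).polynomial_mul τ p) ?_ hc A
  exact (p.continuous.comp (by fun_prop)).mul (hH.continuous_line hτ)

lemma IsSymbol.integrableOn_line_cpow (hH : IsSymbol D H) {τ : ℂ} (hτ : τ.im ≠ 0)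
    (hτ' : τ.re = 0) {c : ℝ} (hc : -1 ≤ c) (p : Polynomial ℂ) {x : ℝ} (hx : 0 < x) :
    IntegrableOn (fun r : ℝ => p.eval (r + τ) * H (r + τ) * (x : ℂ) ^ ((r : ℂ) + τ)) (Ioi c) := by
  refine (hH.integrableOn_line hτ hc p (Real.log x)).norm.mono' ?_ (ae_of_all _ fun r => ?_)
  · refine Continuous.aestronglyMeasurable ?_
    refine ((p.continuous.comp (by fun_prop)).mul (hH.continuous_line hτ)).mul ?_
    exact Continuous.const_cpow (by fun_prop) (Or.inl (by exact_mod_cast hx.ne'))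
  · rw [norm_mul, norm_mul _ (((Real.exp _ : ℝ)) : ℂ), norm_ofReal_cpow hx, Complex.norm_real,
      Real.norm_of_nonneg (Real.exp_pos _).le]
    simp [hτ']

lemma IsSymbol.continuous_segment_cpow (hH : IsSymbol D H) {c : ℝ} (h1 : c < 1) (h0 : c ≠ 0)
    (p : Polynomial ℂ) {x : ℝ} (hx : 0 < x) :
    Continuous (fun t : ℝ => p.eval (c + t * Complex.I) * H (c + t * Complex.I) *
      (x : ℂ) ^ ((c : ℂ) + t * Complex.I)) := by
  refine ((p.continuous.comp (by fun_prop)).mul (hH.continuous_segment h1 h0)).mul ?_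
  exact Continuous.const_cpow (by fun_prop) (Or.inl (by exact_mod_cast hx.ne'))

lemma IsSymbol.hasDerivAt_line (hH : IsSymbol D H) {τ : ℂ} (hτ : τ.im ≠ 0) (hτ' : τ.re = 0) {c : ℝ}
    (hc : -1 ≤ c) (p : Polynomial ℂ) {x : ℝ} (hx : 0 < x) :
    HasDerivAt (fun y : ℝ => ∫ r in Ioi c, p.eval ((r : ℂ) + τ) * H (r + τ) * (y : ℂ) ^ ((r : ℂ) + τ))
      ((x : ℂ)⁻¹ * ∫ r in Ioi c, (Polynomial.X * p).eval ((r : ℂ) + τ) * H (r + τ) *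
        (x : ℂ) ^ ((r : ℂ) + τ)) x := by
  have := hasDerivAt_integral_cpow (μ := volume.restrict (Ioi c))
    (h := fun r : ℝ => p.eval ((r : ℂ) + τ) * H (r + τ)) (ω := fun r : ℝ => (r : ℂ) + τ)
    (((p.continuous.comp (by fun_prop)).mul (hH.continuous_line hτ)).aestronglyMeasurable)
    (by fun_prop) (fun A => by simpa [IntegrableOn, hτ'] using hH.integrableOn_line hτ hc p A)
    (fun A => by
      have := hH.integrableOn_line hτ hc (Polynomial.X * p) A
      simp only [Polynomial.eval_mul, Polynomial.eval_X] at this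
      simpa [IntegrableOn, hτ', mul_assoc] using this) hx
  simpa [Polynomial.eval_mul, mul_assoc] using this

lemma IsSymbol.hasDerivAt_segment (hH : IsSymbol D H) {c : ℝ} (h1 : c < 1) (h0 : c ≠ 0)
    (p : Polynomial ℂ) {x : ℝ} (hx : 0 < x) :
    HasDerivAt (fun y : ℝ => ∫ t in (-1 : ℝ)..1, p.eval ((c : ℂ) + t * Complex.I) *
      H (c + t * Complex.I) * (y : ℂ) ^ ((c : ℂ) + t * Complex.I))
      ((x : ℂ)⁻¹ * ∫ t in (-1 : ℝ)..1, (Polynomial.X * p).eval ((c : ℂ) + t * Complex.I) *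
      H (c + t * Complex.I) * (x : ℂ) ^ ((c : ℂ) + t * Complex.I)) x := by
  have hinteg : ∀ (q : Polynomial ℂ) (A : ℝ), Integrable (fun t : ℝ =>
      q.eval ((c : ℂ) + t * Complex.I) * H (c + t * Complex.I) * (Real.exp (A * c) : ℂ))
      (volume.restrict (Ioc (-1 : ℝ) 1)) := fun q A =>
    (Continuous.integrableOn_Icc (((q.continuous.comp (by fun_prop)).mul
      (hH.continuous_segment h1 h0)).mul continuous_const)).mono_set Ioc_subset_Icc_self
  have := hasDerivAt_integral_cpow (μ := volume.restrict (Ioc (-1 : ℝ) 1))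
    (h := fun t : ℝ => p.eval ((c : ℂ) + t * Complex.I) * H (c + t * Complex.I))
    (ω := fun t : ℝ => (c : ℂ) + t * Complex.I)
    (((p.continuous.comp (by fun_prop)).mul (hH.continuous_segment h1 h0)).aestronglyMeasurable)
    (by fun_prop) (fun A => by simpa using hinteg p A)
    (fun A => by
      have := hinteg (Polynomial.X * p) A
      simp only [Polynomial.eval_mul, Polynomial.eval_X] at this
      simpa [mul_assoc] using this) hx
  simp_rw [intervalIntegral.integral_of_le (show (-1 : ℝ) ≤ 1 by norm_num)]
  simpa [Polynomial.eval_mul, mul_assoc] using this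

/-- `x d/dx` acts on loop integrals as multiplication of the symbol by `w`. -/
lemma IsSymbol.hasDerivAt_loopT (hH : IsSymbol D H) {c : ℝ} (hc : -1 ≤ c) (h1 : c < 1) (h0 : c ≠ 0)
    (p : Polynomial ℂ) {x : ℝ} (hx : 0 < x) :
    HasDerivAt (loopT H c p) ((x : ℂ)⁻¹ * loopT H c (Polynomial.X * p) x) x := by
  have a := hH.hasDerivAt_line (τ := -Complex.I) (by simp) (by simp) hc p hx
  have b := hH.hasDerivAt_line (τ := Complex.I) (by simp) (by simp) hc p hx
  have d := hH.hasDerivAt_segment h1 h0 p hx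
  have := ((a.neg.add (d.const_mul Complex.I)).add b).const_mul (1 / (2 * (Real.pi : ℂ) * Complex.I))
  simp only [← sub_eq_add_neg] at this
  unfold loopT loopIntegral
  refine this.congr_deriv ?_
  ring

end Symbol

end

/-! ### Moving the loop across the pole at the origin -/

section

lemma loopIntegral_congr {c : ℝ} {F G : ℂ → ℂ}
    (h : ∀ w : ℂ, w.im ≠ 0 ∨ w.re = c → F w = G w) :
    loopIntegral c F = loopIntegral c G := by
  unfold loopIntegral
  have h1 : ∀ r : ℝ, F ((r : ℂ) - Complex.I) = G ((r : ℂ) - Complex.I) := fun r =>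
    h _ (Or.inl (by simp))
  have h2 : ∀ r : ℝ, F ((r : ℂ) + Complex.I) = G ((r : ℂ) + Complex.I) := fun r =>
    h _ (Or.inl (by simp))
  have h3 : ∀ t : ℝ, F ((c : ℂ) + t * Complex.I) = G ((c : ℂ) + t * Complex.I) := fun r =>
    h _ (Or.inr (by simp))
  simp only [h1, h2, h3]

lemma setIntegral_Ioi_add_one (c : ℝ) (F : ℝ → ℂ) :
    ∫ r in Ioi (c + 1), F r = ∫ r in Ioi c, F (r + 1) := by
  have := (measurePreserving_add_right (volume : Measure ℝ) 1).setIntegral_preimage_emb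
    (measurableEmbedding_addRight 1) F (Ioi (c + 1))
  rw [← this]
  congr 2
  ext r
  simp

lemma loopIntegral_add_one (c : ℝ) (F : ℂ → ℂ) :
    loopIntegral (c + 1) F = loopIntegral c (fun w => F (w + 1)) := by
  unfold loopIntegral
  rw [setIntegral_Ioi_add_one, setIntegral_Ioi_add_one]
  push_cast
  simp only [sub_add_eq_add_sub, add_right_comm]

/-- The integral over the boundary of the rectangle with corners `-1/4 ± i`, `3/4 ± i`. -/
def rectIntegral (F : ℂ → ℂ) : ℂ :=
  (∫ r in (-1 / 4 : ℝ)..(3 / 4), F ((r : ℂ) - Complex.I)) -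
    (∫ r in (-1 / 4 : ℝ)..(3 / 4), F ((r : ℂ) + Complex.I)) +
    Complex.I * (∫ t in (-1 : ℝ)..1, F (((3 / 4 : ℝ) : ℂ) + (t : ℂ) * Complex.I)) -
    Complex.I * (∫ t in (-1 : ℝ)..1, F (((-1 / 4 : ℝ) : ℂ) + (t : ℂ) * Complex.I))

lemma loopIntegral_sub {F : ℂ → ℂ}
    (h1 : IntegrableOn (fun r : ℝ => F ((r : ℂ) - Complex.I)) (Ioi (-1 / 4)))
    (h2 : IntegrableOn (fun r : ℝ => F ((r : ℂ) + Complex.I)) (Ioi (-1 / 4))) :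
    loopIntegral (-1 / 4) F =
      loopIntegral (3 / 4) F - (1 / (2 * (Real.pi : ℂ) * Complex.I)) * rectIntegral F := by
  have e1 := intervalIntegral.integral_Ioi_sub_Ioi h1 (show (-1 / 4 : ℝ) ≤ 3 / 4 by norm_num)
  have e2 := intervalIntegral.integral_Ioi_sub_Ioi h2 (show (-1 / 4 : ℝ) ≤ 3 / 4 by norm_num)
  unfold loopIntegral rectIntegral
  rw [← e1, ← e2]
  ring

/-- The boundary lines of the rectangle with corners `-1/4 ± i`, `3/4 ± i`, to the left of `1`. -/
def rectLines : Set ℂ := {w | w.re < 1 ∧ (w.im ≠ 0 ∨ w.re = -1 / 4 ∨ w.re = 3 / 4)}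

lemma ne_natCast_of_mem_rectLines {w : ℂ} (hw : w ∈ rectLines) (n : ℕ) : w ≠ n := by
  rcases hw.2 with h | h | h
  · exact ne_natCast_of_im h n
  · exact ne_natCast_of_re (ne_natCast_of_lt_one hw.1 (by rw [h]; norm_num)) n
  · exact ne_natCast_of_re (ne_natCast_of_lt_one hw.1 (by rw [h]; norm_num)) n

lemma rectIntegral_congr {F G : ℂ → ℂ} (h : ∀ w ∈ rectLines, F w = G w) :
    rectIntegral F = rectIntegral G := by
  unfold rectIntegral
  congr 1
  · congr 1
    · congr 1
      · refine intervalIntegral.integral_congr fun r hr => h _ ⟨?_, Or.inl (by simp)⟩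
        rw [uIcc_of_le (by norm_num)] at hr
        simp; linarith [hr.2]
      · refine intervalIntegral.integral_congr fun r hr => h _ ⟨?_, Or.inl (by simp)⟩
        rw [uIcc_of_le (by norm_num)] at hr
        simp; linarith [hr.2]
    · congr 1
      refine intervalIntegral.integral_congr fun t _ => h _ ⟨?_, ?_⟩ <;> norm_num
  · congr 1
    refine intervalIntegral.integral_congr fun t _ => h _ ⟨?_, ?_⟩ <;> norm_num

lemma rectIntegral_add {F G : ℂ → ℂ} (hF : ∀ w ∈ rectLines, ContinuousAt F w)
    (hG : ∀ w ∈ rectLines, ContinuousAt G w) :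
    rectIntegral (fun w => F w + G w) = rectIntegral F + rectIntegral G := by
  have hh : ∀ F : ℂ → ℂ, (∀ w ∈ rectLines, ContinuousAt F w) → ∀ τ : ℂ, τ.re = 0 → τ.im ≠ 0 →
      IntervalIntegrable (fun r : ℝ => F ((r : ℂ) + τ)) volume (-1 / 4) (3 / 4) := by
    intro F hF τ hτ hτ'
    refine ContinuousOn.intervalIntegrable fun r hr => ?_
    rw [uIcc_of_le (by norm_num)] at hr
    have : ContinuousAt F ((r : ℂ) + τ) := hF _ ⟨by simp [hτ]; linarith [hr.2], Or.inl (by simpa)⟩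
    exact (ContinuousAt.comp (f := fun r : ℝ => (r : ℂ) + τ) this (by fun_prop)).continuousWithinAt
  have hv : ∀ F : ℂ → ℂ, (∀ w ∈ rectLines, ContinuousAt F w) → ∀ c : ℝ, c = -1 / 4 ∨ c = 3 / 4 →
      IntervalIntegrable (fun t : ℝ => F ((c : ℂ) + t * Complex.I)) volume (-1) 1 := by
    intro F hF c hc
    refine ContinuousOn.intervalIntegrable fun t _ => ?_
    have : ContinuousAt F ((c : ℂ) + t * Complex.I) :=
      hF _ ⟨by rcases hc with rfl | rfl <;> norm_num, Or.inr (by simpa using hc)⟩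
    exact (ContinuousAt.comp (f := fun t : ℝ => (c : ℂ) + t * Complex.I) this
      (by fun_prop)).continuousWithinAt
  unfold rectIntegral
  rw [intervalIntegral.integral_add (by simpa [sub_eq_add_neg] using hh F hF (-Complex.I) (by simp) (by simp))
      (by simpa [sub_eq_add_neg] using hh G hG (-Complex.I) (by simp) (by simp)),
    intervalIntegral.integral_add (hh F hF Complex.I (by simp) (by simp))
      (hh G hG Complex.I (by simp) (by simp)),
    intervalIntegral.integral_add (hv F hF _ (Or.inr rfl)) (hv G hG _ (Or.inr rfl)),
    intervalIntegral.integral_add (hv F hF _ (Or.inl rfl)) (hv G hG _ (Or.inl rfl))]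
  ring

lemma rectIntegral_const_mul (a : ℂ) (F : ℂ → ℂ) :
    rectIntegral (fun w => a * F w) = a * rectIntegral F := by
  simp only [rectIntegral, intervalIntegral.integral_const_mul]
  ring

lemma isOpen_re_lt_one : IsOpen {w : ℂ | w.re < 1} := isOpen_lt Complex.continuous_re continuous_const

lemma rectIntegral_eq_zero {F : ℂ → ℂ} (hF : DifferentiableOn ℂ F {w | w.re < 1}) :
    rectIntegral F = 0 := by
  have := Complex.integral_boundary_rect_eq_zero_of_differentiableOn F
    (⟨-1 / 4, -1⟩ : ℂ) (⟨3 / 4, 1⟩ : ℂ) (hF.mono ?_)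
  · unfold rectIntegral
    simpa [sub_eq_add_neg] using this
  · intro w hw
    have h1 := (Complex.mem_reProdIm.1 hw).1
    simp only at h1
    rw [uIcc_of_le (by norm_num)] at h1
    simp only [mem_ofPred_eq]
    linarith [h1.2]

section Symbol

variable {D : Polynomial ℂ} {H : ℂ → ℂ}

lemma IsSymbol.loopT_add (hH : IsSymbol D H) {c : ℝ} (hc : -1 ≤ c) (h1 : c < 1) (h0 : c ≠ 0)
    (p q : Polynomial ℂ) {x : ℝ} (hx : 0 < x) :
    loopT H c (p + q) x = loopT H c p x + loopT H c q x := by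
  unfold loopT loopIntegral
  simp only [Polynomial.eval_add, add_mul]
  rw [intervalIntegral.integral_add ((hH.continuous_segment_cpow h1 h0 p hx).intervalIntegrable _ _)
    ((hH.continuous_segment_cpow h1 h0 q hx).intervalIntegrable _ _)]
  simp only [sub_eq_add_neg]
  rw [integral_add (hH.integrableOn_line_cpow (by simp) (by simp) hc p hx)
      (hH.integrableOn_line_cpow (by simp) (by simp) hc q hx),
    integral_add (hH.integrableOn_line_cpow (by simp) (by simp) hc p hx)
      (hH.integrableOn_line_cpow (by simp) (by simp) hc q hx)]
  ring

lemma loopT_C_mul (c : ℝ) (a : ℂ) (p : Polynomial ℂ) (x : ℝ) :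
    loopT H c (Polynomial.C a * p) x = a * loopT H c p x := by
  simp only [loopT, loopIntegral, Polynomial.eval_mul, Polynomial.eval_C, mul_assoc,
    intervalIntegral.integral_const_mul, integral_const_mul]
  ring

lemma loopT_zero (c : ℝ) (x : ℝ) : loopT H c 0 x = 0 := by
  simp [loopT, loopIntegral]

lemma IsSymbol.loopT_sum (hH : IsSymbol D H) {c : ℝ} (hc : -1 ≤ c) (h1 : c < 1) (h0 : c ≠ 0)
    {ι : Type*} (s : Finset ι) (p : ι → Polynomial ℂ) {x : ℝ} (hx : 0 < x) :
    loopT H c (∑ i ∈ s, p i) x = ∑ i ∈ s, loopT H c (p i) x := by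
  classical
  induction s using Finset.induction_on with
  | empty => simp [loopT_zero]
  | insert a s ha ih => rw [Finset.sum_insert ha, Finset.sum_insert ha, hH.loopT_add hc h1 h0 _ _ hx, ih]

lemma IsSymbol.norm_line_le (hH : IsSymbol D H) {τ : ℂ} (hτ : τ.im ≠ 0) (hτ' : τ.re = 0) {c : ℝ}
    (hc : -1 ≤ c) (p : Polynomial ℂ) (A : ℝ) :
    ∃ C, ∀ x : ℝ, 0 < x → x ≤ A →
      ‖∫ r in Ioi c, p.eval ((r : ℂ) + τ) * H (r + τ) * (x : ℂ) ^ ((r : ℂ) + τ)‖ ≤ C * x ^ c := by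
  refine ⟨∫ r in Ioi c, ‖p.eval ((r : ℂ) + τ) * H (r + τ) *
    (Real.exp (Real.log A * r) : ℂ)‖ * Real.exp (-(Real.log A * c)), fun x hx hxA => ?_⟩
  rw [← integral_mul_const]
  refine norm_integral_le_of_norm_le ?_ ((ae_restrict_mem measurableSet_Ioi).mono fun r hr => ?_)
  · exact ((hH.integrableOn_line hτ hc p _).norm.mul_const _).mul_const _
  · rw [norm_mul, norm_mul _ ((Real.exp _ : ℝ) : ℂ), norm_ofReal_cpow hx, Complex.norm_real,
      Real.norm_of_nonneg (Real.exp_pos _).le, mul_assoc, mul_assoc, Real.rpow_def_of_pos hx,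
      ← Real.exp_add, ← Real.exp_add]
    gcongr
    have hl := Real.log_le_log hx hxA
    have hr' : c < r := hr
    simp only [Complex.add_re, Complex.ofReal_re, hτ', add_zero]
    nlinarith

/-- On the loop Re w ≥ c, and x^{Re w - c} ≤ A^{Re w - c} is absorbed by the decay of the symbol.
The position c of the loop is thus the exponent at the origin: -1/4 gives an integrable singularity,
3/4 gives smallness. -/
lemma IsSymbol.norm_loopT_le (hH : IsSymbol D H) {c : ℝ} (hc : -1 ≤ c) (h1 : c < 1) (h0 : c ≠ 0)
    (p : Polynomial ℂ) (A : ℝ) :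
    ∃ C, 0 ≤ C ∧ ∀ x : ℝ, 0 < x → x ≤ A → ‖loopT H c p x‖ ≤ C * x ^ c := by
  obtain ⟨C₁, hC₁⟩ := hH.norm_line_le (τ := -Complex.I) (by simp) (by simp) hc p A
  obtain ⟨C₂, hC₂⟩ := hH.norm_line_le (τ := Complex.I) (by simp) (by simp) hc p A
  have hs : ∀ x : ℝ, 0 < x → ‖∫ t in (-1 : ℝ)..1, p.eval ((c : ℂ) + t * Complex.I) *
      H (c + t * Complex.I) * (x : ℂ) ^ ((c : ℂ) + t * Complex.I)‖ ≤
      (∫ t in (-1 : ℝ)..1, ‖p.eval ((c : ℂ) + t * Complex.I) * H (c + t * Complex.I)‖) * x ^ c := by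
    intro x hx
    rw [← intervalIntegral.integral_mul_const]
    refine intervalIntegral.norm_integral_le_of_norm_le (by norm_num) (ae_of_all _ fun t _ => ?_) ?_
    · rw [norm_mul, norm_ofReal_cpow hx, Real.rpow_def_of_pos hx]
      simp
    · refine Continuous.intervalIntegrable ?_ _ _
      exact (((p.continuous.comp (by fun_prop)).mul (hH.continuous_segment h1 h0)).norm).mul
        continuous_const
  set C₃ := ∫ t in (-1 : ℝ)..1, ‖p.eval ((c : ℂ) + t * Complex.I) * H (c + t * Complex.I)‖
  refine ⟨|‖1 / (2 * (Real.pi : ℂ) * Complex.I)‖ * (C₁ + C₃ + C₂)|, abs_nonneg _,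
    fun x hx hxA => ?_⟩
  have hxc : 0 ≤ x ^ c := Real.rpow_nonneg hx.le _
  refine le_trans ?_ (mul_le_mul_of_nonneg_right (le_abs_self _) hxc)
  unfold loopT loopIntegral
  rw [norm_mul]
  refine le_trans (mul_le_mul_of_nonneg_left ?_ (norm_nonneg _)) (mul_assoc _ _ _).ge
  have e1 := hC₁ x hx hxA
  simp only [← sub_eq_add_neg] at e1
  have e2 := hC₂ x hx hxA
  have e3 := hs x hx
  refine (norm_add₃_le).trans ?_
  rw [norm_neg, norm_mul, Complex.norm_I, one_mul]
  linarith

/-- A loop integral whose symbol has at most a simple pole at `0` is moved across this pole. -/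
lemma IsSymbol.loopT_eq_add (hH : IsSymbol D H) (p : Polynomial ℂ) {G : ℂ → ℂ}
    (hG : DifferentiableOn ℂ G {w | w.re < 1})
    (hpG : ∀ w : ℂ, (∀ n : ℕ, w ≠ n) → w * (p.eval w * H w) = G w) {x : ℝ} (hx : 0 < x) :
    loopT H (-1 / 4) p x = loopT H (3 / 4) p x -
      (1 / (2 * (Real.pi : ℂ) * Complex.I)) * (G 0 * rectIntegral (fun w => w⁻¹)) := by
  have hx0 : (x : ℂ) ≠ 0 := by exact_mod_cast hx.ne'
  unfold loopT
  rw [loopIntegral_sub]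
  · congr 2
    have hGx : DifferentiableOn ℂ (fun w => G w * (x : ℂ) ^ w) {w | w.re < 1} := by
      refine hG.mul fun w _ => ?_
      exact (differentiableAt_id.const_cpow (Or.inl hx0)).differentiableWithinAt
    have hds : DifferentiableOn ℂ (dslope (fun w => G w * (x : ℂ) ^ w) 0) {w | w.re < 1} :=
      (Complex.differentiableOn_dslope (isOpen_re_lt_one.mem_nhds (by simp))).2 hGx
    have hne : ∀ w ∈ rectLines, w ≠ 0 := fun w hw => by
      simpa using ne_natCast_of_mem_rectLines hw 0
    -- The integrand is G(w) x^w / w. Splitting off G(0)/w leaves a divided difference, holomorphic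
    -- in Re w < 1, which Cauchy's theorem kills. The integral of 1/w is never evaluated: it matters
    -- only that this term does not depend on x.
    rw [rectIntegral_congr (G := fun w => dslope (fun w => G w * (x : ℂ) ^ w) 0 w + G 0 * w⁻¹),
      rectIntegral_add, rectIntegral_eq_zero hds, rectIntegral_const_mul, zero_add]
    · exact fun w hw => (hds.differentiableAt (isOpen_re_lt_one.mem_nhds hw.1)).continuousAt
    · exact fun w hw => continuousAt_const.mul (continuousAt_inv₀ (hne w hw))
    · intro w hw
      have h0 := hne w hw
      rw [dslope_of_ne _ h0, slope_def_field, ← hpG w (ne_natCast_of_mem_rectLines hw)]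
      simp only [sub_zero, Complex.cpow_zero, mul_one]
      field_simp
      ring
  · simpa only [sub_eq_add_neg] using
      hH.integrableOn_line_cpow (τ := -Complex.I) (by simp) (by simp) (by norm_num) p hx
  · exact hH.integrableOn_line_cpow (τ := Complex.I) (by simp) (by simp) (by norm_num) p hx

lemma tendsto_mul_rpow_zero (C : ℝ) {a : ℝ} (ha : 0 < a) :
    Tendsto (fun x : ℝ => C * x ^ a) (𝓝[>] 0) (𝓝 0) := by
  have : ContinuousAt (fun x : ℝ => C * x ^ a) 0 :=
    continuousAt_const.mul (Real.continuousAt_rpow_const _ _ (Or.inr ha.le))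
  have h2 := this.tendsto
  simp only [Real.zero_rpow ha.ne', mul_zero] at h2
  exact h2.mono_left nhdsWithin_le_nhds

/-- Once the loop is moved to 3/4 its integral is O(x^{3/4}), so only the contribution of the simple
pole at 0 survives, and that is constant in x. -/
lemma IsSymbol.tendsto_loopT (hH : IsSymbol D H) (p : Polynomial ℂ) {G : ℂ → ℂ}
    (hG : DifferentiableOn ℂ G {w | w.re < 1})
    (hpG : ∀ w : ℂ, (∀ n : ℕ, w ≠ n) → w * (p.eval w * H w) = G w) :
    ∃ l, Tendsto (loopT H (-1 / 4) p) (𝓝[>] 0) (𝓝 l) := by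
  refine ⟨0 - (1 / (2 * (Real.pi : ℂ) * Complex.I)) * (G 0 * rectIntegral (fun w => w⁻¹)), ?_⟩
  obtain ⟨C, -, hC⟩ := hH.norm_loopT_le (c := 3 / 4) (by norm_num) (by norm_num) (by norm_num) p 1
  have h1 : Tendsto (loopT H (3 / 4) p) (𝓝[>] 0) (𝓝 0) := by
    refine squeeze_zero_norm' ?_ (tendsto_mul_rpow_zero C (a := 3 / 4) (by norm_num))
    filter_upwards [Ioc_mem_nhdsGT (show (0 : ℝ) < 1 by norm_num)] with x hx
    exact hC x hx.1 hx.2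
  refine (h1.sub_const _).congr' ?_
  filter_upwards [self_mem_nhdsWithin] with x hx
  exact (hH.loopT_eq_add p hG hpG hx).symm

/-- Without a pole at 0 the loop moves to 3/4 at no cost: the regular part is then w G(w), which
vanishes at 0. -/
lemma IsSymbol.norm_loopT_le_of_holomorphic (hH : IsSymbol D H) (p : Polynomial ℂ) {G : ℂ → ℂ}
    (hG : DifferentiableOn ℂ G {w | w.re < 1})
    (hpG : ∀ w : ℂ, (∀ n : ℕ, w ≠ n) → p.eval w * H w = G w) (A : ℝ) :
    ∃ C, 0 ≤ C ∧ ∀ x : ℝ, 0 < x → x ≤ A → ‖loopT H (-1 / 4) p x‖ ≤ C * x ^ (3 / 4 : ℝ) := by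
  obtain ⟨C, h0, hC⟩ := hH.norm_loopT_le (c := 3 / 4) (by norm_num) (by norm_num) (by norm_num) p A
  refine ⟨C, h0, fun x hx hxA => ?_⟩
  rw [hH.loopT_eq_add p (G := fun w => w * G w) (differentiableOn_id.mul hG)
    (fun w hw => by rw [hpG w hw]) hx]
  simpa using hC x hx hxA

/-- The differential equation `D(x d/dx) T = x T`. -/
lemma IsSymbol.loopT_shift (hH : IsSymbol D H) {x : ℝ} (hx : 0 < x) :
    loopT H (-1 / 4) D x = x * loopT H (-1 / 4) 1 x := by
  have hx0 : (x : ℂ) ≠ 0 := by exact_mod_cast hx.ne'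
  have hshift : ∀ w : ℂ, (∀ n : ℕ, w ≠ n) → D.eval w * H w = H (w - 1) := by
    intro w hw
    have := hH.shift (w - 1) (fun n h => hw (n + 1) (by push_cast; linear_combination h))
      (by simpa using hw 0)
    rw [this]; ring_nf
  -- The symbol D(w) H(w) = H(w-1) has no pole to the left of 1, so the loop moves from -1/4 to 3/4
  -- without a residue. Translating it back by 1 then replaces x^w by x^{w+1}.
  rw [hH.loopT_eq_add D (G := fun w => w * H (w - 1)) ?_ (fun w hw => by rw [hshift w hw]) hx]
  · simp only [zero_mul, mul_zero, sub_zero]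
    have e : (3 / 4 : ℝ) = -1 / 4 + 1 := by norm_num
    unfold loopT
    rw [e, loopIntegral_add_one]
    have : (fun w : ℂ => (x : ℂ) * ((1 : Polynomial ℂ).eval w * H w * (x : ℂ) ^ w)) =
        fun w => H w * (x : ℂ) ^ (w + 1) := by
      funext w
      rw [Complex.cpow_add _ _ hx0, Complex.cpow_one, Polynomial.eval_one]
      ring
    have e2 : (x : ℂ) * loopIntegral (-1 / 4) (fun w => (1 : Polynomial ℂ).eval w * H w * (x : ℂ) ^ w)
        = loopIntegral (-1 / 4) (fun w => H w * (x : ℂ) ^ (w + 1)) := by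
      rw [← this]
      simp only [loopIntegral, intervalIntegral.integral_const_mul, integral_const_mul]
      ring
    rw [e2]
    refine loopIntegral_congr fun w hw => ?_
    rw [hshift, add_sub_cancel_right]
    rcases hw with h | h
    · exact ne_natCast_of_im (by simpa using h)
    · refine ne_natCast_of_re (ne_natCast_of_lt_one ?_ ?_) <;> simp [h] <;> norm_num
  · intro w hw
    have : DifferentiableAt ℂ H (w - 1) := hH.diff _ fun n h => by
      have h2 : w.re - 1 = n := by simpa using congrArg Complex.re h
      have h3 : w.re < 1 := hw
      have : (0 : ℝ) ≤ n := n.cast_nonneg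
      linarith
    have h2 : DifferentiableAt ℂ (fun w => H (w - 1)) w :=
      DifferentiableAt.comp (f := fun w : ℂ => w - 1) w this (by fun_prop)
    exact (differentiableAt_id.mul h2).differentiableWithinAt

end Symbol

end

section

variable {M : ℕ}

/-! ### The functions `φ_j` and `ψ_j` -/

/-- The symbol of `f`. -/
def symbF (ν : Fin (M + 1) → ℕ) (w : ℂ) : ℂ :=
  Complex.Gamma (-w) * ∏ i : Fin M, (Complex.Gamma (1 + ν i.succ + w))⁻¹

/-- The symbol of `g`. -/
def symbG (ν : Fin (M + 1) → ℕ) (w : ℂ) : ℂ :=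
  (∏ i : Fin M, Complex.Gamma (ν i.succ - w)) * (Complex.Gamma (1 + w))⁻¹

/-- The polynomial `∏_{i=1}^M (X - ν_i)`. -/
def polyA (ν : Fin (M + 1) → ℕ) : Polynomial ℂ :=
  ∏ l : Fin M, (Polynomial.X - Polynomial.C (ν l.succ : ℂ))

/-- The polynomial `∏_{i=0}^M (X + ν_i)`. -/
def polyB (ν : Fin (M + 1) → ℕ) : Polynomial ℂ :=
  ∏ l : Fin (M + 1), (Polynomial.X + Polynomial.C (ν l : ℂ))

lemma natDegree_polyA (ν : Fin (M + 1) → ℕ) : (polyA ν).natDegree = M := by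
  unfold polyA
  rw [Polynomial.natDegree_prod_of_monic _ _ fun _ _ => Polynomial.monic_X_sub_C _]
  simp only [Polynomial.natDegree_X_sub_C, Finset.sum_const, Finset.card_univ, Fintype.card_fin,
    smul_eq_mul, mul_one]

lemma monic_polyA (ν : Fin (M + 1) → ℕ) : (polyA ν).Monic :=
  Polynomial.monic_prod_of_monic _ _ fun _ _ => Polynomial.monic_X_sub_C _

lemma natDegree_polyB (ν : Fin (M + 1) → ℕ) : (polyB ν).natDegree = M + 1 := by
  unfold polyB
  rw [Polynomial.natDegree_prod_of_monic _ _ fun _ _ => Polynomial.monic_X_add_C _]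
  simp only [Polynomial.natDegree_X_add_C, Finset.sum_const, Finset.card_univ, Fintype.card_fin,
    smul_eq_mul, mul_one]

lemma monic_polyB (ν : Fin (M + 1) → ℕ) : (polyB ν).Monic :=
  Polynomial.monic_prod_of_monic _ _ fun _ _ => Polynomial.monic_X_add_C _

lemma f_eq_loopT {ν : Fin (M + 1) → ℕ} (hν : ν 0 = 0) (x : ℝ) :
    f ν x = loopT (symbF ν) (-1 / 4) 1 x := by
  unfold f meijerG loopT
  congr 1
  funext w
  simp [meijerIntegrand, symbF, Finset.prod_filter, Fin.prod_univ_succ, hν, div_eq_mul_inv]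

lemma g_eq_loopT {ν : Fin (M + 1) → ℕ} (hν : ν 0 = 0) (x : ℝ) :
    g ν x = loopT (symbG ν) (-1 / 4) 1 x := by
  unfold g meijerG loopT
  congr 1
  funext w
  have hlt : ∀ i : Fin M, ¬ M ≤ (i : ℕ) := fun i => not_le.2 i.2
  simp [meijerIntegrand, symbG, hlt, Finset.prod_filter, Fin.prod_univ_castSucc, hν, div_eq_mul_inv]

lemma differentiable_inv_Gamma_comp (a : ℂ) :
    Differentiable ℂ (fun w => (Complex.Gamma (a + w))⁻¹) :=
  Complex.differentiable_one_div_Gamma.comp (differentiable_const a |>.add differentiable_id)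

lemma differentiableAt_Gamma_natCast_sub {w : ℂ} (k : ℕ) (hw : ∀ n : ℕ, w ≠ n) :
    DifferentiableAt ℂ (fun w => Complex.Gamma (k - w)) w := by
  have : DifferentiableAt ℂ Complex.Gamma (k - w) := by
    refine Complex.differentiableAt_Gamma _ fun m h => hw (k + m) ?_
    push_cast
    linear_combination -h
  exact DifferentiableAt.comp (f := fun w : ℂ => (k : ℂ) - w) w this (by fun_prop)

lemma differentiableAt_Gamma_natCast_sub' {w : ℂ} {k : ℕ} (hk : 1 ≤ k) (hw : w.re < 1) :
    DifferentiableAt ℂ (fun w => Complex.Gamma (k - w)) w := by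
  have : DifferentiableAt ℂ Complex.Gamma (k - w) := by
    refine Complex.differentiableAt_Gamma _ fun m h => ?_
    have h2 := congrArg Complex.re h
    simp only [Complex.sub_re, Complex.natCast_re, Complex.neg_re] at h2
    have : (1 : ℝ) ≤ k := by exact_mod_cast hk
    have : (0 : ℝ) ≤ m := m.cast_nonneg
    linarith
  exact DifferentiableAt.comp (f := fun w : ℂ => (k : ℂ) - w) w this (by fun_prop)

/-- From Γ(-w) = -(w+1) Γ(-w-1) and 1/Γ(z) = z/Γ(z+1). The factor w+1 is the one of index 0 in
`polyB`, because ν_0 = 0. -/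
lemma isSymbol_symbF {ν : Fin (M + 1) → ℕ} (hν : ν 0 = 0) : IsSymbol (-polyB ν) (symbF ν) where
  diff w hw := by
    refine DifferentiableAt.mul ?_ ?_
    · simpa using differentiableAt_Gamma_natCast_sub 0 hw
    · exact DifferentiableAt.fun_finsetProd fun i _ =>
        (differentiable_inv_Gamma_comp (1 + (ν i.succ : ℂ))).differentiableAt
  shift w hw hw1 := by
    have h1 : Complex.Gamma (-w) = -(w + 1) * Complex.Gamma (-(w + 1)) := by
      rw [← Complex.Gamma_add_one _ (neg_ne_zero.2 hw1)]
      ring_nf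
    have h2 : ∀ i : Fin M, (Complex.Gamma (1 + ν i.succ + w))⁻¹ =
        (w + 1 + ν i.succ) * (Complex.Gamma (1 + ν i.succ + (w + 1)))⁻¹ := by
      intro i
      rw [Complex.one_div_Gamma_eq_self_mul_one_div_Gamma_add_one]
      ring_nf
    simp only [symbF, h1, h2, Finset.prod_mul_distrib, polyB, Polynomial.eval_neg,
      Polynomial.eval_prod, Polynomial.eval_add, Polynomial.eval_X, Polynomial.eval_C]
    rw [Fin.prod_univ_succ, hν, Nat.cast_zero, add_zero]
    ring
  deg := by
    rw [Polynomial.degree_neg]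
    refine Polynomial.natDegree_pos_iff_degree_pos.1 ?_
    rw [natDegree_polyB]
    exact Nat.succ_pos M

lemma isSymbol_symbG (ν : Fin (M + 1) → ℕ) :
    IsSymbol (Polynomial.C ((-1) ^ M) * (Polynomial.X * polyA ν)) (symbG ν) where
  diff w hw := by
    refine DifferentiableAt.mul ?_ ?_
    · exact DifferentiableAt.fun_finsetProd fun i _ => differentiableAt_Gamma_natCast_sub _ hw
    · exact (differentiable_inv_Gamma_comp 1).differentiableAt
  shift w hw hw1 := by
    have h1 : ∀ i : Fin M, Complex.Gamma (ν i.succ - w) =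
        -1 * (w + 1 - ν i.succ) * Complex.Gamma (ν i.succ - (w + 1)) := by
      intro i
      -- For ν_i = 0 this is the hypothesis w ≠ -1; for ν_i ≥ 1 it excludes the natural number w =
      -- ν_i - 1.
      have h0 : (ν i.succ : ℂ) - (w + 1) ≠ 0 := by
        intro h
        rcases Nat.eq_zero_or_pos (ν i.succ) with hz | hz
        · rw [hz] at h
          apply hw1
          linear_combination -h - (Nat.cast_zero : ((0 : ℕ) : ℂ) = 0)
        · apply hw (ν i.succ - 1)
          push_cast [hz]
          linear_combination -h
      have := Complex.Gamma_add_one _ h0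
      have e : (ν i.succ : ℂ) - (w + 1) + 1 = ν i.succ - w := by ring
      rw [e] at this
      rw [this]
      ring
    have h2 : (Complex.Gamma (1 + w))⁻¹ = (w + 1) * (Complex.Gamma (1 + (w + 1)))⁻¹ := by
      rw [Complex.one_div_Gamma_eq_self_mul_one_div_Gamma_add_one]
      ring_nf
    simp only [symbG, h1, h2, Finset.prod_mul_distrib, polyA, Polynomial.eval_mul,
      Polynomial.eval_prod, Polynomial.eval_sub, Polynomial.eval_X, Polynomial.eval_C,
      Finset.prod_const, Finset.card_univ, Fintype.card_fin]
    ring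
  deg := by
    have h1 : (Polynomial.X * polyA ν).natDegree = M + 1 := by
      rw [Polynomial.natDegree_X_mul (monic_polyA ν).ne_zero, natDegree_polyA]
    rw [Polynomial.degree_C_mul (pow_ne_zero _ (by norm_num))]
    refine Polynomial.natDegree_pos_iff_degree_pos.1 ?_
    rw [h1]
    exact Nat.succ_pos M

/-- The regular part of the symbol of `f`. -/
def symbF' (ν : Fin (M + 1) → ℕ) (w : ℂ) : ℂ :=
  -(Complex.Gamma ((1 : ℕ) - w)) * ∏ i : Fin M, (Complex.Gamma (1 + ν i.succ + w))⁻¹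

lemma mul_symbF (ν : Fin (M + 1) → ℕ) {w : ℂ} (hw : w ≠ 0) : w * symbF ν w = symbF' ν w := by
  have h := Complex.Gamma_add_one (-w) (neg_ne_zero.2 hw)
  have e : -w + 1 = ((1 : ℕ) : ℂ) - w := by push_cast; ring
  rw [e] at h
  rw [symbF, symbF', h]
  ring

lemma differentiableOn_symbF' (ν : Fin (M + 1) → ℕ) :
    DifferentiableOn ℂ (symbF' ν) {w | w.re < 1} := by
  intro w hw
  refine DifferentiableAt.differentiableWithinAt (DifferentiableAt.mul ?_ ?_)
  · exact (differentiableAt_Gamma_natCast_sub' le_rfl hw).neg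
  · exact DifferentiableAt.fun_finsetProd fun i _ =>
      (differentiable_inv_Gamma_comp (1 + (ν i.succ : ℂ))).differentiableAt

/-- The regular part of the symbol of `g`. -/
def symbG' (ν : Fin (M + 1) → ℕ) (w : ℂ) : ℂ :=
  (-1) ^ M * (∏ i : Fin M, Complex.Gamma ((ν i.succ + 1 : ℕ) - w)) * (Complex.Gamma (1 + w))⁻¹

/-- Each factor w - ν_i raises the argument of its Gamma factor by one, so the poles start at ν_i +
1 ≥ 1. Hence the symbol of ψ_0 is regular at 0. -/
lemma polyA_mul_symbG (ν : Fin (M + 1) → ℕ) {w : ℂ} (hw : ∀ n : ℕ, w ≠ n) :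
    (polyA ν).eval w * symbG ν w = symbG' ν w := by
  have h1 : ∀ i : Fin M, Complex.Gamma ((ν i.succ + 1 : ℕ) - w) =
      -1 * (w - ν i.succ) * Complex.Gamma (ν i.succ - w) := by
    intro i
    have := Complex.Gamma_add_one ((ν i.succ : ℂ) - w) (fun h => hw (ν i.succ)
      (by linear_combination -h))
    have e : ((ν i.succ + 1 : ℕ) : ℂ) - w = ν i.succ - w + 1 := by push_cast; ring
    rw [e, this]
    ring
  have hs : ((-1 : ℂ)) ^ M * (-1) ^ M = 1 := by rw [← mul_pow]; simp
  simp only [symbG, symbG', h1, Finset.prod_mul_distrib, polyA,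
      Polynomial.eval_prod, Polynomial.eval_sub, Polynomial.eval_X, Polynomial.eval_C,
      Finset.prod_const, Finset.card_univ, Fintype.card_fin]
  linear_combination -(∏ x : Fin M, (w - ν x.succ)) *
    (∏ x : Fin M, Complex.Gamma (ν x.succ - w)) * (Complex.Gamma (1 + w))⁻¹ * hs

lemma differentiableOn_symbG' (ν : Fin (M + 1) → ℕ) :
    DifferentiableOn ℂ (symbG' ν) {w | w.re < 1} := by
  intro w hw
  refine DifferentiableAt.differentiableWithinAt (DifferentiableAt.mul
    (DifferentiableAt.const_mul ?_ _) ?_)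
  · exact DifferentiableAt.fun_finsetProd fun i _ =>
      differentiableAt_Gamma_natCast_sub' (Nat.le_add_left 1 _) hw
  · exact (differentiable_inv_Gamma_comp 1).differentiableAt

/-- If at most one of `ν_1, …, ν_M` is zero, the symbol of `g` has at most a simple pole at `0`. -/
lemma exists_mul_symbG {ν : Fin (M + 1) → ℕ}
    (h : (Finset.univ.filter (fun l : Fin M => ν l.succ = 0)).card ≤ 1) :
    ∃ G : ℂ → ℂ, DifferentiableOn ℂ G {w | w.re < 1} ∧
      ∀ w : ℂ, (∀ n : ℕ, w ≠ n) → w * symbG ν w = G w := by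
  rcases Nat.eq_zero_or_pos (Finset.univ.filter (fun l : Fin M => ν l.succ = 0)).card with h0 | h0
  · rw [Finset.card_eq_zero, Finset.filter_eq_empty_iff] at h0
    refine ⟨fun w => w * symbG ν w, ?_, fun w _ => rfl⟩
    intro w hw
    refine (differentiableAt_id.mul (DifferentiableAt.mul ?_ ?_)).differentiableWithinAt
    · exact DifferentiableAt.fun_finsetProd fun i _ => differentiableAt_Gamma_natCast_sub'
        (Nat.one_le_iff_ne_zero.2 (h0 (Finset.mem_univ i))) hw
    · exact (differentiable_inv_Gamma_comp 1).differentiableAt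
  · obtain ⟨i₀, hi₀⟩ := Finset.card_eq_one.1 (le_antisymm h h0)
    have hz : ν i₀.succ = 0 := by
      have : i₀ ∈ Finset.univ.filter (fun l : Fin M => ν l.succ = 0) := by rw [hi₀]; simp
      simpa using this
    have hnz : ∀ i : Fin M, i ≠ i₀ → 1 ≤ ν i.succ := by
      intro i hi
      refine Nat.one_le_iff_ne_zero.2 fun hi0 => hi ?_
      have : i ∈ Finset.univ.filter (fun l : Fin M => ν l.succ = 0) := by simpa using hi0
      rw [hi₀] at this
      simpa using this
    refine ⟨fun w => -(Complex.Gamma ((1 : ℕ) - w)) *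
      (∏ i ∈ Finset.univ.erase i₀, Complex.Gamma (ν i.succ - w)) * (Complex.Gamma (1 + w))⁻¹,
      ?_, ?_⟩
    · intro w hw
      refine (((differentiableAt_Gamma_natCast_sub' le_rfl hw).neg.mul
        ?_).mul (differentiable_inv_Gamma_comp 1).differentiableAt).differentiableWithinAt
      exact DifferentiableAt.fun_finsetProd fun i hi => differentiableAt_Gamma_natCast_sub'
        (hnz i (Finset.ne_of_mem_erase hi)) hw
    · intro w hw
      have hw0 : w ≠ 0 := by simpa using hw 0
      have h := Complex.Gamma_add_one (-w) (neg_ne_zero.2 hw0)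
      have e : -w + 1 = ((1 : ℕ) : ℂ) - w := by push_cast; ring
      rw [e] at h
      beta_reduce
      rw [symbG, ← Finset.mul_prod_erase Finset.univ _ (Finset.mem_univ i₀), h, hz]
      simp only [Nat.cast_zero, zero_sub]
      ring

lemma euler_iterate_eq_loopT {D : Polynomial ℂ} {H : ℂ → ℂ} (hH : IsSymbol D H) {h : ℝ → ℂ}
    (hh : ∀ x, 0 < x → h x = loopT H (-1 / 4) 1 x) (j : ℕ) :
    ∀ x, 0 < x → (euler^[j] h) x = loopT H (-1 / 4) (Polynomial.X ^ j) x := by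
  induction j with
  | zero => simpa using hh
  | succ j ih =>
    intro x hx
    rw [Function.iterate_succ_apply', euler]
    have h1 : euler^[j] h =ᶠ[𝓝 x] loopT H (-1 / 4) (Polynomial.X ^ j) := by
      filter_upwards [Ioi_mem_nhds hx] with y hy using ih y hy
    rw [h1.deriv_eq, (hH.hasDerivAt_loopT (by norm_num) (by norm_num) (by norm_num) _ hx).deriv,
      ← mul_assoc, mul_inv_cancel₀ (by exact_mod_cast hx.ne'), one_mul, pow_succ']

lemma phi_eq_loopT {ν : Fin (M + 1) → ℕ} (hν : ν 0 = 0) (j : ℕ) {x : ℝ} (hx : 0 < x) :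
    phi ν j x = (-1) ^ (M - j + 1) * loopT (symbF ν) (-1 / 4) (Polynomial.X ^ j) x := by
  rw [phi, euler_iterate_eq_loopT (isSymbol_symbF hν) (fun x _ => f_eq_loopT hν x) j x hx]

/-- The polynomial `∑_i α_{i+j} X^i`. -/
def polyQ (ν : Fin (M + 1) → ℕ) (j : ℕ) : Polynomial ℂ := Polynomial.divX^[j] (polyA ν)

lemma coeff_polyQ (ν : Fin (M + 1) → ℕ) (j i : ℕ) : (polyQ ν j).coeff i = alpha ν (i + j) := by
  induction j generalizing i with
  | zero => rfl
  | succ j ih =>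
    rw [polyQ, Function.iterate_succ_apply', Polynomial.coeff_divX]
    change (polyQ ν j).coeff (i + 1) = _
    rw [ih]
    congr 1
    ring

/-- Horner's scheme for `polyA`. It expresses the Euler derivative of ψ_{j+1} through ψ_j and ψ_M.
-/
lemma X_mul_polyQ (ν : Fin (M + 1) → ℕ) (j : ℕ) :
    Polynomial.X * polyQ ν (j + 1) + Polynomial.C (alpha ν j) = polyQ ν j := by
  have := Polynomial.X_mul_divX_add (polyQ ν j)
  rw [coeff_polyQ, zero_add] at this
  rw [polyQ, Function.iterate_succ_apply']
  exact this

lemma natDegree_polyQ_le (ν : Fin (M + 1) → ℕ) {j : ℕ} : (polyQ ν j).natDegree ≤ M - j := by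
  rw [Polynomial.natDegree_le_iff_coeff_eq_zero]
  intro i hi
  rw [coeff_polyQ]
  exact Polynomial.coeff_eq_zero_of_natDegree_lt (by
    change (polyA ν).natDegree < _
    rw [natDegree_polyA]
    omega)

lemma polyQ_last (ν : Fin (M + 1) → ℕ) : polyQ ν M = 1 := by
  have h := natDegree_polyQ_le ν (j := M)
  rw [Nat.sub_self, Nat.le_zero] at h
  rw [Polynomial.eq_C_of_natDegree_eq_zero h, coeff_polyQ, zero_add]
  have : (polyA ν).coeff M = 1 := by
    have := monic_polyA ν
    rwa [Polynomial.Monic, Polynomial.leadingCoeff, natDegree_polyA] at this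
  change Polynomial.C ((polyA ν).coeff M) = 1
  rw [this, Polynomial.C_1]

lemma psi_eq_loopT {ν : Fin (M + 1) → ℕ} (hν : ν 0 = 0) (j : ℕ) {y : ℝ} (hy : 0 < y) :
    psi ν j y = loopT (symbG ν) (-1 / 4) (polyQ ν j) y := by
  conv_rhs => rw [(polyQ ν j).as_sum_range_C_mul_X_pow' (n := M - j + 1)
    (Nat.lt_succ_of_le (natDegree_polyQ_le ν))]
  rw [(isSymbol_symbG ν).loopT_sum (by norm_num) (by norm_num) (by norm_num) _ _ hy, psi]
  refine Finset.sum_congr rfl fun i _ => ?_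
  rw [loopT_C_mul, coeff_polyQ,
    euler_iterate_eq_loopT (isSymbol_symbG ν) (fun x _ => g_eq_loopT hν x) i y hy]

end

/-! ### The first order systems for φ_j and ψ_j, and their behaviour at the origin -/

section

variable {M : ℕ}

/-- The numbers `(-1)^{M+1-j} e_{M+1-j}(ν_0, …, ν_M)`. -/
def eps (ν : Fin (M + 1) → ℕ) (j : ℕ) : ℂ := (-1) ^ (M + 1 - j) * esymmNu ν (M + 1 - j)

lemma eps_eq_coeff {ν : Fin (M + 1) → ℕ} (hν : ν 0 = 0) {j : ℕ} (hj : j ≤ M) :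
    eps ν j = (Polynomial.X * polyA ν).coeff j := by
  have h1 : (Polynomial.X * polyA ν) =
      ((Finset.univ.val.map (fun l : Fin (M + 1) => (ν l : ℂ))).map
        fun t => Polynomial.X - Polynomial.C t).prod := by
    rw [Multiset.map_map]
    change _ = ∏ l : Fin (M + 1), (Polynomial.X - Polynomial.C (ν l : ℂ))
    rw [Fin.prod_univ_succ, hν, Nat.cast_zero, Polynomial.C_0, sub_zero]
    rfl
  rw [h1, Multiset.prod_X_sub_C_coeff _ (by simp; omega)]
  simp [eps, esymmNu]

lemma eps_zero {ν : Fin (M + 1) → ℕ} (hν : ν 0 = 0) : eps ν 0 = 0 := by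
  rw [eps_eq_coeff hν (Nat.zero_le _), Polynomial.coeff_X_mul_zero]

lemma eps_succ {ν : Fin (M + 1) → ℕ} (hν : ν 0 = 0) {j : ℕ} (hj : j < M) :
    eps ν (j + 1) = alpha ν j := by
  rw [eps_eq_coeff hν (Nat.succ_le_of_lt hj), Polynomial.coeff_X_mul]
  rfl

lemma coeff_polyB (ν : Fin (M + 1) → ℕ) {j : ℕ} (hj : j ≤ M) :
    (polyB ν).coeff j = esymmNu ν (M + 1 - j) := by
  have h1 : polyB ν = ((Finset.univ.val.map (fun l : Fin (M + 1) => (ν l : ℂ))).map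
        fun t => Polynomial.X + Polynomial.C t).prod := by
    rw [Multiset.map_map]
    rfl
  rw [h1, Multiset.prod_X_add_C_coeff _ (by simp; omega)]
  simp [esymmNu]

lemma polyB_eq (ν : Fin (M + 1) → ℕ) : polyB ν = (∑ i ∈ Finset.range (M + 1),
    Polynomial.C (esymmNu ν (M + 1 - i)) * Polynomial.X ^ i) + Polynomial.X ^ (M + 1) := by
  conv_lhs => rw [(polyB ν).as_sum_range_C_mul_X_pow' (n := M + 2) (by rw [natDegree_polyB]; omega)]
  rw [Finset.sum_range_succ]
  congr 1
  · refine Finset.sum_congr rfl fun i hi => ?_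
    rw [coeff_polyB ν (by simpa [Nat.lt_succ_iff] using hi)]
  · have := monic_polyB ν
    rw [Polynomial.Monic, Polynomial.leadingCoeff, natDegree_polyB] at this
    rw [this, Polynomial.C_1, one_mul]

/-- `x d/dx` applied to `φ_j`. -/
def thetaPhi (ν : Fin (M + 1) → ℕ) (j : ℕ) (x : ℝ) : ℂ :=
  if j < M then -phi ν (j + 1) x
  else (-1) ^ (M + 1) * x * phi ν 0 x + ∑ i ∈ Finset.range (M + 1), eps ν i * phi ν i x

/-- `y d/dy` applied to `ψ_j`. -/
def thetaPsi (ν : Fin (M + 1) → ℕ) (j : ℕ) (y : ℝ) : ℂ :=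
  if j = 0 then (-1) ^ M * y * psi ν M y else psi ν (j - 1) y - eps ν j * psi ν M y

lemma neg_one_pow_mul_self (n : ℕ) : (-1 : ℂ) ^ n * (-1) ^ n = 1 := by
  rw [← mul_pow]; simp

lemma hasDerivAt_phi_aux {ν : Fin (M + 1) → ℕ} (hν : ν 0 = 0) (j : ℕ) {x : ℝ} (hx : 0 < x) :
    HasDerivAt (phi ν j) ((x : ℂ)⁻¹ * ((-1) ^ (M - j + 1) *
      loopT (symbF ν) (-1 / 4) (Polynomial.X ^ (j + 1)) x)) x := by
  have h1 := ((isSymbol_symbF hν).hasDerivAt_loopT (c := -1 / 4) (by norm_num) (by norm_num)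
    (by norm_num) (Polynomial.X ^ j) hx).const_mul ((-1 : ℂ) ^ (M - j + 1))
  rw [← pow_succ'] at h1
  have h2 : phi ν j =ᶠ[𝓝 x] fun y => (-1) ^ (M - j + 1) *
      loopT (symbF ν) (-1 / 4) (Polynomial.X ^ j) y := by
    filter_upwards [Ioi_mem_nhds hx] with y hy using phi_eq_loopT hν j hy
  refine (h1.congr_of_eventuallyEq h2).congr_deriv ?_
  ring

/-- For j < M only the sign (-1)^{M-j+1} changes. For j = M the Euler derivative of order M+1 is
eliminated with the equation -B(x d/dx) f = x f, B = ∏ (X + ν_l), whose lower coefficients are the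
elementary symmetric polynomials. -/
lemma hasDerivAt_phi {ν : Fin (M + 1) → ℕ} (hν : ν 0 = 0) {j : ℕ} (hj : j ≤ M) {x : ℝ}
    (hx : 0 < x) : HasDerivAt (phi ν j) ((x : ℂ)⁻¹ * thetaPhi ν j x) x := by
  refine (hasDerivAt_phi_aux hν j hx).congr_deriv ?_
  congr 1
  unfold thetaPhi
  split_ifs with h
  · rw [phi_eq_loopT hν _ hx, show M - j + 1 = (M - (j + 1) + 1) + 1 by omega, pow_succ]
    ring
  · obtain rfl : j = M := by omega
    have hs := (isSymbol_symbF hν).loopT_shift hx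
    rw [show -polyB ν = Polynomial.C (-1) * polyB ν by simp, loopT_C_mul, polyB_eq,
      (isSymbol_symbF hν).loopT_add (by norm_num) (by norm_num) (by norm_num) _ _ hx,
      (isSymbol_symbF hν).loopT_sum (by norm_num) (by norm_num) (by norm_num) _ _ hx] at hs
    simp only [loopT_C_mul] at hs
    have h1 : ∑ i ∈ Finset.range (j + 1), eps ν i * phi ν i x = ∑ i ∈ Finset.range (j + 1),
        esymmNu ν (j + 1 - i) * loopT (symbF ν) (-1 / 4) (Polynomial.X ^ i) x := by
      refine Finset.sum_congr rfl fun i hi => ?_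
      have hi' : i ≤ j := by simpa [Nat.lt_succ_iff] using hi
      rw [phi_eq_loopT hν _ hx, eps, show j - i + 1 = j + 1 - i by omega]
      linear_combination esymmNu ν (j + 1 - i) *
        loopT (symbF ν) (-1 / 4) (Polynomial.X ^ i) x * neg_one_pow_mul_self (j + 1 - i)
    rw [h1, phi_eq_loopT hν _ hx, Nat.sub_self, Nat.sub_zero, pow_zero]
    linear_combination hs - x * loopT (symbF ν) (-1 / 4) 1 x * neg_one_pow_mul_self (j + 1)

lemma psi_last {ν : Fin (M + 1) → ℕ} (hν : ν 0 = 0) {y : ℝ} (hy : 0 < y) :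
    psi ν M y = g ν y := by
  rw [psi_eq_loopT hν _ hy, polyQ_last, g_eq_loopT hν]

lemma phi_zero (ν : Fin (M + 1) → ℕ) (x : ℝ) : phi ν 0 x = (-1) ^ (M + 1) * f ν x := by
  simp [phi]

/-- For j ≥ 1 this is Horner's scheme, as α_{j-1} is the constant `eps ν j` and ψ_M = g. For j = 0
the symbol becomes w ∏ (w - ν_i) times that of g, and the differential equation of g applies. -/
lemma hasDerivAt_psi {ν : Fin (M + 1) → ℕ} (hν : ν 0 = 0) {j : ℕ} (hj : j ≤ M) {y : ℝ}
    (hy : 0 < y) : HasDerivAt (psi ν j) ((y : ℂ)⁻¹ * thetaPsi ν j y) y := by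
  have hS := isSymbol_symbG ν
  have h1 := hS.hasDerivAt_loopT (c := -1 / 4) (by norm_num) (by norm_num)
    (by norm_num) (polyQ ν j) hy
  have h2 : psi ν j =ᶠ[𝓝 y] loopT (symbG ν) (-1 / 4) (polyQ ν j) := by
    filter_upwards [Ioi_mem_nhds hy] with z hz using psi_eq_loopT hν j hz
  refine (h1.congr_of_eventuallyEq h2).congr_deriv ?_
  congr 1
  unfold thetaPsi
  split_ifs with h
  · subst h
    have hs := hS.loopT_shift hy
    rw [loopT_C_mul] at hs
    rw [psi_eq_loopT hν _ hy, polyQ_last, polyQ, Function.iterate_zero, id]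
    linear_combination (-1) ^ M * hs - loopT (symbG ν) (-1 / 4) (Polynomial.X * polyA ν) y *
      neg_one_pow_mul_self M
  · obtain ⟨i, rfl⟩ := Nat.exists_eq_succ_of_ne_zero h
    rw [Nat.succ_eq_add_one, eps_succ hν (by omega), Nat.add_sub_cancel, psi_eq_loopT hν _ hy,
      psi_eq_loopT hν _ hy, ← X_mul_polyQ ν i, polyQ_last,
      hS.loopT_add (by norm_num) (by norm_num) (by norm_num) _ _ hy,
      show Polynomial.C (alpha ν i) = Polynomial.C (alpha ν i) * 1 by rw [mul_one], loopT_C_mul]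
    ring

lemma tendsto_phi {ν : Fin (M + 1) → ℕ} (hν : ν 0 = 0) (j : ℕ) :
    ∃ l, Tendsto (phi ν j) (𝓝[>] 0) (𝓝 l) := by
  obtain ⟨l, hl⟩ := (isSymbol_symbF hν).tendsto_loopT (Polynomial.X ^ j)
    (G := fun w => w ^ j * symbF' ν w)
    ((differentiable_id.pow j).differentiableOn.mul (differentiableOn_symbF' ν)) (by
      intro w hw
      rw [← mul_symbF ν (by simpa using hw 0)]
      simp only [Polynomial.eval_pow, Polynomial.eval_X]
      ring)
  refine ⟨_, (hl.const_mul ((-1) ^ (M - j + 1))).congr' ?_⟩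
  filter_upwards [self_mem_nhdsWithin] with x hx
  rw [phi_eq_loopT hν j hx]

/-- For j ≥ 1 the factor w^j cancels the simple pole of Γ(-w) at 0. -/
lemma norm_phi_le_rpow {ν : Fin (M + 1) → ℕ} (hν : ν 0 = 0) {j : ℕ} (hj : j ≠ 0) (A : ℝ) :
    ∃ C, 0 ≤ C ∧ ∀ x : ℝ, 0 < x → x ≤ A → ‖phi ν j x‖ ≤ C * x ^ (3 / 4 : ℝ) := by
  obtain ⟨i, rfl⟩ := Nat.exists_eq_succ_of_ne_zero hj
  obtain ⟨C, h0, hC⟩ := (isSymbol_symbF hν).norm_loopT_le_of_holomorphic (Polynomial.X ^ (i + 1))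
    (G := fun w => w ^ i * symbF' ν w)
    ((differentiable_id.pow i).differentiableOn.mul (differentiableOn_symbF' ν)) (by
      intro w hw
      rw [← mul_symbF ν (by simpa using hw 0)]
      simp only [Polynomial.eval_pow, Polynomial.eval_X]
      ring) A
  refine ⟨C, h0, fun x hx hxA => ?_⟩
  rw [phi_eq_loopT hν _ hx, norm_mul, norm_pow, norm_neg, norm_one, one_pow, one_mul]
  exact hC x hx hxA

/-- If several ν_i vanish, the pole of the symbol at 0 can have higher order and produce powers of
logarithms. The loop through -1/4 gives a crude bound that covers all cases and is still square
integrable. -/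
lemma norm_psi_le {ν : Fin (M + 1) → ℕ} (hν : ν 0 = 0) (j : ℕ) (A : ℝ) :
    ∃ C, 0 ≤ C ∧ ∀ y : ℝ, 0 < y → y ≤ A → ‖psi ν j y‖ ≤ C * y ^ (-1 / 4 : ℝ) := by
  obtain ⟨C, h0, hC⟩ := (isSymbol_symbG ν).norm_loopT_le (c := -1 / 4) (by norm_num) (by norm_num)
    (by norm_num) (polyQ ν j) A
  refine ⟨C, h0, fun y hy hyA => ?_⟩
  rw [psi_eq_loopT hν _ hy]
  exact hC y hy hyA

lemma norm_psi_zero_le {ν : Fin (M + 1) → ℕ} (hν : ν 0 = 0) (A : ℝ) :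
    ∃ C, 0 ≤ C ∧ ∀ y : ℝ, 0 < y → y ≤ A → ‖psi ν 0 y‖ ≤ C * y ^ (3 / 4 : ℝ) := by
  obtain ⟨C, h0, hC⟩ := (isSymbol_symbG ν).norm_loopT_le_of_holomorphic (polyQ ν 0)
    (differentiableOn_symbG' ν) (fun w hw => polyA_mul_symbG ν hw) A
  refine ⟨C, h0, fun y hy hyA => ?_⟩
  rw [psi_eq_loopT hν _ hy]
  exact hC y hy hyA

/-- A limit exists when the symbol has at most a simple pole at 0. With at most one ν_i = 0 this
holds for the symbol of g itself. Otherwise j ≤ 1 and α_0 = 0, so both `polyQ ν 0` and w times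
`polyQ ν 1` are ∏ (w - ν_i), which removes the pole altogether. -/
lemma tendsto_psi {ν : Fin (M + 1) → ℕ} (hν : ν 0 = 0) {j : ℕ}
    (h : j ≤ 1 ∨ (Finset.univ.filter (fun l : Fin M => ν l.succ = 0)).card ≤ 1) :
    ∃ l, Tendsto (psi ν j) (𝓝[>] 0) (𝓝 l) := by
  have key : ∃ G : ℂ → ℂ, DifferentiableOn ℂ G {w | w.re < 1} ∧
      ∀ w : ℂ, (∀ n : ℕ, w ≠ n) → w * ((polyQ ν j).eval w * symbG ν w) = G w := by
    by_cases hc : (Finset.univ.filter (fun l : Fin M => ν l.succ = 0)).card ≤ 1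
    · obtain ⟨G, hG, hG'⟩ := exists_mul_symbG hc
      refine ⟨fun w => (polyQ ν j).eval w * G w, (polyQ ν j).differentiable.differentiableOn.mul hG,
        fun w hw => ?_⟩
      beta_reduce
      rw [← hG' w hw]
      ring
    · have hj := h.resolve_right hc
      rcases Nat.le_one_iff_eq_zero_or_eq_one.1 hj with rfl | rfl
      · refine ⟨fun w => w * symbG' ν w, differentiableOn_id.mul (differentiableOn_symbG' ν),
          fun w hw => ?_⟩
        beta_reduce
        rw [← polyA_mul_symbG ν hw]
        rfl
      · refine ⟨symbG' ν, differentiableOn_symbG' ν, fun w hw => ?_⟩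
        have h0 : alpha ν 0 = 0 := by
          obtain ⟨i, hi⟩ := Finset.card_pos.1 (lt_of_lt_of_le Nat.zero_lt_one (not_le.1 hc).le)
          have hi' : ν i.succ = 0 := by simpa using hi
          change (polyA ν).coeff 0 = 0
          rw [Polynomial.coeff_zero_eq_eval_zero, polyA, Polynomial.eval_prod]
          exact Finset.prod_eq_zero (Finset.mem_univ i) (by simp [hi'])
        have h1 := X_mul_polyQ ν 0
        rw [h0, Polynomial.C_0, add_zero] at h1
        have h2 := congrArg (Polynomial.eval w) h1
        rw [Polynomial.eval_mul, Polynomial.eval_X] at h2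
        rw [← polyA_mul_symbG ν hw, ← mul_assoc, h2]
        rfl
  obtain ⟨G, hG, hG'⟩ := key
  obtain ⟨l, hl⟩ := (isSymbol_symbG ν).tendsto_loopT (polyQ ν j) hG hG'
  refine ⟨l, hl.congr' ?_⟩
  filter_upwards [self_mem_nhdsWithin] with y hy
  rw [psi_eq_loopT hν _ hy]

/-! ### The integral representation of the kernel -/

/-- The products φ_{j+1} ψ_j cancel between the two systems, and so do the terms `eps ν i` φ_i ψ_M;
for i = 0 there is no counterpart, but `eps ν 0` = 0. Only the inhomogeneous terms of θφ_M and θψ_0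
remain. -/
lemma sum_theta {ν : Fin (M + 1) → ℕ} (hν : ν 0 = 0) (x y : ℝ) :
    ∑ j ∈ Finset.range (M + 1), (thetaPhi ν j x * psi ν j y + phi ν j x * thetaPsi ν j y) =
      (-1) ^ (M + 1) * ((x : ℂ) - y) * phi ν 0 x * psi ν M y := by
  rw [Finset.sum_add_distrib, Finset.sum_range_succ, Finset.sum_range_succ' (fun j => phi ν j x * _)]
  have h1 : ∀ j ∈ Finset.range M, thetaPhi ν j x * psi ν j y = -(phi ν (j + 1) x * psi ν j y) := by
    intro j hj
    rw [thetaPhi, if_pos (by simpa using hj)]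
    ring
  have h2 : ∀ j ∈ Finset.range M, phi ν (j + 1) x * thetaPsi ν (j + 1) y =
      phi ν (j + 1) x * psi ν j y - eps ν (j + 1) * phi ν (j + 1) x * psi ν M y := by
    intro j hj
    rw [thetaPsi, if_neg (Nat.succ_ne_zero j), Nat.add_sub_cancel]
    ring
  rw [Finset.sum_congr rfl h1, Finset.sum_congr rfl h2, Finset.sum_neg_distrib,
    Finset.sum_sub_distrib, ← Finset.sum_mul, thetaPhi, if_neg (lt_irrefl M), thetaPsi, if_pos rfl,
    Finset.sum_range_succ', eps_zero hν]
  ring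

lemma hasDerivAt_comp_mul {h : ℝ → ℂ} {h' : ℂ} {t x : ℝ} (hx : 0 < x)
    (hh : HasDerivAt h (((t * x : ℝ) : ℂ)⁻¹ * h') (t * x)) :
    HasDerivAt (fun t => h (t * x)) ((t : ℂ)⁻¹ * h') t := by
  have h1 : HasDerivAt (fun t : ℝ => t * x) x t := by simpa using (hasDerivAt_id t).mul_const x
  have h2 := HasDerivAt.scomp t hh h1
  refine h2.congr_deriv ?_
  have hx' : (x : ℂ) ≠ 0 := by exact_mod_cast hx.ne'
  rw [Complex.real_smul]
  push_cast
  field_simp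

/-- Along a ray, t d/dt is the sum of the Euler operators in the two variables, and the resulting
factor tx - ty cancels the 1/t. -/
lemma hasDerivAt_sum_phi_psi {ν : Fin (M + 1) → ℕ} (hν : ν 0 = 0) {x y t : ℝ} (hx : 0 < x)
    (hy : 0 < y) (ht : 0 < t) :
    HasDerivAt (fun t : ℝ => ∑ j ∈ Finset.range (M + 1), phi ν j (t * x) * psi ν j (t * y))
      (((x : ℂ) - y) * (f ν (t * x) * g ν (t * y))) t := by
  have h1 : ∀ j ∈ Finset.range (M + 1), HasDerivAt (fun t : ℝ => phi ν j (t * x) * psi ν j (t * y))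
      ((t : ℂ)⁻¹ * (thetaPhi ν j (t * x) * psi ν j (t * y) +
        phi ν j (t * x) * thetaPsi ν j (t * y))) t := by
    intro j hj
    have hj' : j ≤ M := by simpa [Nat.lt_succ_iff] using hj
    refine ((hasDerivAt_comp_mul hx (hasDerivAt_phi hν hj' (mul_pos ht hx))).mul
      (hasDerivAt_comp_mul hy (hasDerivAt_psi hν hj' (mul_pos ht hy)))).congr_deriv ?_
    ring
  refine (HasDerivAt.fun_sum h1).congr_deriv ?_
  rw [← Finset.mul_sum, sum_theta hν, phi_zero, psi_last hν (mul_pos ht hy)]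
  have ht' : (t : ℂ) ≠ 0 := by exact_mod_cast ht.ne'
  push_cast
  field_simp
  linear_combination ((x : ℂ) - y) * f ν (t * x) * g ν (t * y) * neg_one_pow_mul_self (M + 1)

/-- In every product one factor wins: ψ_0 = O(y^{3/4}) against the bounded φ_0, and for j ≥ 1 the
bound O(x^{3/4}) of φ_j against O(y^{-1/4}) of ψ_j. -/
lemma tendsto_sum_phi_psi {ν : Fin (M + 1) → ℕ} (hν : ν 0 = 0) {x y : ℝ} (hx : 0 < x)
    (hy : 0 < y) :
    Tendsto (fun t : ℝ => ∑ j ∈ Finset.range (M + 1), phi ν j (t * x) * psi ν j (t * y))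
      (𝓝[>] 0) (𝓝 0) := by
  rw [show (0 : ℂ) = ∑ j ∈ Finset.range (M + 1), 0 by simp]
  have hlim : ∀ z : ℝ, 0 < z → Tendsto (fun t : ℝ => t * z) (𝓝[>] 0) (𝓝[>] 0) := by
    intro z hz
    refine tendsto_nhdsWithin_iff.2 ⟨?_, ?_⟩
    · have : Tendsto (fun t : ℝ => t * z) (𝓝 0) (𝓝 (0 * z)) :=
        (continuous_mul_const z).tendsto 0
      rw [zero_mul] at this
      exact this.mono_left nhdsWithin_le_nhds
    · filter_upwards [self_mem_nhdsWithin] with t ht using mul_pos ht hz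
  refine tendsto_finsetSum _ fun j _ => ?_
  rcases eq_or_ne j 0 with rfl | hj
  · obtain ⟨l, hl⟩ := tendsto_phi hν 0
    obtain ⟨C, -, hC⟩ := norm_psi_zero_le hν 1
    have h0 : Tendsto (psi ν 0) (𝓝[>] 0) (𝓝 0) := by
      refine squeeze_zero_norm' ?_ (tendsto_mul_rpow_zero C (a := 3 / 4) (by norm_num))
      filter_upwards [Ioc_mem_nhdsGT (show (0 : ℝ) < 1 by norm_num)] with x hx
      exact hC x hx.1 hx.2
    simpa using (hl.comp (hlim x hx)).mul (h0.comp (hlim y hy))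
  · obtain ⟨C, hC0, hC⟩ := norm_phi_le_rpow hν hj x
    obtain ⟨C', hC0', hC'⟩ := norm_psi_le hν j y
    refine squeeze_zero_norm' ?_ (tendsto_mul_rpow_zero
      (C * x ^ (3 / 4 : ℝ) * (C' * y ^ (-1 / 4 : ℝ))) (a := 1 / 2) (by norm_num))
    filter_upwards [Ioc_mem_nhdsGT (show (0 : ℝ) < 1 by norm_num)] with t ht
    have e1 := hC (t * x) (mul_pos ht.1 hx) (by nlinarith [ht.2])
    have e2 := hC' (t * y) (mul_pos ht.1 hy) (by nlinarith [ht.2])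
    rw [Real.mul_rpow ht.1.le hx.le] at e1
    rw [Real.mul_rpow ht.1.le hy.le] at e2
    rw [norm_mul]
    have hte : t ^ (1 / 2 : ℝ) = t ^ (3 / 4 : ℝ) * t ^ (-1 / 4 : ℝ) := by
      rw [← Real.rpow_add ht.1]; norm_num
    rw [hte]
    have := mul_le_mul e1 e2 (norm_nonneg _) (mul_nonneg hC0 (mul_nonneg
      (Real.rpow_nonneg ht.1.le _) (Real.rpow_nonneg hx.le _)))
    linarith

end

section

/-! ### Functions with an integrable singularity at the origin -/

/-- `h` is continuous on `(0, ∞)` and `O(y^{-1/4})` on every interval `(0, A]`. -/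
structure IsSingular (h : ℝ → ℂ) : Prop where
  cont : ContinuousOn h (Ioi 0)
  bound : ∀ A : ℝ, ∃ C, 0 ≤ C ∧ ∀ y : ℝ, 0 < y → y ≤ A → ‖h y‖ ≤ C * y ^ (-1 / 4 : ℝ)

lemma IsSingular.const_mul {h : ℝ → ℂ} (hh : IsSingular h) (a : ℂ) :
    IsSingular (fun y => a * h y) := by
  refine ⟨continuousOn_const.mul hh.cont, fun A => ?_⟩
  obtain ⟨C, h0, hC⟩ := hh.bound A
  refine ⟨‖a‖ * C, by positivity, fun y hy hyA => ?_⟩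
  rw [norm_mul, mul_assoc]
  exact mul_le_mul_of_nonneg_left (hC y hy hyA) (norm_nonneg _)

lemma IsSingular.sub {h k : ℝ → ℂ} (hh : IsSingular h) (hk : IsSingular k) :
    IsSingular (fun y => h y - k y) := by
  refine ⟨hh.cont.sub hk.cont, fun A => ?_⟩
  obtain ⟨C, h0, hC⟩ := hh.bound A
  obtain ⟨C', h0', hC'⟩ := hk.bound A
  refine ⟨C + C', by positivity, fun y hy hyA => ?_⟩
  rw [add_mul]
  exact (norm_sub_le _ _).trans (add_le_add (hC y hy hyA) (hC' y hy hyA))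

lemma IsSingular.mul_continuous {h k : ℝ → ℂ} (hh : IsSingular h) (hk : Continuous k) :
    IsSingular (fun y => k y * h y) := by
  refine ⟨hk.continuousOn.mul hh.cont, fun A => ?_⟩
  obtain ⟨C, h0, hC⟩ := hh.bound A
  obtain ⟨C', hC'⟩ := (isCompact_Icc (a := (0 : ℝ)) (b := A)).exists_bound_of_continuousOn
    hk.continuousOn
  refine ⟨max C' 0 * C, by positivity, fun y hy hyA => ?_⟩
  rw [norm_mul, mul_assoc]
  exact mul_le_mul ((hC' y ⟨hy.le, hyA⟩).trans (le_max_left _ _)) (hC y hy hyA) (norm_nonneg _)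
    (le_max_right _ _)

lemma intervalIntegrable_rpow_quarter (a b : ℝ) :
    IntervalIntegrable (fun t : ℝ => t ^ (-1 / 4 : ℝ)) volume a b :=
  intervalIntegral.intervalIntegrable_rpow' (by norm_num)

lemma intervalIntegrable_of_norm_le_rpow {W : Type*} [NormedAddCommGroup W] {h : ℝ → W} {A C : ℝ}
    (hA : 0 ≤ A) (hc : ContinuousOn h (Ioi 0))
    (hb : ∀ t, 0 < t → t ≤ A → ‖h t‖ ≤ C * t ^ (-1 / 4 : ℝ)) :
    IntervalIntegrable h volume 0 A := by
  rw [intervalIntegrable_iff_integrableOn_Ioc_of_le hA]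
  refine Integrable.mono' (g := fun t => C * t ^ (-1 / 4 : ℝ)) ?_ ?_ ?_
  · exact (((intervalIntegrable_iff_integrableOn_Ioc_of_le hA).1
      (intervalIntegrable_rpow_quarter 0 A))).const_mul C
  · exact (hc.mono fun t ht => ht.1).aestronglyMeasurable measurableSet_Ioc
  · exact (ae_restrict_mem measurableSet_Ioc).mono fun t ht => hb t ht.1 ht.2

lemma IsSingular.comp_mul {h : ℝ → ℂ} (hh : IsSingular h) {s : ℝ} (hs : 0 < s) :
    IsSingular (fun y => h (s * y)) := by
  refine ⟨hh.cont.comp (by fun_prop) fun y hy => mul_pos hs hy, fun A => ?_⟩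
  obtain ⟨C, h0, hC⟩ := hh.bound (s * A)
  refine ⟨C * s ^ (-1 / 4 : ℝ), by positivity, fun y hy hyA => ?_⟩
  rw [mul_assoc, ← Real.mul_rpow hs.le hy.le]
  exact hC _ (mul_pos hs hy) (mul_le_mul_of_nonneg_left hyA hs.le)

lemma IsSingular.intervalIntegrable {h : ℝ → ℂ} (hh : IsSingular h) {A : ℝ} (hA : 0 ≤ A) :
    IntervalIntegrable h volume 0 A := by
  obtain ⟨C, -, hC⟩ := hh.bound A
  exact intervalIntegrable_of_norm_le_rpow hA hh.cont hC

lemma IsSingular.integrableOn {h : ℝ → ℂ} (hh : IsSingular h) {A : ℝ} (hA : 0 ≤ A) :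
    IntegrableOn h (Ioo 0 A) :=
  ((intervalIntegrable_iff_integrableOn_Ioo_of_le hA).1 (hh.intervalIntegrable hA))

lemma IsSingular.memLp {h : ℝ → ℂ} (hh : IsSingular h) {A : ℝ} (hA : 0 ≤ A) :
    MemLp h 2 (volume.restrict (Ioo 0 A)) := by
  have hm : AEStronglyMeasurable h (volume.restrict (Ioo 0 A)) :=
    (hh.cont.mono fun t ht => ht.1).aestronglyMeasurable measurableSet_Ioo
  rw [memLp_two_iff_integrable_sq_norm hm]
  obtain ⟨C, h0, hC⟩ := hh.bound A
  refine Integrable.mono' (g := fun t => C ^ 2 * t ^ (-1 / 2 : ℝ)) ?_ (hm.norm.pow 2) ?_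
  · exact ((intervalIntegrable_iff_integrableOn_Ioo_of_le hA).1
      (intervalIntegral.intervalIntegrable_rpow' (by norm_num))).const_mul _
  · refine (ae_restrict_mem measurableSet_Ioo).mono fun t ht => ?_
    have h1 := hC t ht.1 ht.2.le
    rw [norm_pow, norm_norm]
    calc ‖h t‖ ^ 2 ≤ (C * t ^ (-1 / 4 : ℝ)) ^ 2 := by gcongr
      _ = _ := by
        rw [mul_pow, ← Real.rpow_natCast (t ^ (-1 / 4 : ℝ)), ← Real.rpow_mul ht.1.le]
        norm_num

/-! ### Continuous extension to the origin -/

/-- The extension of `h` from `(0, ∞)` to the real line by the value `l`. -/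
def extendBy (l : ℂ) (h : ℝ → ℂ) (x : ℝ) : ℂ := if x ≤ 0 then l else h x

lemma extendBy_of_pos {l : ℂ} {h : ℝ → ℂ} {x : ℝ} (hx : 0 < x) : extendBy l h x = h x :=
  if_neg (not_le.2 hx)

lemma continuous_extendBy {l : ℂ} {h : ℝ → ℂ} (hc : ContinuousOn h (Ioi 0))
    (hl : Tendsto h (𝓝[>] 0) (𝓝 l)) : Continuous (extendBy l h) := by
  refine continuous_iff_continuousAt.2 fun x => ?_
  rcases lt_trichotomy x 0 with hx | rfl | hx
  · refine continuousAt_const.congr (f := fun _ => l) ?_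
    filter_upwards [Iio_mem_nhds hx] with y hy
    exact (if_pos (le_of_lt hy)).symm
  · rw [continuousAt_iff_continuous_left'_right']
    have h0 : extendBy l h 0 = l := if_pos le_rfl
    refine ⟨?_, ?_⟩
    · rw [ContinuousWithinAt, h0]
      refine tendsto_const_nhds.congr' ?_
      filter_upwards [self_mem_nhdsWithin] with y hy
      exact (if_pos (le_of_lt hy)).symm
    · rw [ContinuousWithinAt, h0]
      refine hl.congr' ?_
      filter_upwards [self_mem_nhdsWithin] with y hy
      exact (extendBy_of_pos hy).symm
  · refine (hc.continuousAt (Ioi_mem_nhds hx)).congr ?_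
    filter_upwards [Ioi_mem_nhds hx] with y hy
    exact (extendBy_of_pos hy).symm

variable {M : ℕ}

lemma continuousOn_phi {ν : Fin (M + 1) → ℕ} (hν : ν 0 = 0) (j : ℕ) :
    ContinuousOn (phi ν j) (Ioi 0) :=
  fun _ hx => (hasDerivAt_phi_aux hν j hx).continuousAt.continuousWithinAt

lemma exists_extension_phi {ν : Fin (M + 1) → ℕ} (hν : ν 0 = 0) (j : ℕ) :
    ∃ a : C(ℝ, ℂ), ∀ x, 0 < x → a x = phi ν j x := by
  obtain ⟨l, hl⟩ := tendsto_phi hν j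
  exact ⟨⟨extendBy l (phi ν j), continuous_extendBy (continuousOn_phi hν j) hl⟩,
    fun x hx => extendBy_of_pos hx⟩

/-- The continuous extension of `φ_j` to the real line. -/
def phiC {ν : Fin (M + 1) → ℕ} (hν : ν 0 = 0) (j : ℕ) : C(ℝ, ℂ) :=
  (exists_extension_phi hν j).choose

lemma phiC_apply {ν : Fin (M + 1) → ℕ} (hν : ν 0 = 0) (j : ℕ) {x : ℝ} (hx : 0 < x) :
    phiC hν j x = phi ν j x := (exists_extension_phi hν j).choose_spec x hx

/-- The continuous extension of `f` to the real line. -/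
def fC {ν : Fin (M + 1) → ℕ} (hν : ν 0 = 0) : C(ℝ, ℂ) := (-1 : ℂ) ^ (M + 1) • phiC hν 0

lemma fC_apply {ν : Fin (M + 1) → ℕ} (hν : ν 0 = 0) {x : ℝ} (hx : 0 < x) :
    fC hν x = f ν x := by
  rw [fC, ContinuousMap.smul_apply, phiC_apply hν 0 hx, phi_zero, smul_eq_mul, ← mul_assoc,
    neg_one_pow_mul_self, one_mul]

lemma isSingular_psi {ν : Fin (M + 1) → ℕ} (hν : ν 0 = 0) {j : ℕ} (hj : j ≤ M) :
    IsSingular (psi ν j) :=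
  ⟨fun _ hy => (hasDerivAt_psi hν hj hy).continuousAt.continuousWithinAt,
    fun A => norm_psi_le hν j A⟩

lemma isSingular_g {ν : Fin (M + 1) → ℕ} (hν : ν 0 = 0) : IsSingular (g ν) := by
  have h := isSingular_psi hν (le_refl M)
  refine ⟨h.cont.congr fun y hy => (psi_last hν hy).symm, fun A => ?_⟩
  obtain ⟨C, h0, hC⟩ := h.bound A
  refine ⟨C, h0, fun y hy hyA => ?_⟩
  rw [← psi_last hν hy]
  exact hC y hy hyA

/-! ### The kernel -/

lemma intervalIntegrable_mul_comp {a : ℝ → ℂ} (ha : Continuous a) {h : ℝ → ℂ} (hh : IsSingular h)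
    {y : ℝ} (hy : 0 < y) {A : ℝ} (hA : 0 ≤ A) :
    IntervalIntegrable (fun t => a t * h (t * y)) volume 0 A := by
  have := ((hh.comp_mul hy).mul_continuous ha).intervalIntegrable hA
  simpa only [mul_comm y] using this

/-- The fundamental theorem of calculus on the ray from the origin to (x,y); the boundary term at
the origin vanishes. -/
lemma sum_phi_psi_eq {ν : Fin (M + 1) → ℕ} (hν : ν 0 = 0) {x y : ℝ} (hx : 0 < x) (hy : 0 < y) :
    ∑ j ∈ Finset.range (M + 1), phi ν j x * psi ν j y =
      ((x : ℂ) - y) * ∫ t in (0 : ℝ)..1, fC hν (t * x) * g ν (t * y) := by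
  have hinteg : IntervalIntegrable (fun t : ℝ => ((x : ℂ) - y) * (fC hν (t * x) * g ν (t * y)))
      volume 0 1 :=
    (intervalIntegrable_mul_comp (a := fun t => fC hν (t * x)) (by fun_prop) (isSingular_g hν) hy
      zero_le_one).const_mul _
  have h1 := intervalIntegral.integral_eq_sub_of_hasDerivAt_of_tendsto (a := 0) (b := 1)
    (f := fun t : ℝ => ∑ j ∈ Finset.range (M + 1), phi ν j (t * x) * psi ν j (t * y))
    zero_lt_one (fun t ht => by
      have := hasDerivAt_sum_phi_psi hν hx hy ht.1
      rwa [← fC_apply hν (mul_pos ht.1 hx)] at this) hinteg (tendsto_sum_phi_psi hν hx hy)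
    ((hasDerivAt_sum_phi_psi hν hx hy one_pos).continuousAt.tendsto.mono_left nhdsWithin_le_nhds)
  rw [intervalIntegral.integral_const_mul] at h1
  rw [h1]
  simp

lemma continuousAt_integral_fC {ν : Fin (M + 1) → ℕ} (hν : ν 0 = 0) {y : ℝ} (hy : 0 < y) :
    ContinuousAt (fun x : ℝ => ∫ t in (0 : ℝ)..1, fC hν (t * x) * g ν (t * y)) y := by
  obtain ⟨C, hC⟩ := (isCompact_Icc (a := (0 : ℝ)) (b := 2 * y)).exists_bound_of_continuousOn
    (fC hν).continuous.continuousOn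
  have hg := intervalIntegrable_mul_comp (a := fun _ => 1) continuous_const (isSingular_g hν) hy
      zero_le_one
  simp only [one_mul] at hg
  refine intervalIntegral.continuousAt_of_dominated_interval
    (bound := fun t => C * ‖g ν (t * y)‖) ?_ ?_ (hg.norm.const_mul C) ?_
  · refine Eventually.of_forall fun x => ?_
    have := (intervalIntegrable_mul_comp (a := fun t => fC hν (t * x)) (by fun_prop)
      (isSingular_g hν) hy zero_le_one).aestronglyMeasurable
    rwa [uIoc_of_le zero_le_one]
  · filter_upwards [Ioo_mem_nhds (show 0 < y from hy) (show y < 2 * y by linarith)] with x hx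
    refine ae_of_all _ fun t ht => ?_
    rw [uIoc_of_le zero_le_one] at ht
    rw [norm_mul]
    gcongr
    exact hC _ ⟨mul_nonneg ht.1.le hx.1.le, by nlinarith [ht.2, hx.2, hx.1]⟩
  · exact ae_of_all _ fun t _ => by fun_prop

/-- Because the first factor vanishes at y, continuity of `I` suffices. This identifies the diagonal
value of the kernel, given by L'Hospital's rule, with the integral. -/
lemma hasDerivAt_sub_mul {I : ℝ → ℂ} {y : ℝ} (hI : ContinuousAt I y) :
    HasDerivAt (fun x : ℝ => ((x : ℂ) - y) * I x) (I y) y := by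
  rw [hasDerivAt_iff_tendsto_slope]
  refine (hI.tendsto.mono_left nhdsWithin_le_nhds).congr' ?_
  filter_upwards [self_mem_nhdsWithin] with x hx
  have hne : ((x : ℂ) - y) ≠ 0 := by
    rw [sub_ne_zero]
    exact_mod_cast hx
  rw [slope_def_module, sub_self, zero_mul, sub_zero, Complex.real_smul]
  push_cast
  field_simp

/-- The integral representation of the kernel. -/
lemma K_eq_integral {ν : Fin (M + 1) → ℕ} (hν : ν 0 = 0) {x y : ℝ} (hx : 0 < x) (hy : 0 < y) :
    K ν x y = ∫ t in (0 : ℝ)..1, fC hν (t * x) * g ν (t * y) := by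
  unfold K
  split_ifs with h
  · subst h
    have h1 : HasDerivAt (fun z : ℝ => ∑ j ∈ Finset.range (M + 1), phi ν j z * psi ν j x)
        (∑ j ∈ Finset.range (M + 1), deriv (phi ν j) x * psi ν j x) x := by
      refine HasDerivAt.fun_sum fun j hj => ?_
      have hj' : j ≤ M := by simpa [Nat.lt_succ_iff] using hj
      exact (hasDerivAt_phi hν hj' hx).differentiableAt.hasDerivAt.mul_const _
    have h2 := hasDerivAt_sub_mul (continuousAt_integral_fC hν hx)
    refine h1.unique (h2.congr_of_eventuallyEq ?_)
    filter_upwards [Ioi_mem_nhds hx] with z hz using sum_phi_psi_eq hν hz hx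
  · have hne : ((x : ℂ) - y) ≠ 0 := by
      rw [sub_ne_zero]
      exact_mod_cast h
    rw [sum_phi_psi_eq hν hx hy, mul_div_cancel_left₀ _ hne]

end

section

/-! ### Hadamard's inequality and derivatives of determinants -/

/-- The inequality of arithmetic and geometric means, to be applied to eigenvalues. -/
lemma prod_le_pow_of_sum_le {n : ℕ} {z : Fin n → ℝ} (hz : ∀ i, 0 ≤ z i) {S : ℝ}
    (hS : ∑ i, z i ≤ n * S) : ∏ i, z i ≤ S ^ n := by
  rcases Nat.eq_zero_or_pos n with rfl | hn
  · simp
  have hn' : (0 : ℝ) < n := by exact_mod_cast hn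
  have h := Real.geom_mean_le_arith_mean_weighted Finset.univ (fun _ : Fin n => (n : ℝ)⁻¹) z
    (fun _ _ => by positivity) (by simp [hn'.ne']) (fun i _ => hz i)
  rw [Real.finsetProd_rpow _ _ (fun i _ => hz i), ← Finset.mul_sum] at h
  have hP : 0 ≤ ∏ i, z i := Finset.prod_nonneg fun i _ => hz i
  have h2 : (n : ℝ)⁻¹ * ∑ i, z i ≤ S := by
    rw [inv_mul_le_iff₀ hn']
    exact hS
  calc ∏ i, z i = ((∏ i, z i) ^ (n : ℝ)⁻¹) ^ n := by
        rw [← Real.rpow_natCast, ← Real.rpow_mul hP, inv_mul_cancel₀ hn'.ne', Real.rpow_one]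
    _ ≤ S ^ n := by
        gcongr
        exact h.trans h2

open scoped ComplexOrder in
-- The eigenvalues of A A* are non-negative with sum Σ |A_ij|² ≤ n² and product |det A|², so the
-- product is at most n^n.
lemma norm_det_le_sqrt_pow {n : ℕ} (A : Matrix (Fin n) (Fin n) ℂ) (hA : ∀ i j, ‖A i j‖ ≤ 1) :
    ‖A.det‖ ≤ (Real.sqrt n) ^ n := by
  have hps := Matrix.posSemidef_self_mul_conjTranspose A
  have hdet := hps.isHermitian.det_eq_prod_eigenvalues
  have htr := hps.isHermitian.trace_eq_sum_eigenvalues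
  have h1 : ∑ i, hps.isHermitian.eigenvalues i ≤ n * n := by
    have h2 : ((∑ i, hps.isHermitian.eigenvalues i : ℝ) : ℂ) =
        ((∑ i, ∑ j, ‖A i j‖ ^ 2 : ℝ) : ℂ) := by
      push_cast
      refine htr.symm.trans ?_
      simp only [Matrix.trace, Matrix.diag, Matrix.mul_apply, Matrix.conjTranspose_apply]
      refine Finset.sum_congr rfl fun i _ => Finset.sum_congr rfl fun j _ => ?_
      exact Complex.mul_conj' (A i j)
    rw [Complex.ofReal_inj.1 h2]
    calc ∑ i, ∑ j, ‖A i j‖ ^ 2 ≤ ∑ i : Fin n, ∑ j : Fin n, (1 : ℝ) := by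
          gcongr with i _ j _
          exact pow_le_one₀ (norm_nonneg _) (hA i j)
      _ = n * n := by simp
  have h3 := prod_le_pow_of_sum_le hps.eigenvalues_nonneg h1
  have h4 : ‖A.det‖ ^ 2 = ∏ i, hps.isHermitian.eigenvalues i := by
    have h5 : ((‖A.det‖ ^ 2 : ℝ) : ℂ) = ((∏ i, hps.isHermitian.eigenvalues i : ℝ) : ℂ) := by
      push_cast
      refine Eq.trans ?_ hdet
      rw [Matrix.det_mul, Matrix.det_conjTranspose]
      exact (Complex.mul_conj' _).symm
    exact Complex.ofReal_inj.1 h5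
  refine le_of_sq_le_sq ?_ (by positivity)
  rw [h4, ← pow_mul, mul_comm n 2, pow_mul, Real.sq_sqrt (Nat.cast_nonneg n)]
  exact h3

/-- **Hadamard's inequality** in a weighted form. -/
lemma norm_det_le {n : ℕ} (A : Matrix (Fin n) (Fin n) ℂ) (c w : Fin n → ℝ) (hc : ∀ i, 0 ≤ c i)
    (hw : ∀ j, 0 ≤ w j) (hA : ∀ i j, ‖A i j‖ ≤ c i * w j) :
    ‖A.det‖ ≤ (Real.sqrt n) ^ n * (∏ i, c i) * ∏ j, w j := by
  let B : Matrix (Fin n) (Fin n) ℂ := Matrix.of fun i j => A i j / ((c i * w j : ℝ) : ℂ)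
  have hB : ∀ i j, ‖B i j‖ ≤ 1 := fun i j => by
    simp only [B, Matrix.of_apply, norm_div, Complex.norm_real]
    rw [Real.norm_of_nonneg (mul_nonneg (hc i) (hw j))]
    exact div_le_one_of_le₀ (hA i j) (mul_nonneg (hc i) (hw j))
  have hAB : A = Matrix.of fun i j => (c i : ℂ) * (Matrix.of fun i j => (w j : ℂ) * B i j) i j := by
    ext i j
    simp only [B, Matrix.of_apply]
    -- Where the weight vanishes, division yields 0 by convention; the entry of `A` is then 0 as
    -- well, so the factorization still holds.
    by_cases h : c i * w j = 0
    · have h0 : A i j = 0 := by simpa [h] using hA i j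
      simp [h0]
    · have h1 : (c i : ℂ) ≠ 0 := by exact_mod_cast left_ne_zero_of_mul h
      have h2 : (w j : ℂ) ≠ 0 := by exact_mod_cast right_ne_zero_of_mul h
      push_cast
      field_simp
  rw [hAB, Matrix.det_mul_column, Matrix.det_mul_row, norm_mul, norm_mul, norm_prod, norm_prod]
  simp only [Complex.norm_real, Real.norm_of_nonneg (hc _), Real.norm_of_nonneg (hw _)]
  have := norm_det_le_sqrt_pow B hB
  have hp : 0 ≤ (∏ i, c i) * ∏ j, w j :=
    mul_nonneg (Finset.prod_nonneg fun i _ => hc i) (Finset.prod_nonneg fun i _ => hw i)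
  nlinarith

/-- Since n^n ≤ n! e^n, the terms are at most (c e / √n)^n, eventually below 2^{-n}. -/
lemma summable_hadamard (c : ℝ) (hc : 0 ≤ c) :
    Summable fun n : ℕ => (Real.sqrt n) ^ n * c ^ n / (n ! : ℝ) := by
  have hlim : Tendsto (fun n : ℕ => Real.sqrt n) atTop atTop :=
    Real.tendsto_sqrt_atTop.comp tendsto_natCast_atTop_atTop
  have hev := hlim.eventually_ge_atTop (2 * (c * Real.exp 1) + 1)
  refine Summable.of_norm_bounded_eventually_nat (g := fun n => (1 / 2 : ℝ) ^ n)
    (summable_geometric_of_lt_one (by norm_num) (by norm_num)) ?_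
  filter_upwards [hev] with n hn
  have hs : 0 < Real.sqrt n := lt_of_lt_of_le (by positivity) hn
  have hn0 : 0 < (n : ℝ) := Real.sqrt_pos.1 hs
  rw [Real.norm_of_nonneg (by positivity)]
  have h1 := Real.pow_div_factorial_le_exp (n : ℝ) n.cast_nonneg n
  have hpow : (n : ℝ) ^ n = Real.sqrt n ^ n * Real.sqrt n ^ n := by
    rw [← mul_pow, Real.mul_self_sqrt hn0.le]
  have hexp : Real.exp n = Real.exp 1 ^ n := by rw [← Real.exp_nat_mul, mul_one]
  rw [hpow, hexp] at h1
  have h2 : c * Real.exp 1 / Real.sqrt n ≤ 1 / 2 := by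
    rw [div_le_iff₀ hs]
    linarith
  calc Real.sqrt n ^ n * c ^ n / (n ! : ℝ)
      = (c ^ n / Real.sqrt n ^ n) * (Real.sqrt n ^ n * Real.sqrt n ^ n / (n ! : ℝ)) := by
        field_simp
    _ ≤ (c ^ n / Real.sqrt n ^ n) * Real.exp 1 ^ n := by gcongr
    _ = (c * Real.exp 1 / Real.sqrt n) ^ n := by rw [div_pow, mul_pow]; ring
    _ ≤ (1 / 2) ^ n := by gcongr

lemma hasDerivAt_det {n : ℕ} {A : ℝ → Matrix (Fin n) (Fin n) ℂ} {A' : Matrix (Fin n) (Fin n) ℂ}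
    {s : ℝ} (hA : ∀ i j, HasDerivAt (fun t => A t i j) (A' i j) s) :
    HasDerivAt (fun t => (A t).det) (∑ i, ((A s).updateRow i (A' i)).det) s := by
  have h1 : ∀ B : Matrix (Fin n) (Fin n) ℂ, B.det = ∑ σ : Equiv.Perm (Fin n),
      ((Equiv.Perm.sign σ : ℤ) : ℂ) * ∏ i, B i (σ i) := by
    intro B
    -- Transposition puts the permutation on the column index, so that the product runs over the
    -- rows.
    rw [← Matrix.det_transpose, Matrix.det_apply']
    rfl
  simp only [h1]
  rw [Finset.sum_comm]
  refine HasDerivAt.fun_sum fun σ _ => ?_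
  rw [← Finset.mul_sum]
  refine HasDerivAt.const_mul _ ?_
  refine (HasDerivAt.fun_finsetProd (u := Finset.univ) (fun i _ => hA i (σ i))).congr_deriv ?_
  refine Finset.sum_congr rfl fun i _ => ?_
  rw [← Finset.mul_prod_erase Finset.univ _ (Finset.mem_univ i), Matrix.updateRow_self,
    smul_eq_mul, mul_comm]
  congr 1
  refine Finset.prod_congr rfl fun j hj => ?_
  rw [Matrix.updateRow_ne (Finset.ne_of_mem_erase hj)]

lemma measurable_det {α : Type*} [MeasurableSpace α] {n : ℕ} {A : α → Matrix (Fin n) (Fin n) ℂ}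
    (hA : ∀ i j, Measurable fun a => A a i j) : Measurable fun a => (A a).det := by
  simp only [Matrix.det_apply']
  exact Finset.measurable_fun_sum _ fun σ _ =>
    (Finset.measurable_fun_prod _ fun i _ => hA _ _).const_mul _

/-! ### Fredholm determinants and their minors -/

variable {X : Type*}

/-- The integrand of the Fredholm determinant. -/
def fdet (k : X → X → ℂ) {n : ℕ} (t : Fin n → X) : ℂ := (Matrix.of fun i j => k (t i) (t j)).det

/-- The determinant of `k(t_i, t_j)` bordered by the column `k(t_i, y)` and the row
`r(y), r(t_j)`. -/
def bord (k : X → X → ℂ) (r : X → ℂ) (y : X) {n : ℕ} (t : Fin n → X) : ℂ :=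
  (Matrix.of fun i j : Fin (n + 1) =>
    (Fin.cons (α := fun _ => X → ℂ) r (fun i => k (t i)) i) (Fin.cons (α := fun _ => X) y t j)).det

lemma bord_zero (k : X → X → ℂ) (r : X → ℂ) (y : X) (t : Fin 0 → X) : bord k r y t = r y := by
  simp [bord]

/-- Expansion of the bordered determinant along its first row. -/
lemma bord_succ (k : X → X → ℂ) (r : X → ℂ) (y : X) {n : ℕ} (t : Fin (n + 1) → X) :
    bord k r y t = r y * fdet k t -
      ∑ l, r (t l) * bord k (k (t l)) y (fun i => t (l.succAbove i)) := by
  rw [bord, Matrix.det_succ_row_zero, Fin.sum_univ_succ, sub_eq_add_neg, ← Finset.sum_neg_distrib]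
  congr 1
  · simp only [Fin.val_zero, pow_zero, one_mul, Matrix.of_apply, Fin.cons_zero]
    congr 1
  · refine Finset.sum_congr rfl fun l _ => ?_
    simp only [Matrix.of_apply, Fin.cons_zero, Fin.cons_succ, Fin.val_succ]
    set N : Matrix (Fin (n + 1)) (Fin (n + 1)) ℂ := Matrix.submatrix (Matrix.of fun i j =>
      (Fin.cons (α := fun _ => X → ℂ) r (fun i => k (t i)) i) (Fin.cons (α := fun _ => X) y t j))
      Fin.succ l.succ.succAbove with hN
    -- In the cofactor the row k(t_l) stands at place l. A cycle brings it to the top with sign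
    -- (-1)^l, which combines with the cofactor sign (-1)^{l+1} to -1.
    have h1 : bord k (k (t l)) y (fun i => t (l.succAbove i)) =
        (N.submatrix (l.cycleRange.symm) id).det := by
      unfold bord
      congr 1
      ext i j
      simp only [hN, Matrix.of_apply, Matrix.submatrix_apply, id, Fin.cons_succ]
      have hj : Fin.cons (α := fun _ => X) y t (l.succ.succAbove j) =
          Fin.cons (α := fun _ => X) y (fun i => t (l.succAbove i)) j := by
        refine Fin.cases ?_ (fun j' => ?_) j
        · simp
        · simp
      rw [hj]
      refine Fin.cases ?_ (fun i' => ?_) i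
      · simp
      · simp
    rw [h1, Matrix.det_permute, Equiv.Perm.sign_symm, Fin.sign_cycleRange, pow_succ]
    have h2 : (((((-1 : ℤˣ) ^ (l : ℕ) : ℤˣ) : ℤ)) : ℂ) = (-1) ^ (l : ℕ) := by push_cast; rfl
    rw [h2]
    ring

/-- The same cycle is applied to rows and to columns, so no sign appears. -/
lemma det_updateRow_eq_bord (k : X → X → ℂ) (r : X → ℂ) {n : ℕ} (t : Fin (n + 1) → X)
    (l : Fin (n + 1)) :
    ((Matrix.of fun i j => k (t i) (t j)).updateRow l (fun j => r (t j))).det =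
      bord k r (t l) (fun i => t (l.succAbove i)) := by
  rw [← Matrix.det_submatrix_equiv_self l.cycleRange.symm, bord]
  congr 1
  ext i j
  have hj : t (l.cycleRange.symm j) =
      Fin.cons (α := fun _ => X) (t l) (fun i => t (l.succAbove i)) j := by
    refine Fin.cases ?_ (fun j' => ?_) j
    · simp
    · simp
  rw [Matrix.submatrix_apply, Matrix.of_apply, ← hj]
  refine Fin.cases ?_ (fun i' => ?_) i
  · simp
  · simp

end

/-! ### Integrated determinants and minors of kernels with an integrable weight -/

section

variable {X : Type*} [MeasurableSpace X]

/-- A measurable kernel with `|k(x,y)| ≤ C w(y)` for an integrable weight `w`. -/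
structure IsFredholmKernel (μ : Measure X) (k : X → X → ℂ) (C : ℝ) (w : X → ℝ) : Prop where
  meas : Measurable (Function.uncurry k)
  nonneg : 0 ≤ C
  w_nonneg : ∀ y, 0 ≤ w y
  w_int : Integrable w μ
  bound : ∀ x y, ‖k x y‖ ≤ C * w y

/-- The `n`-th coefficient of the Fredholm determinant. -/
def fInt (μ : Measure X) (k : X → X → ℂ) (n : ℕ) : ℂ :=
  ∫ t, fdet k t ∂(Measure.pi fun _ : Fin n => μ)

/-- The `n`-th coefficient of the bordered Fredholm determinant. -/
def bInt (μ : Measure X) (k : X → X → ℂ) (r : X → ℂ) (n : ℕ) (y : X) : ℂ :=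
  ∫ t, bord k r y t ∂(Measure.pi fun _ : Fin n => μ)

lemma measurable_fdet {k : X → X → ℂ} (hk : Measurable (Function.uncurry k)) (n : ℕ) :
    Measurable fun t : Fin n → X => fdet k t := by
  refine measurable_det fun i j => ?_
  have h : Measurable fun t : Fin n → X => (t i, t j) :=
    (measurable_pi_apply i).prodMk (measurable_pi_apply j)
  exact hk.comp h

lemma measurable_bord {Z : Type*} [MeasurableSpace Z] {k : X → X → ℂ}
    (hk : Measurable (Function.uncurry k)) {r : Z → X → ℂ} (hr : Measurable (Function.uncurry r))
    {y : Z → X} (hy : Measurable y) {n : ℕ} {t : Z → Fin n → X} (ht : Measurable t) :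
    Measurable fun z => bord k (r z) (y z) (t z) := by
  refine measurable_det fun i j => ?_
  have hj : Measurable fun z => Fin.cons (α := fun _ => X) (y z) (t z) j := by
    refine Fin.cases ?_ (fun j' => ?_) j
    · simpa using hy
    · simpa [Function.comp_def] using (measurable_pi_apply j').comp ht
  refine Fin.cases ?_ (fun i' => ?_) i
  · exact hr.comp (measurable_id.prodMk hj)
  · exact hk.comp (((measurable_pi_apply i').comp ht).prodMk hj)

section Kernel

variable {μ : Measure X} {k : X → X → ℂ} {C : ℝ} {w : X → ℝ}

lemma integral_prod_weight [SigmaFinite μ] (w : X → ℝ) (n : ℕ) :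
    ∫ t : Fin n → X, ∏ j, w (t j) ∂(Measure.pi fun _ : Fin n => μ) = (∫ x, w x ∂μ) ^ n := by
  rw [integral_fintype_prod_eq_prod (fun _ => w)]
  simp

lemma IsFredholmKernel.integrable_prod [SigmaFinite μ] (hk : IsFredholmKernel μ k C w) (n : ℕ) :
    Integrable (fun t : Fin n → X => ∏ j, w (t j)) (Measure.pi fun _ : Fin n => μ) :=
  Integrable.fintype_prod (f := fun _ => w) fun _ => hk.w_int

lemma IsFredholmKernel.integral_nonneg (hk : IsFredholmKernel μ k C w) : 0 ≤ ∫ x, w x ∂μ :=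
  MeasureTheory.integral_nonneg hk.w_nonneg

lemma IsFredholmKernel.norm_fdet_le (hk : IsFredholmKernel μ k C w) {n : ℕ} (t : Fin n → X) :
    ‖fdet k t‖ ≤ (Real.sqrt n) ^ n * C ^ n * ∏ j, w (t j) := by
  have := norm_det_le (Matrix.of fun i j => k (t i) (t j)) (fun _ => C) (fun j => w (t j))
    (fun _ => hk.nonneg) (fun j => hk.w_nonneg _) (fun i j => hk.bound _ _)
  simpa [fdet] using this

lemma IsFredholmKernel.integrable_fdet [SigmaFinite μ] (hk : IsFredholmKernel μ k C w) (n : ℕ) :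
    Integrable (fun t : Fin n → X => fdet k t) (Measure.pi fun _ : Fin n => μ) :=
  ((hk.integrable_prod n).const_mul _).mono' (measurable_fdet hk.meas n).aestronglyMeasurable
    (ae_of_all _ hk.norm_fdet_le)

lemma IsFredholmKernel.norm_fInt_le [SigmaFinite μ] (hk : IsFredholmKernel μ k C w) (n : ℕ) :
    ‖fInt μ k n‖ ≤ (Real.sqrt n) ^ n * (C * ∫ x, w x ∂μ) ^ n := by
  refine (norm_integral_le_of_norm_le ((hk.integrable_prod n).const_mul _)
    (ae_of_all _ hk.norm_fdet_le)).trans (le_of_eq ?_)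
  rw [integral_const_mul, integral_prod_weight, mul_pow]
  ring

lemma fInt_zero (k : X → X → ℂ) : fInt μ k 0 = 1 := by
  simp [fInt, fdet, Measure.real]

lemma IsFredholmKernel.norm_bord_le (hk : IsFredholmKernel μ k C w) {r : X → ℂ} {c : ℝ}
    (hc : 0 ≤ c) (hr : ∀ y, ‖r y‖ ≤ c * w y) (y : X) {n : ℕ} (t : Fin n → X) :
    ‖bord k r y t‖ ≤ (Real.sqrt (n + 1 : ℕ)) ^ (n + 1) * (c * C ^ n) * w y * ∏ j, w (t j) := by
  have := norm_det_le (Matrix.of fun i j : Fin (n + 1) =>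
    (Fin.cons (α := fun _ => X → ℂ) r (fun i => k (t i)) i) (Fin.cons (α := fun _ => X) y t j))
    (Fin.cons (α := fun _ => ℝ) c fun _ => C)
    (fun j => w (Fin.cons (α := fun _ => X) y t j)) ?_ (fun j => hk.w_nonneg _) ?_
  · rw [Fin.prod_univ_succ, Fin.prod_univ_succ] at this
    simp only [Fin.cons_zero, Fin.cons_succ, Finset.prod_const, Finset.card_univ,
      Fintype.card_fin] at this
    refine this.trans (le_of_eq ?_)
    ring
  · exact Fin.cases hc fun _ => hk.nonneg
  · intro i j
    refine Fin.cases ?_ (fun i' => ?_) i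
    · exact hr _
    · exact hk.bound _ _

lemma IsFredholmKernel.norm_bInt_le [SigmaFinite μ] (hk : IsFredholmKernel μ k C w) {r : X → ℂ}
    {c : ℝ}
    (hc : 0 ≤ c) (hr : ∀ y, ‖r y‖ ≤ c * w y) (n : ℕ) (y : X) :
    ‖bInt μ k r n y‖ ≤ (Real.sqrt (n + 1 : ℕ)) ^ (n + 1) * (c * C ^ n) * (∫ x, w x ∂μ) ^ n * w y :=
      by
  refine (norm_integral_le_of_norm_le ((hk.integrable_prod n).const_mul _)
    (ae_of_all _ (hk.norm_bord_le hc hr y))).trans (le_of_eq ?_)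
  rw [integral_const_mul, integral_prod_weight]
  ring

lemma bInt_zero (k : X → X → ℂ) (r : X → ℂ) (y : X) : bInt μ k r 0 y = r y := by
  simp [bInt, bord_zero, Measure.real]

lemma IsFredholmKernel.stronglyMeasurable_bInt [SigmaFinite μ] {Z : Type*} [MeasurableSpace Z]
    (hk : IsFredholmKernel μ k C w)
    {r : Z → X → ℂ} (hr : Measurable (Function.uncurry r)) {y : Z → X} (hy : Measurable y) (n : ℕ) :
    StronglyMeasurable fun z => bInt μ k (r z) n (y z) := by
  have h : Measurable fun p : Z × (Fin n → X) => bord k (r p.1) (y p.1) p.2 :=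
    measurable_bord hk.meas (r := fun p : Z × (Fin n → X) => r p.1)
      (hr.comp (((measurable_fst.comp measurable_fst)).prodMk measurable_snd))
      (hy.comp measurable_fst) measurable_snd
  exact h.stronglyMeasurable.integral_prod_right

/-- Integration over one of the `n + 1` variables separately. -/
lemma integral_pi_succAbove [SigmaFinite μ] {n : ℕ} (l : Fin (n + 1)) {G : X → (Fin n → X) → ℂ}
    (hG : Integrable (Function.uncurry G) (μ.prod (Measure.pi fun _ : Fin n => μ))) :
    Integrable (fun t : Fin (n + 1) → X => G (t l) (fun i => t (l.succAbove i)))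
        (Measure.pi fun _ : Fin (n + 1) => μ) ∧
      ∫ t : Fin (n + 1) → X, G (t l) (fun i => t (l.succAbove i))
        ∂(Measure.pi fun _ : Fin (n + 1) => μ) =
      ∫ z, ∫ t, G z t ∂(Measure.pi fun _ : Fin n => μ) ∂μ := by
  have hmp := measurePreserving_piFinSuccAbove (fun _ : Fin (n + 1) => μ) l
  refine ⟨?_, ?_⟩
  · exact hmp.integrable_comp_of_integrable hG
  · have h2 := integral_prod _ hG
    rw [← hmp.integral_comp (MeasurableEquiv.measurableEmbedding _)] at h2
    exact h2

lemma IsFredholmKernel.integrable_uncurry_bord [SigmaFinite μ] (hk : IsFredholmKernel μ k C w)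
    {v : X → ℂ} {c : ℝ}
    (hv : Measurable v) (hvi : ∀ z, ‖v z‖ ≤ c * w z) (y : X) (n : ℕ) :
    Integrable (Function.uncurry fun (z : X) (t : Fin n → X) => v z * bord k (k z) y t)
      (μ.prod (Measure.pi fun _ : Fin n => μ)) := by
  have hdom : Integrable (fun p : X × (Fin n → X) => (c * w p.1) *
      ((Real.sqrt (n + 1 : ℕ)) ^ (n + 1) * (C * C ^ n) * w y * ∏ j, w (p.2 j)))
      (μ.prod (Measure.pi fun _ : Fin n => μ)) :=
    (hk.w_int.const_mul c).mul_prod ((hk.integrable_prod n).const_mul _)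
  refine hdom.mono' ?_ (ae_of_all _ fun p => ?_)
  · refine Measurable.aestronglyMeasurable ?_
    refine (hv.comp measurable_fst).mul (measurable_bord hk.meas
      (r := fun p : X × (Fin n → X) => k p.1) (y := fun _ => y) ?_ measurable_const measurable_snd)
    exact hk.meas.comp ((measurable_fst.comp measurable_fst).prodMk measurable_snd)
  · simp only [Function.uncurry]
    rw [norm_mul]
    exact mul_le_mul (hvi _) (hk.norm_bord_le hk.nonneg (fun y => hk.bound _ _) y _)
      (norm_nonneg _) ((norm_nonneg _).trans (hvi _))

/-- Fredholm's recursion for the minors. -/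
lemma IsFredholmKernel.bInt_succ [SigmaFinite μ] (hk : IsFredholmKernel μ k C w) {r : X → ℂ} {c : ℝ}
    (hrm : Measurable r) (hr : ∀ y, ‖r y‖ ≤ c * w y) (n : ℕ) (y : X) :
    bInt μ k r (n + 1) y =
      r y * fInt μ k (n + 1) - (n + 1) * ∫ z, r z * bInt μ k (k z) n y ∂μ := by
  have h1 := fun l : Fin (n + 1) => integral_pi_succAbove (μ := μ) l
    (hk.integrable_uncurry_bord hrm hr y n)
  unfold bInt fInt
  simp only [bord_succ]
  rw [integral_sub ((hk.integrable_fdet (n + 1)).const_mul _)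
    (integrable_finsetSum _ fun l _ => (h1 l).1), integral_const_mul,
    integral_finsetSum _ fun l _ => (h1 l).1]
  simp only [(h1 _).2, integral_const_mul, Finset.sum_const, Finset.card_univ, Fintype.card_fin,
    nsmul_eq_mul]
  push_cast
  ring

end Kernel

/-! ### Differentiation of the Fredholm determinant along a family of kernels -/

section Family

variable {μ : Measure X} {C : ℝ} {w : X → ℝ} {k : ℝ → X → X → ℂ}
  {a b : ℝ → X → ℂ} {c₁ c₂ : ℝ} {U : Set ℝ}

/-- A family of Fredholm kernels whose derivative is the kernel `a(x) b(y)` of rank one. -/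
structure IsFredholmFamily (μ : Measure X) (k : ℝ → X → X → ℂ) (a b : ℝ → X → ℂ)
    (C c₁ c₂ : ℝ) (w : X → ℝ) (U : Set ℝ) : Prop where
  kernel : ∀ s ∈ U, IsFredholmKernel μ (k s) C w
  meas_a : ∀ s ∈ U, Measurable (a s)
  meas_b : ∀ s ∈ U, Measurable (b s)
  bound_a : ∀ s ∈ U, ∀ x, ‖a s x‖ ≤ c₁
  bound_b : ∀ s ∈ U, ∀ y, ‖b s y‖ ≤ c₂ * w y
  nonneg_b : 0 ≤ c₂
  deriv : ∀ s ∈ U, ∀ x y, HasDerivAt (fun s => k s x y) (a s x * b s y) s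

/-- Differentiating row l puts a(t_l) b(t_j) into it. The scalar a(t_l) factors out, and a
determinant bordered by the row b remains. -/
lemma IsFredholmFamily.hasDerivAt_fdet (hk : IsFredholmFamily μ k a b C c₁ c₂ w U) {s : ℝ}
    (hs : s ∈ U) {n : ℕ} (t : Fin (n + 1) → X) :
    HasDerivAt (fun s => fdet (k s) t)
      (∑ l, a s (t l) * bord (k s) (b s) (t l) (fun i => t (l.succAbove i))) s := by
  refine (hasDerivAt_det (A := fun s => Matrix.of fun i j => k s (t i) (t j))
    (A' := Matrix.of fun i j => a s (t i) * b s (t j)) fun i j =>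
      hk.deriv s hs (t i) (t j)).congr_deriv ?_
  refine Finset.sum_congr rfl fun l _ => ?_
  rw [← det_updateRow_eq_bord, ← Matrix.det_updateRow_smul]
  rfl

/-- After integration all rows contribute equally, hence the factor n+1. Hadamard's bound, uniform
on `U`, justifies differentiation under the integral. -/
lemma IsFredholmFamily.hasDerivAt_fInt [SigmaFinite μ] (hk : IsFredholmFamily μ k a b C c₁ c₂ w U)
    (hU : IsOpen U)
    {s : ℝ} (hs : s ∈ U) (n : ℕ) :
    HasDerivAt (fun s => fInt μ (k s) (n + 1))
      ((n + 1) * ∫ x, a s x * bInt μ (k s) (b s) n x ∂μ) s := by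
  have hks := hk.kernel s hs
  have hbound : ∀ s ∈ U, ∀ (l : Fin (n + 1)) (t : Fin (n + 1) → X),
      ‖a s (t l) * bord (k s) (b s) (t l) (fun i => t (l.succAbove i))‖ ≤
        c₁ * ((Real.sqrt (n + 1 : ℕ)) ^ (n + 1) * (c₂ * C ^ n)) * ∏ j, w (t j) := by
    intro s hs l t
    rw [norm_mul]
    refine (mul_le_mul (hk.bound_a s hs _) ((hk.kernel s hs).norm_bord_le hk.nonneg_b
      (hk.bound_b s hs) (t l) _) (norm_nonneg _) ((norm_nonneg _).trans (hk.bound_a s hs (t l)))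
      ).trans (le_of_eq ?_)
    rw [Fin.prod_univ_succAbove _ l]
    ring
  have hinteg : Integrable (Function.uncurry fun (z : X) (t : Fin n → X) =>
      a s z * bord (k s) (b s) z t) (μ.prod (Measure.pi fun _ : Fin n => μ)) := by
    have hdom : Integrable (fun p : X × (Fin n → X) => w p.1 *
        (c₁ * ((Real.sqrt (n + 1 : ℕ)) ^ (n + 1) * (c₂ * C ^ n)) * ∏ j, w (p.2 j)))
        (μ.prod (Measure.pi fun _ : Fin n => μ)) :=
      hks.w_int.mul_prod ((hks.integrable_prod n).const_mul _)
    refine hdom.mono' ?_ (ae_of_all _ fun p => ?_)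
    · refine Measurable.aestronglyMeasurable ?_
      exact ((hk.meas_a s hs).comp measurable_fst).mul (measurable_bord hks.meas
        (r := fun _ => b s) ((hk.meas_b s hs).comp measurable_snd) measurable_fst measurable_snd)
    · simp only [Function.uncurry]
      rw [norm_mul]
      refine (mul_le_mul (hk.bound_a s hs _) (hks.norm_bord_le hk.nonneg_b
        (hk.bound_b s hs) p.1 _) (norm_nonneg _) ((norm_nonneg _).trans (hk.bound_a s hs p.1))
        ).trans (le_of_eq ?_)
      ring
  have hl := fun l : Fin (n + 1) => integral_pi_succAbove (μ := μ) l hinteg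
  have key := hasDerivAt_integral_of_dominated_loc_of_deriv_le
    (μ := Measure.pi fun _ : Fin (n + 1) => μ) (𝕜 := ℝ) (x₀ := s) (s := U)
    (F := fun s (t : Fin (n + 1) → X) => fdet (k s) t)
    (F' := fun s t => ∑ l, a s (t l) * bord (k s) (b s) (t l) (fun i => t (l.succAbove i)))
    (bound := fun t => ∑ _l : Fin (n + 1),
      c₁ * ((Real.sqrt (n + 1 : ℕ)) ^ (n + 1) * (c₂ * C ^ n)) * ∏ j, w (t j))
    (hU.mem_nhds hs) ?_ (hks.integrable_fdet _) ?_ ?_ ?_ ?_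
  · refine key.2.congr_deriv ?_
    rw [integral_finsetSum _ fun l _ => (hl l).1]
    simp only [(hl _).2, integral_const_mul, Finset.sum_const, Finset.card_univ, Fintype.card_fin,
      nsmul_eq_mul, bInt]
    push_cast
    ring
  · filter_upwards [hU.mem_nhds hs] with s' hs'
    exact ((hk.kernel s' hs').integrable_fdet _).aestronglyMeasurable
  · exact (integrable_finsetSum _ fun l _ => (hl l).1).aestronglyMeasurable
  · refine ae_of_all _ fun t s' hs' => (norm_sum_le _ _).trans (Finset.sum_le_sum fun l _ => ?_)
    exact hbound s' hs' l t
  · exact integrable_finsetSum _ fun l _ => (hks.integrable_prod _).const_mul _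
  · exact ae_of_all _ fun t s' hs' => hk.hasDerivAt_fdet hs' t

/-- The `n`-th term of the Fredholm series. -/
def fTerm (μ : Measure X) (k : X → X → ℂ) (n : ℕ) : ℂ := (-1) ^ n / (n ! : ℂ) * fInt μ k n

lemma norm_neg_one_pow_div (n : ℕ) : ‖(-1 : ℂ) ^ n / (n ! : ℂ)‖ = 1 / (n ! : ℝ) := by
  rw [norm_div, norm_pow, norm_neg, norm_one, one_pow, Complex.norm_natCast]

lemma IsFredholmKernel.norm_fTerm_le [SigmaFinite μ] {k : X → X → ℂ} (hk : IsFredholmKernel μ k C w)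
    (n : ℕ) :
    ‖fTerm μ k n‖ ≤ (Real.sqrt n) ^ n * (C * ∫ x, w x ∂μ) ^ n / (n ! : ℝ) := by
  rw [fTerm, norm_mul, norm_neg_one_pow_div, one_div_mul_eq_div]
  gcongr
  exact hk.norm_fInt_le n

lemma IsFredholmKernel.summable_fTerm [SigmaFinite μ] {k : X → X → ℂ}
    (hk : IsFredholmKernel μ k C w) :
    Summable (fTerm μ k) :=
  Summable.of_norm_bounded (summable_hadamard _ (mul_nonneg hk.nonneg hk.integral_nonneg))
    hk.norm_fTerm_le

/-- The majorant of the derivatives of the terms of the Fredholm series. -/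
lemma summable_hadamard_succ (c C W : ℝ) (hc : 0 ≤ c) (hC : 0 ≤ C) (hW : 0 ≤ W) :
    Summable fun n : ℕ => (Real.sqrt (n + 1 : ℕ)) ^ (n + 1) * (c * C ^ n) * W ^ n / (n ! : ℝ) := by
  have h := ((summable_nat_add_iff 1).2 (summable_hadamard (2 * ((C + 1) * (W + 1)))
    (by positivity))).mul_left c
  refine Summable.of_nonneg_of_le (fun n => by positivity) (fun n => ?_) h
  -- Pays for the factor n+1 between n! and (n+1)!; this is the origin of the 2 in the majorant.
  have h1 : ((n : ℝ) + 1) ≤ 2 ^ (n + 1) := by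
    have := (Nat.lt_two_pow_self (n := n + 1)).le
    exact_mod_cast this
  have h2 : C ^ n ≤ (C + 1) ^ (n + 1) := by
    calc C ^ n ≤ (C + 1) ^ n := by gcongr; linarith
      _ ≤ (C + 1) ^ (n + 1) := pow_le_pow_right₀ (by linarith) (Nat.le_succ n)
  have h3 : W ^ n ≤ (W + 1) ^ (n + 1) := by
    calc W ^ n ≤ (W + 1) ^ n := by gcongr; linarith
      _ ≤ (W + 1) ^ (n + 1) := pow_le_pow_right₀ (by linarith) (Nat.le_succ n)
  have hf : ((n + 1)! : ℝ) = (n + 1) * (n ! : ℝ) := by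
    rw [Nat.factorial_succ]; push_cast; ring
  have hf0 : (0 : ℝ) < n ! := by exact_mod_cast n.factorial_pos
  have h4 : ((n : ℝ) + 1) * (C ^ n * W ^ n) ≤ 2 ^ (n + 1) * ((C + 1) ^ (n + 1) * (W + 1) ^ (n + 1)) := by
    gcongr
  rw [hf, div_le_iff₀ hf0]
  have hne : ((n : ℝ) + 1) ≠ 0 := by positivity
  have h5 : c * (Real.sqrt (n + 1 : ℕ) ^ (n + 1) * (2 * ((C + 1) * (W + 1))) ^ (n + 1) /
      ((n + 1) * (n ! : ℝ))) * (n ! : ℝ) = c * Real.sqrt (n + 1 : ℕ) ^ (n + 1) *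
      ((2 ^ (n + 1) * ((C + 1) ^ (n + 1) * (W + 1) ^ (n + 1))) / (n + 1)) := by
    rw [mul_pow, mul_pow]
    field_simp
  rw [h5]
  have h6 : C ^ n * W ^ n ≤ (2 ^ (n + 1) * ((C + 1) ^ (n + 1) * (W + 1) ^ (n + 1))) / (n + 1) := by
    rw [le_div_iff₀ (by positivity)]
    linarith
  calc _ = c * Real.sqrt (n + 1 : ℕ) ^ (n + 1) * (C ^ n * W ^ n) := by ring
    _ ≤ _ := by gcongr

lemma IsFredholmFamily.hasDerivAt_tsum [SigmaFinite μ] (hk : IsFredholmFamily μ k a b C c₁ c₂ w U)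
    (hU : IsOpen U)
    (hU' : IsPreconnected U) {s : ℝ} (hs : s ∈ U) :
    HasDerivAt (fun s => ∑' n, fTerm μ (k s) n)
      (-∑' n : ℕ, (-1) ^ n / (n ! : ℂ) * ∫ x, a s x * bInt μ (k s) (b s) n x ∂μ) s := by
  have hks := hk.kernel s hs
  have hC := hks.nonneg
  set W := ∫ x, w x ∂μ with hW
  have hW0 : 0 ≤ W := hks.integral_nonneg
  set D : ℕ → ℝ → ℂ := fun n s => -((-1) ^ n / (n ! : ℂ) * ∫ x, a s x * bInt μ (k s) (b s) n x ∂μ)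
    with hD
  have hderiv : ∀ n, ∀ s ∈ U, HasDerivAt (fun s => fTerm μ (k s) (n + 1)) (D n s) s := by
    intro n s hs
    refine ((hk.hasDerivAt_fInt hU hs n).const_mul ((-1) ^ (n + 1) / ((n + 1)! : ℂ))).congr_deriv ?_
    simp only [hD]
    have h1 : (n ! : ℂ) ≠ 0 := by exact_mod_cast n.factorial_ne_zero
    have h2 : ((n : ℂ) + 1) ≠ 0 := by exact_mod_cast n.succ_ne_zero
    rw [Nat.factorial_succ, pow_succ]
    push_cast
    field_simp
  have hnorm : ∀ n, ∀ s ∈ U, ‖D n s‖ ≤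
      (Real.sqrt (n + 1 : ℕ)) ^ (n + 1) * (c₁ * c₂ * W * C ^ n) * W ^ n / (n ! : ℝ) := by
    intro n s hs
    have hb : ∀ x, ‖a s x * bInt μ (k s) (b s) n x‖ ≤
        c₁ * ((Real.sqrt (n + 1 : ℕ)) ^ (n + 1) * (c₂ * C ^ n) * W ^ n) * w x := by
      intro x
      rw [norm_mul, mul_assoc]
      exact mul_le_mul (hk.bound_a s hs x) ((hk.kernel s hs).norm_bInt_le hk.nonneg_b
        (hk.bound_b s hs) n x) (norm_nonneg _) ((norm_nonneg _).trans (hk.bound_a s hs x))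
    have h1 := norm_integral_le_of_norm_le (hks.w_int.const_mul _) (ae_of_all μ hb)
    rw [integral_const_mul] at h1
    simp only [hD]
    rw [norm_neg, norm_mul, norm_neg_one_pow_div, one_div_mul_eq_div]
    gcongr
    refine h1.trans (le_of_eq ?_)
    rw [← hW]
    ring
  -- The bound on `a` shows c₁ ≥ 0 only if there is a point to evaluate at. On an empty space `W` =
  -- 0, and the majorant vanishes.
  have hc₁ : 0 ≤ c₁ ∨ IsEmpty X := by
    rcases isEmpty_or_nonempty X with h | ⟨⟨x⟩⟩
    · exact Or.inr h
    · exact Or.inl ((norm_nonneg _).trans (hk.bound_a s hs x))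
  have hsum : Summable fun n : ℕ =>
      (Real.sqrt (n + 1 : ℕ)) ^ (n + 1) * (c₁ * c₂ * W * C ^ n) * W ^ n / (n ! : ℝ) := by
    rcases hc₁ with hc₁ | hX
    · exact summable_hadamard_succ (c₁ * c₂ * W) C W
        (mul_nonneg (mul_nonneg hc₁ hk.nonneg_b) hW0) hC hW0
    · have : W = 0 := by rw [hW]; simp [Measure.eq_zero_of_isEmpty μ]
      simp [this, summable_zero]
  have key := hasDerivAt_tsum_of_isPreconnected hsum hU hU' hderiv hnorm hs
    ((summable_nat_add_iff 1).2 hks.summable_fTerm) hs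
  have h0 : (fun s => ∑' n, fTerm μ (k s) n) =ᶠ[𝓝 s]
      fun s => fTerm μ (k s) 0 + ∑' n, fTerm μ (k s) (n + 1) := by
    filter_upwards [hU.mem_nhds hs] with s' hs'
    exact (hk.kernel s' hs').summable_fTerm.tsum_eq_zero_add
  have h1 : ∀ s, fTerm μ (k s) 0 = 1 := fun s => by simp [fTerm, fInt_zero]
  simp only [h1] at h0
  rw [← tsum_neg]
  exact (key.const_add 1).congr_of_eventuallyEq h0

end Family

end

section

/-! ### Dilations in `C([0,1])` and its dual -/

/-- The Banach space `C([0,1])`. -/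
abbrev E := BoundedContinuousFunction unitInterval ℂ

/-- The function `u ↦ h(s u)` on `[0,1]`. -/
def dil (h : C(ℝ, ℂ)) (s : ℝ) : E :=
  BoundedContinuousFunction.mkOfCompact ⟨fun u => h (s * u), by fun_prop⟩

@[simp]
lemma dil_apply (h : C(ℝ, ℂ)) (s : ℝ) (u : unitInterval) : dil h s u = h (s * u) := rfl

lemma continuous_dil (h : C(ℝ, ℂ)) : Continuous (dil h) := by
  have h1 : Continuous fun s : ℝ => (⟨fun u => h (s * u), by fun_prop⟩ : C(unitInterval, ℂ)) := by
    refine ContinuousMap.continuous_of_continuous_uncurry _ ?_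
    change Continuous fun p : ℝ × unitInterval => h (p.1 * p.2)
    fun_prop
  exact (ContinuousMap.linearIsometryBoundedOfCompact unitInterval ℂ ℂ).continuous.comp h1

/-- The extension of a function on `[0,1]` to the real line that is constant outside of `[0,1]`. -/
def ext (e : E) (v : ℝ) : ℂ := e (projIcc 0 1 zero_le_one v)

lemma continuous_ext (e : E) : Continuous (ext e) := e.continuous.comp continuous_projIcc

lemma norm_ext_le (e : E) (v : ℝ) : ‖ext e v‖ ≤ ‖e‖ := e.norm_coe_le_norm _

lemma ext_of_mem (e : E) {v : ℝ} (hv : v ∈ Icc (0 : ℝ) 1) : ext e v = e ⟨v, hv⟩ := by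
  rw [ext, projIcc_of_mem _ hv]

lemma integrableOn_mul_ext {h : ℝ → ℂ} (hh : IntegrableOn h (Ioo 0 1)) (e : E) :
    IntegrableOn (fun v => h v * ext e v) (Ioo 0 1) :=
  Integrable.mul_bdd (c := ‖e‖) hh (continuous_ext e).aestronglyMeasurable
    (ae_of_all _ fun v => norm_ext_le e v)

open Classical in
/-- The functional `e ↦ ∫_0^1 h(v) e(v) dv` on `C([0,1])`. -/
def dual (h : ℝ → ℂ) : E →L[ℂ] ℂ :=
  if hh : IntegrableOn h (Ioo 0 1) then
    LinearMap.mkContinuous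
      { toFun := fun e => ∫ v in Ioo 0 1, h v * ext e v
        map_add' := fun e e' => by
          rw [← integral_add (integrableOn_mul_ext hh e) (integrableOn_mul_ext hh e')]
          simp only [ext, BoundedContinuousFunction.coe_add, Pi.add_apply, mul_add]
        map_smul' := fun c e => by
          rw [RingHom.id_apply, smul_eq_mul, ← integral_const_mul]
          simp only [ext, BoundedContinuousFunction.coe_smul, smul_eq_mul, mul_left_comm] }
      (∫ v in Ioo 0 1, ‖h v‖)
      (fun e => by
        rw [← integral_mul_const]
        refine norm_integral_le_of_norm_le (hh.norm.mul_const _) (ae_of_all _ fun v => ?_)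
        rw [norm_mul]
        exact mul_le_mul_of_nonneg_left (norm_ext_le e v) (norm_nonneg _))
  else 0

lemma dual_apply {h : ℝ → ℂ} (hh : IntegrableOn h (Ioo 0 1)) (e : E) :
    dual h e = ∫ v in Ioo 0 1, h v * ext e v := by
  rw [dual, dif_pos hh]
  rfl

lemma norm_dual_le {h : ℝ → ℂ} (hh : IntegrableOn h (Ioo 0 1)) :
    ‖dual h‖ ≤ ∫ v in Ioo 0 1, ‖h v‖ := by
  rw [dual, dif_pos hh]
  exact LinearMap.mkContinuous_norm_le _ (integral_nonneg fun v => norm_nonneg _) _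

lemma dual_sub {h k : ℝ → ℂ} (hh : IntegrableOn h (Ioo 0 1)) (hk : IntegrableOn k (Ioo 0 1)) :
    dual (fun v => h v - k v) = dual h - dual k := by
  ext e
  rw [sub_apply, dual_apply (show IntegrableOn (fun v => h v - k v) _ from hh.sub hk), dual_apply hh, dual_apply hk,
    ← integral_sub (integrableOn_mul_ext hh e) (integrableOn_mul_ext hk e)]
  simp only [sub_mul]

lemma dual_congr {h k : ℝ → ℂ} (hhk : ∀ v ∈ Ioo (0 : ℝ) 1, h v = k v) : dual h = dual k := by
  have hi : IntegrableOn h (Ioo 0 1) ↔ IntegrableOn k (Ioo 0 1) :=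
    integrableOn_congr_fun hhk measurableSet_Ioo
  by_cases hh : IntegrableOn h (Ioo 0 1)
  · ext e
    rw [dual_apply hh, dual_apply (hi.1 hh)]
    refine setIntegral_congr_fun measurableSet_Ioo fun v hv => ?_
    simp only [hhk v hv]
  · rw [dual, dif_neg hh, dual, dif_neg (fun h => hh (hi.2 h))]

lemma dual_const_mul {h : ℝ → ℂ} (hh : IntegrableOn h (Ioo 0 1)) (c : ℂ) :
    dual (fun v => c * h v) = c • dual h := by
  ext e
  rw [smul_apply, dual_apply (hh.const_mul c), dual_apply hh, smul_eq_mul,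
    ← integral_const_mul]
  simp only [mul_assoc]

lemma integrableOn_rpow_quarter : IntegrableOn (fun v : ℝ => v ^ (-1 / 4 : ℝ)) (Ioo 0 1) :=
  (intervalIntegrable_iff_integrableOn_Ioo_of_le zero_le_one).1 (intervalIntegrable_rpow_quarter 0 1)

lemma rpow_quarter_anti {x y : ℝ} (hx : 0 < x) (hxy : x ≤ y) :
    y ^ (-1 / 4 : ℝ) ≤ x ^ (-1 / 4 : ℝ) :=
  Real.rpow_le_rpow_of_nonpos hx hxy (by norm_num)

section Singular

variable {h : ℝ → ℂ}

lemma IsSingular.integrableOn_dil (hh : IsSingular h) {s : ℝ} (hs : 0 < s) :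
    IntegrableOn (fun v => h (s * v)) (Ioo 0 1) :=
  (hh.comp_mul hs).integrableOn zero_le_one

/-- Uniform bounds for dilations by numbers close to `s`. -/
lemma IsSingular.exists_bound_near (hh : IsSingular h) {s : ℝ} (hs : 0 < s) :
    ∃ C, 0 ≤ C ∧ ∀ r ∈ Ioo (s / 2) (2 * s), ∀ v ∈ Ioo (0 : ℝ) 1,
      ‖h (r * v)‖ ≤ C * v ^ (-1 / 4 : ℝ) := by
  obtain ⟨C, h0, hC⟩ := hh.bound (2 * s)
  refine ⟨C * (s / 2) ^ (-1 / 4 : ℝ), by positivity, fun r hr v hv => ?_⟩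
  have hr0 : 0 < r := lt_trans (by linarith) hr.1
  refine (hC (r * v) (mul_pos hr0 hv.1) (by nlinarith [hr.2, hv.2, hv.1])).trans ?_
  rw [Real.mul_rpow hr0.le hv.1.le, mul_assoc]
  have := rpow_quarter_anti (by linarith) hr.1.le
  have := Real.rpow_nonneg hv.1.le (-1 / 4)
  gcongr

lemma IsSingular.continuousOn_dual (hh : IsSingular h) : ContinuousOn
    (fun s : ℝ => dual fun v => h (s * v)) (Ioi 0) := by
  intro s hs
  refine ContinuousAt.continuousWithinAt ?_
  have hs' : 0 < s := hs
  obtain ⟨C, h0, hC⟩ := hh.exists_bound_near hs'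
  have hnear : Ioo (s / 2) (2 * s) ∈ 𝓝 s := Ioo_mem_nhds (by linarith) (by linarith)
  refine tendsto_iff_norm_sub_tendsto_zero.2 ?_
  have hlim : Tendsto (fun r : ℝ => ∫ v in Ioo (0 : ℝ) 1, ‖h (r * v) - h (s * v)‖) (𝓝 s)
      (𝓝 (∫ v in Ioo (0 : ℝ) 1, 0)) := by
    refine tendsto_integral_filter_of_dominated_convergence
      (fun v => C * v ^ (-1 / 4 : ℝ) + C * v ^ (-1 / 4 : ℝ)) ?_ ?_ ?_ ?_
    · filter_upwards [Ioi_mem_nhds hs'] with r hr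
      exact ((hh.integrableOn_dil hr).sub (hh.integrableOn_dil hs')).norm.aestronglyMeasurable
    · filter_upwards [hnear] with r hr
      refine (ae_restrict_mem measurableSet_Ioo).mono fun v hv => ?_
      rw [norm_norm]
      exact (norm_sub_le _ _).trans (add_le_add (hC r hr v hv) (hC s (mem_of_mem_nhds hnear) v hv))
    · exact (integrableOn_rpow_quarter.const_mul C).add (integrableOn_rpow_quarter.const_mul C)
    · refine (ae_restrict_mem measurableSet_Ioo).mono fun v hv => ?_
      have h1 : ContinuousAt h (s * v) := hh.cont.continuousAt (Ioi_mem_nhds (mul_pos hs' hv.1))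
      have h2 : ContinuousAt (fun r : ℝ => ‖h (r * v) - h (s * v)‖) s :=
        ((ContinuousAt.comp (f := fun r : ℝ => r * v) h1 (by fun_prop)).sub continuousAt_const).norm
      simpa [ContinuousAt] using h2
  rw [integral_zero] at hlim
  refine squeeze_zero' (Eventually.of_forall fun r => norm_nonneg _) ?_ hlim
  filter_upwards [Ioi_mem_nhds hs'] with r hr
  rw [← dual_sub (hh.integrableOn_dil hr) (hh.integrableOn_dil hs')]
  exact norm_dual_le ((hh.integrableOn_dil hr).sub (hh.integrableOn_dil hs'))

lemma IsSingular.norm_dual_dil_le (hh : IsSingular h) (A : ℝ) :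
    ∃ C, 0 ≤ C ∧ ∀ s : ℝ, 0 < s → s ≤ A →
      ‖dual fun v => h (s * v)‖ ≤ C * s ^ (-1 / 4 : ℝ) := by
  obtain ⟨C, h0, hC⟩ := hh.bound A
  refine ⟨C * ∫ v in Ioo (0 : ℝ) 1, v ^ (-1 / 4 : ℝ), mul_nonneg h0
    (setIntegral_nonneg measurableSet_Ioo fun v hv => Real.rpow_nonneg hv.1.le _),
    fun s hs hsA => ?_⟩
  refine (norm_dual_le (hh.integrableOn_dil hs)).trans ?_
  rw [mul_assoc, mul_comm (∫ v in Ioo (0 : ℝ) 1, v ^ (-1 / 4 : ℝ)), ← mul_assoc, ← integral_const_mul]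
  refine setIntegral_mono_on (hh.integrableOn_dil hs).norm
    (integrableOn_rpow_quarter.const_mul _) measurableSet_Ioo fun v hv => ?_
  rw [mul_assoc, ← Real.mul_rpow hs.le hv.1.le]
  exact hC _ (mul_pos hs hv.1) (by nlinarith [hv.2, hv.1])

end Singular

/-- A curve in a Banach space is differentiable if it is so after applying each of a separating
family of functionals, with a derivative that is continuous in norm. -/
lemma hasDerivAt_of_separating {W : Type*} [NormedAddCommGroup W] [NormedSpace ℂ W]
    [CompleteSpace W] {ι : Type*} (l : ι → W →L[ℂ] ℂ) (hsep : ∀ x, (∀ i, l i x = 0) → x = 0)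
    {L B : ℝ → W} (hB : ContinuousOn B (Ioi 0))
    (hL : ∀ i, ∀ s, 0 < s → HasDerivAt (fun s => l i (L s)) (l i (B s)) s) {s : ℝ} (hs : 0 < s) :
    HasDerivAt L (B s) s := by
  have hinteg : ∀ t, 0 < t → IntervalIntegrable B volume s t := fun t ht =>
    ContinuousOn.intervalIntegrable (hB.mono fun r hr =>
      lt_of_lt_of_le (lt_min hs ht) hr.1)
  -- The primitive of B is differentiable in norm because B is norm continuous; the functionals then
  -- identify it with L.
  have hFTC : HasDerivAt (fun t => L s + ∫ r in s..t, B r) (B s) s := by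
    refine HasDerivAt.const_add _ ?_
    refine intervalIntegral.integral_hasDerivAt_right (hinteg s hs) ?_
      (hB.continuousAt (Ioi_mem_nhds hs))
    exact hB.stronglyMeasurableAtFilter isOpen_Ioi s hs
  refine hFTC.congr_of_eventuallyEq ?_
  filter_upwards [Ioi_mem_nhds hs] with t ht
  rw [← sub_eq_zero]
  refine hsep _ fun i => ?_
  have h1 : ∫ r in s..t, l i (B r) = l i (L t) - l i (L s) := by
    refine intervalIntegral.integral_eq_sub_of_hasDerivAt (fun r hr => hL i r ?_) ?_
    · exact lt_of_lt_of_le (lt_min hs ht) hr.1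
    · exact ContinuousOn.intervalIntegrable ((l i).continuous.comp_continuousOn (hB.mono fun r hr =>
        lt_of_lt_of_le (lt_min hs ht) hr.1))
  rw [map_sub, map_add, ← ContinuousLinearMap.intervalIntegral_comp_comm _ (hinteg t ht), h1]
  ring

lemma continuousOn_ofReal_inv : ContinuousOn (fun s : ℝ => (s : ℂ)⁻¹) (Ioi 0) := by
  intro s hs
  have : (s : ℂ) ≠ 0 := by exact_mod_cast (ne_of_gt hs)
  exact (Complex.continuous_ofReal.continuousAt.inv₀ this).continuousWithinAt

lemma IsSingular.hasDerivAt_dual {h θ : ℝ → ℂ} (hh : IsSingular h) (hθ : IsSingular θ)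
    (hd : ∀ y : ℝ, 0 < y → HasDerivAt h ((y : ℂ)⁻¹ * θ y) y) {s : ℝ} (hs : 0 < s) :
    HasDerivAt (fun s : ℝ => dual fun v => h (s * v))
      ((s : ℂ)⁻¹ • dual fun v => θ (s * v)) s := by
  refine hasDerivAt_of_separating (W := E →L[ℂ] ℂ) (fun e => ContinuousLinearMap.apply ℂ ℂ e)
    (fun x hx => ContinuousLinearMap.ext hx)
    (B := fun s : ℝ => (s : ℂ)⁻¹ • dual fun v => θ (s * v)) ?_ ?_ hs
  · exact continuousOn_ofReal_inv.smul hθ.continuousOn_dual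
  · intro e s hs
    obtain ⟨C, h0, hC⟩ := hθ.exists_bound_near hs
    have hnear : Ioo (s / 2) (2 * s) ∈ 𝓝 s := Ioo_mem_nhds (by linarith) (by linarith)
    have key := hasDerivAt_integral_of_dominated_loc_of_deriv_le (𝕜 := ℝ)
      (μ := volume.restrict (Ioo (0 : ℝ) 1)) (F := fun s v => h (s * v) * ext e v)
      (F' := fun s v => (s : ℂ)⁻¹ * θ (s * v) * ext e v) (x₀ := s) (s := Ioo (s / 2) (2 * s))
      (bound := fun v => (s / 2)⁻¹ * (C * v ^ (-1 / 4 : ℝ)) * ‖e‖) hnear ?_ ?_ ?_ ?_ ?_ ?_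
    · have h2 := key.2
      have e2 : (s : ℂ)⁻¹ * dual (fun v => θ (s * v)) e =
          ∫ v in Ioo (0 : ℝ) 1, (s : ℂ)⁻¹ * θ (s * v) * ext e v := by
        rw [dual_apply (hθ.integrableOn_dil hs), ← integral_const_mul]
        simp only [mul_assoc]
      simp only [ContinuousLinearMap.apply_apply, smul_apply, smul_eq_mul, e2]
      refine h2.congr_of_eventuallyEq ?_
      filter_upwards [Ioi_mem_nhds hs] with r hr
      rw [dual_apply (hh.integrableOn_dil hr)]
    · filter_upwards [Ioi_mem_nhds hs] with r hr
      exact (integrableOn_mul_ext (hh.integrableOn_dil hr) e).aestronglyMeasurable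
    · exact integrableOn_mul_ext (hh.integrableOn_dil hs) e
    · exact (integrableOn_mul_ext ((hθ.integrableOn_dil hs).const_mul _) e).aestronglyMeasurable
    · refine (ae_restrict_mem measurableSet_Ioo).mono fun v hv r hr => ?_
      have hr0 : 0 < r := lt_trans (by linarith) hr.1
      rw [norm_mul, norm_mul, norm_inv, Complex.norm_real, Real.norm_of_nonneg hr0.le]
      have h1 := hC r hr v hv
      have h2 := norm_ext_le e v
      have h3 : r⁻¹ ≤ (s / 2)⁻¹ := inv_anti₀ (by linarith) hr.1.le
      have h4 : 0 ≤ (s / 2)⁻¹ := by positivity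
      gcongr
      · exact mul_nonneg h4 ((norm_nonneg _).trans h1)
    · exact ((integrableOn_rpow_quarter.const_mul C).const_mul _).mul_const _
    · refine (ae_restrict_mem measurableSet_Ioo).mono fun v hv r hr => ?_
      have hr0 : 0 < r := lt_trans (by linarith) hr.1
      exact (hasDerivAt_comp_mul hv.1 (hd (r * v) (mul_pos hr0 hv.1))).mul_const _

lemma eq_zero_of_forall_pos {e : E} (he : ∀ u : unitInterval, 0 < (u : ℝ) → e u = 0) : e = 0 := by
  have h1 : EqOn e 0 (closure {u : unitInterval | 0 < (u : ℝ)}) :=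
    Set.EqOn.closure (fun u hu => he u hu) e.continuous continuous_const
  ext u
  refine h1 ?_
  rcases lt_or_eq_of_le u.2.1 with hu | hu
  · exact subset_closure hu
  · rw [mem_closure_iff_seq_limit]
    refine ⟨fun n => ⟨1 / ((n : ℝ) + 1), by positivity, ?_⟩, fun n => ?_, ?_⟩
    · rw [div_le_one (by positivity)]
      linarith [(n.cast_nonneg : (0 : ℝ) ≤ n)]
    · change (0 : ℝ) < 1 / ((n : ℝ) + 1)
      positivity
    · rw [tendsto_subtype_rng, ← hu]
      exact tendsto_one_div_add_atTop_nhds_zero_nat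

/-- Evaluation at a point of `[0,1]`. -/
def evalE (u : unitInterval) : E →L[ℂ] ℂ := BoundedContinuousFunction.evalCLM ℂ u

@[simp]
lemma evalE_apply (u : unitInterval) (e : E) : evalE u e = e u := rfl

/-- Evaluations at u > 0 already separate C([0,1]), so the missing information on `h` at the origin
does no harm. -/
lemma hasDerivAt_dil {h θ : C(ℝ, ℂ)} (hd : ∀ y : ℝ, 0 < y → HasDerivAt h ((y : ℂ)⁻¹ * θ y) y)
    {s : ℝ}
    (hs : 0 < s) : HasDerivAt (dil h) ((s : ℂ)⁻¹ • dil θ s) s := by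
  refine hasDerivAt_of_separating (W := E)
    (fun u : {u : unitInterval // 0 < (u : ℝ)} => evalE u)
    (fun x hx => eq_zero_of_forall_pos fun u hu => hx ⟨u, hu⟩)
    (B := fun s : ℝ => (s : ℂ)⁻¹ • dil θ s) ?_ ?_ hs
  · exact continuousOn_ofReal_inv.smul (continuous_dil θ).continuousOn
  · intro u s hs
    exact hasDerivAt_comp_mul u.2 (hd (s * u) (mul_pos hs u.2))

end

section

/-! ### The integral operator on `C([0,1])` -/

instance : NormedRing (E →L[ℂ] E) := ContinuousLinearMap.toNormedRing

instance : NormedAlgebra ℂ (E →L[ℂ] E) := ContinuousLinearMap.toNormedAlgebra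

/-- Curves of operators are differentiated and integrated over a real parameter, which requires a
real structure on the complex Banach algebra. -/
instance : NormedSpace ℝ (E →L[ℂ] E) := NormedSpace.restrictScalars ℝ ℂ (E →L[ℂ] E)

instance : CompleteSpace (E →L[ℂ] E) := inferInstance

/-- The columns `u ↦ ∫_0^1 a(t s u) b(t y) dt` of the kernel. -/
def kap (a : C(ℝ, ℂ)) (b : ℝ → ℂ) (y s : ℝ) : E := ∫ t in (0 : ℝ)..1, b (t * y) • dil a (t * s)

/-- The operators of rank one `e ↦ (∫_0^1 b(r v) e(v) dv) a(r u)`. -/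
def rankOne (a : C(ℝ, ℂ)) (b : ℝ → ℂ) (r : ℝ) : E →L[ℂ] E :=
  (dual fun v => b (r * v)).smulRight (dil a r)

/-- The integral operator, rescaled to `[0,1]`. -/
def opK (a : C(ℝ, ℂ)) (b : ℝ → ℂ) (s : ℝ) : E →L[ℂ] E := ∫ r in (0 : ℝ)..s, rankOne a b r

lemma exists_norm_dil_le (a : C(ℝ, ℂ)) (A : ℝ) :
    ∃ C, 0 ≤ C ∧ ∀ s : ℝ, 0 ≤ s → s ≤ A → ‖dil a s‖ ≤ C := by
  obtain ⟨C, hC⟩ := (isCompact_Icc (a := (0 : ℝ)) (b := A)).exists_bound_of_continuousOn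
    (continuous_dil a).continuousOn
  exact ⟨max C 0, le_max_right _ _, fun s hs hsA => (hC s ⟨hs, hsA⟩).trans (le_max_left _ _)⟩

lemma tendsto_primitive_zero {W : Type*} [NormedAddCommGroup W] [NormedSpace ℝ W] {h : ℝ → W}
    {A : ℝ} (hA : 0 < A) (hi : IntervalIntegrable h volume 0 A) :
    Tendsto (fun s => ∫ r in (0 : ℝ)..s, h r) (𝓝[>] 0) (𝓝 0) := by
  have h : ContinuousWithinAt (fun s => ∫ r in (0 : ℝ)..s, h r) (uIcc 0 A) 0 :=
    intervalIntegral.continuousOn_primitive_interval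
      (by rwa [uIcc_of_le hA.le, ← intervalIntegrable_iff_integrableOn_Icc_of_le hA.le]) 0 (by simp)
  rw [ContinuousWithinAt, intervalIntegral.integral_same, uIcc_of_le hA.le] at h
  exact h.mono_left (nhdsWithin_le_of_mem
    (mem_of_superset (Ioo_mem_nhdsGT hA) Ioo_subset_Icc_self))

section Operator

variable {a : C(ℝ, ℂ)} {b : ℝ → ℂ}

lemma exists_bound_integrand (hb : IsSingular b) (A : ℝ) : ∃ C, 0 ≤ C ∧ ∀ y : ℝ, 0 < y → y ≤ A → ∀ s
    : ℝ, 0 ≤ s →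
    s ≤ A → ∀ t : ℝ, 0 < t → t ≤ 1 →
      ‖b (t * y) • dil a (t * s)‖ ≤ C * y ^ (-1 / 4 : ℝ) * t ^ (-1 / 4 : ℝ) := by
  obtain ⟨C, h0, hC⟩ := hb.bound A
  obtain ⟨C', h0', hC'⟩ := exists_norm_dil_le a A
  refine ⟨C * C', by positivity, fun y hy hyA s hs hsA t ht ht1 => ?_⟩
  have h1 := hC (t * y) (mul_pos ht hy) ((mul_le_of_le_one_left hy.le ht1).trans hyA)
  have h2 := hC' (t * s) (mul_nonneg ht.le hs) ((mul_le_of_le_one_left hs ht1).trans hsA)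
  rw [norm_smul]
  refine (mul_le_mul h1 h2 (norm_nonneg _) ((norm_nonneg _).trans h1)).trans (le_of_eq ?_)
  rw [Real.mul_rpow ht.le hy.le]
  ring

lemma continuousOn_integrand (hb : IsSingular b) {y : ℝ} (hy : 0 < y) (s : ℝ) :
    ContinuousOn (fun t : ℝ => b (t * y) • dil a (t * s)) (Ioi 0) := by
  have h1 : ContinuousOn (fun t : ℝ => b (t * y)) (Ioi 0) :=
    hb.cont.comp (by fun_prop) fun t ht => mul_pos ht hy
  exact h1.smul ((continuous_dil a).comp (continuous_mul_const s)).continuousOn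

lemma intervalIntegrable_integrand (hb : IsSingular b) {y : ℝ} (hy : 0 < y) {s : ℝ} (hs : 0 ≤ s) :
    IntervalIntegrable (fun t : ℝ => b (t * y) • dil a (t * s)) volume 0 1 := by
  obtain ⟨C, -, hC⟩ := exists_bound_integrand (a := a) hb (max y s)
  exact intervalIntegrable_of_norm_le_rpow zero_le_one (continuousOn_integrand hb hy s)
    fun t ht ht1 => hC y hy (le_max_left _ _) s hs (le_max_right _ _) t ht ht1

lemma exists_norm_kap_le (hb : IsSingular b) (A : ℝ) : ∃ C, 0 ≤ C ∧ ∀ y : ℝ, 0 < y → y ≤ A → ∀ s :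
    ℝ, 0 ≤ s →
    s ≤ A → ‖kap a b y s‖ ≤ C * y ^ (-1 / 4 : ℝ) := by
  obtain ⟨C, h0, hC⟩ := exists_bound_integrand (a := a) hb A
  have hI : 0 ≤ ∫ t in (0 : ℝ)..1, t ^ (-1 / 4 : ℝ) :=
    intervalIntegral.integral_nonneg zero_le_one fun t ht => Real.rpow_nonneg ht.1 _
  refine ⟨C * ∫ t in (0 : ℝ)..1, t ^ (-1 / 4 : ℝ), by positivity, fun y hy hyA s hs hsA => ?_⟩
  refine (intervalIntegral.norm_integral_le_of_norm_le zero_le_one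
    (ae_of_all _ fun t ht => hC y hy hyA s hs hsA t ht.1 ht.2)
    ((intervalIntegrable_rpow_quarter 0 1).const_mul _)).trans (le_of_eq ?_)
  rw [intervalIntegral.integral_const_mul]
  ring

lemma continuousAt_kap (hb : IsSingular b) {y s : ℝ} (hy : 0 < y) (hs : 0 < s) :
    ContinuousAt (fun p : ℝ × ℝ => kap a b p.1 p.2) (y, s) := by
  obtain ⟨C, h0, hC⟩ := exists_bound_integrand (a := a) hb (2 * max y s)
  have hnear : ∀ᶠ p : ℝ × ℝ in 𝓝 (y, s),
      (y / 2 < p.1 ∧ p.1 < 2 * max y s) ∧ 0 < p.2 ∧ p.2 < 2 * max y s := by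
    have h1 : y < 2 * max y s := by linarith [le_max_left y s]
    have h2 : s < 2 * max y s := by linarith [le_max_right y s]
    exact (continuous_fst.continuousAt.eventually (Ioo_mem_nhds (a := y / 2) (by simp; linarith) h1)).and
      (continuous_snd.continuousAt.eventually (Ioo_mem_nhds hs h2))
  refine intervalIntegral.continuousAt_of_dominated_interval
    (bound := fun t => C * (y / 2) ^ (-1 / 4 : ℝ) * t ^ (-1 / 4 : ℝ)) ?_ ?_ ?_ ?_
  · filter_upwards [hnear] with p hp
    rw [uIoc_of_le zero_le_one]
    exact ((continuousOn_integrand hb (by linarith [hp.1.1]) p.2).mono fun t ht => ht.1).aestronglyMeasurable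
      measurableSet_Ioc
  · filter_upwards [hnear] with p hp
    refine ae_of_all _ fun t ht => ?_
    rw [uIoc_of_le zero_le_one] at ht
    refine (hC p.1 (by linarith [hp.1.1]) hp.1.2.le p.2 hp.2.1.le hp.2.2.le t ht.1 ht.2).trans ?_
    have := rpow_quarter_anti (by linarith : 0 < y / 2) hp.1.1.le
    have := Real.rpow_nonneg ht.1.le (-1 / 4)
    gcongr
  · exact (intervalIntegrable_rpow_quarter 0 1).const_mul _
  · refine ae_of_all _ fun t ht => ?_
    rw [uIoc_of_le zero_le_one] at ht
    have h1 : ContinuousAt b (t * y) := hb.cont.continuousAt (Ioi_mem_nhds (mul_pos ht.1 hy))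
    have h2 : ContinuousAt (fun p : ℝ × ℝ => b (t * p.1)) (y, s) :=
      ContinuousAt.comp (f := fun p : ℝ × ℝ => t * p.1) (x := (y, s)) h1 (by fun_prop)
    exact h2.smul ((continuous_dil a).comp (continuous_snd.const_mul t)).continuousAt

lemma kap_apply (hb : IsSingular b) {y : ℝ} (hy : 0 < y) {s : ℝ} (hs : 0 ≤ s) (u : unitInterval) :
    kap a b y s u = ∫ t in (0 : ℝ)..1, a (t * (s * u)) * b (t * y) := by
  have h := ContinuousLinearMap.intervalIntegral_comp_comm (evalE u)
    (intervalIntegrable_integrand (a := a) hb hy hs)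
  rw [evalE_apply] at h
  rw [kap, ← h]
  refine intervalIntegral.integral_congr fun t _ => ?_
  simp only [evalE_apply, BoundedContinuousFunction.coe_smul, dil_apply, smul_eq_mul, mul_assoc]
  rw [mul_comm]

/-- Rescaling of the columns of the kernel. -/
lemma smul_kap_eq {s : ℝ} (v : ℝ) : (s : ℂ) • kap a b (s * v) s = ∫ r in (0 : ℝ)..s, b (r * v) • dil
    a r := by
  have h := intervalIntegral.smul_integral_comp_mul_right
    (fun r : ℝ => b (r * v) • dil a r) s (a := 0) (b := 1)
  rw [zero_mul, one_mul] at h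
  rw [← h, kap, ← Complex.coe_smul]
  simp only [mul_assoc]

/-- After the substitution r = ts the parameter s occurs only as the upper limit, so the derivative
is the integrand itself, of rank one. This is the purpose of the rescaling to [0,1]. -/
lemma hasDerivAt_smul_kap (hb : IsSingular b) {s v : ℝ} (hs : 0 < s) (hv : 0 < v) :
    HasDerivAt (fun s : ℝ => (s : ℂ) • kap a b (s * v) s) (b (s * v) • dil a s) s := by
  simp only [smul_kap_eq]
  have hc : ContinuousOn (fun r : ℝ => b (r * v) • dil a r) (Ioi 0) := by
    simpa using continuousOn_integrand (a := a) hb hv 1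
  obtain ⟨C, -, hC⟩ := (hb.comp_mul hv).bound s
  obtain ⟨C', h0', hC'⟩ := exists_norm_dil_le a s
  refine intervalIntegral.integral_hasDerivAt_right
    (intervalIntegrable_of_norm_le_rpow (C := C * C') hs.le hc fun t ht hts => ?_)
    (hc.stronglyMeasurableAtFilter isOpen_Ioi s hs) (hc.continuousAt (Ioi_mem_nhds hs))
  rw [norm_smul]
  have h1 := hC t ht hts
  rw [mul_comm v t] at h1
  refine (mul_le_mul h1 (hC' t ht.le hts) (norm_nonneg _) ((norm_nonneg _).trans h1)).trans
    (le_of_eq (by ring))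

lemma continuousOn_rankOne (hb : IsSingular b) : ContinuousOn (rankOne a b) (Ioi 0) := by
  have h : ContinuousOn (fun r => ContinuousLinearMap.smulRightL ℂ E E (dual fun v => b (r * v)) (dil a r))
      (Ioi 0) :=
    ((ContinuousLinearMap.smulRightL ℂ E E).continuous.comp_continuousOn hb.continuousOn_dual).clm_apply
      (continuous_dil a).continuousOn
  exact h

lemma exists_norm_rankOne_le (hb : IsSingular b) (A : ℝ) : ∃ C, 0 ≤ C ∧ ∀ r : ℝ, 0 < r → r ≤ A →
    ‖rankOne a b r‖ ≤ C * r ^ (-1 / 4 : ℝ) := by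
  obtain ⟨C, h0, hC⟩ := hb.norm_dual_dil_le A
  obtain ⟨C', h0', hC'⟩ := exists_norm_dil_le a A
  refine ⟨C * C', by positivity, fun r hr hrA => ?_⟩
  rw [rankOne, ContinuousLinearMap.norm_smulRight_apply]
  have h1 := hC r hr hrA
  exact (mul_le_mul h1 (hC' r hr.le hrA) (norm_nonneg _) ((norm_nonneg _).trans h1)).trans
    (le_of_eq (by ring))

lemma intervalIntegrable_rankOne (hb : IsSingular b) {s : ℝ} (hs : 0 ≤ s) :
    IntervalIntegrable (rankOne a b) volume 0 s := by
  obtain ⟨C, -, hC⟩ := exists_norm_rankOne_le (a := a) hb s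
  exact intervalIntegrable_of_norm_le_rpow hs (continuousOn_rankOne hb) hC

lemma hasDerivAt_opK (hb : IsSingular b) {s : ℝ} (hs : 0 < s) : HasDerivAt (opK a b) (rankOne a b s)
    s :=
  intervalIntegral.integral_hasDerivAt_right (intervalIntegrable_rankOne hb hs.le)
    ((continuousOn_rankOne hb).stronglyMeasurableAtFilter isOpen_Ioi s hs)
    ((continuousOn_rankOne hb).continuousAt (Ioi_mem_nhds hs))

lemma tendsto_opK_zero (hb : IsSingular b) : Tendsto (opK a b) (𝓝[>] 0) (𝓝 0) :=
  tendsto_primitive_zero one_pos (intervalIntegrable_rankOne hb zero_le_one)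

lemma integrable_kernel_prod (hb : IsSingular b) {s : ℝ} (hs : 0 < s) (e : E) :
    Integrable (Function.uncurry fun r v : ℝ => ext e v • b (r * v) • dil a r)
      ((volume.restrict (Ioc 0 s)).prod (volume.restrict (Ioo 0 1))) := by
  obtain ⟨C, h0, hC⟩ := hb.bound s
  obtain ⟨C', h0', hC'⟩ := exists_norm_dil_le a s
  have hdom : Integrable (fun p : ℝ × ℝ => (‖e‖ * C * C') * (p.1 ^ (-1 / 4 : ℝ) * p.2 ^ (-1 / 4 : ℝ)))
      ((volume.restrict (Ioc 0 s)).prod (volume.restrict (Ioo 0 1))) :=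
    (Integrable.mul_prod ((intervalIntegrable_iff_integrableOn_Ioc_of_le hs.le).1
      (intervalIntegrable_rpow_quarter 0 s)) integrableOn_rpow_quarter).const_mul _
  rw [Measure.prod_restrict] at hdom ⊢
  refine hdom.mono' ?_ ?_
  · refine ContinuousOn.aestronglyMeasurable ?_ (measurableSet_Ioc.prod measurableSet_Ioo)
    have h1 : ContinuousOn (fun p : ℝ × ℝ => b (p.1 * p.2)) (Ioc 0 s ×ˢ Ioo 0 1) :=
      hb.cont.comp (by fun_prop) fun p hp => mul_pos hp.1.1 hp.2.1
    exact ((continuous_ext e).comp continuous_snd).continuousOn.smul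
      (h1.smul ((continuous_dil a).comp continuous_fst).continuousOn)
  · refine (ae_restrict_mem (measurableSet_Ioc.prod measurableSet_Ioo)).mono fun p hp => ?_
    have h1 := hC (p.1 * p.2) (mul_pos hp.1.1 hp.2.1)
      ((mul_le_of_le_one_right hp.1.1.le hp.2.2.le).trans hp.1.2)
    rw [Real.mul_rpow hp.1.1.le hp.2.1.le] at h1
    have h2 := hC' p.1 hp.1.1.le hp.1.2
    rw [Function.uncurry, norm_smul, norm_smul]
    calc _ ≤ ‖e‖ * ((C * (p.1 ^ (-1 / 4 : ℝ) * p.2 ^ (-1 / 4 : ℝ))) * C') := by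
          gcongr
          · exact norm_ext_le e _
          · exact (norm_nonneg _).trans h1
      _ = _ := by ring

/-- The integral operator in terms of the columns of its kernel. -/
lemma opK_apply (hb : IsSingular b) {s : ℝ} (hs : 0 < s) (e : E) :
    opK a b s e = ∫ v in Ioo (0 : ℝ) 1, ext e v • (s : ℂ) • kap a b (s * v) s := by
  have h1 : opK a b s e = ∫ r in Ioc 0 s, ∫ v in Ioo (0 : ℝ) 1, ext e v • b (r * v) • dil a r := by
    rw [opK, intervalIntegral.integral_of_le hs.le, ContinuousLinearMap.integral_apply
      ((intervalIntegrable_iff_integrableOn_Ioc_of_le hs.le).1 (intervalIntegrable_rankOne hb hs.le))]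
    refine setIntegral_congr_fun measurableSet_Ioc fun r hr => ?_
    simp only [rankOne, ContinuousLinearMap.smulRight_apply]
    rw [dual_apply (hb.integrableOn_dil hr.1), ← integral_smul_const]
    simp only [smul_smul, mul_comm]
  rw [h1, integral_integral_swap (integrable_kernel_prod hb hs e)]
  refine setIntegral_congr_fun measurableSet_Ioo fun v hv => ?_
  simp only [smul_kap_eq, intervalIntegral.integral_of_le hs.le, integral_smul]

lemma continuousOn_smul_kap (hb : IsSingular b) {s x : ℝ} (hs : 0 < s) (hx : 0 < x) :
    ContinuousOn (fun v => (s : ℂ) • kap a b (s * v) x) (Ioi 0) := by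
  intro v hv
  have h : ContinuousAt (fun v : ℝ => kap a b (s * v) x) v :=
    ContinuousAt.comp (f := fun v : ℝ => (s * v, x)) (continuousAt_kap hb (mul_pos hs hv) hx)
      (by fun_prop)
  exact (h.const_smul (s : ℂ)).continuousWithinAt

lemma exists_norm_smul_kap_le (hb : IsSingular b) {s A : ℝ} (hs : 0 < s) : ∃ C, 0 ≤ C ∧ ∀ x : ℝ, 0 <
    x → x ≤ A →
    ∀ v ∈ Ioo (0 : ℝ) 1, ‖(s : ℂ) • kap a b (s * v) x‖ ≤ C * v ^ (-1 / 4 : ℝ) := by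
  obtain ⟨C, h0, hC⟩ := exists_norm_kap_le (a := a) hb (max s A)
  refine ⟨s * (C * s ^ (-1 / 4 : ℝ)), by positivity, fun x hx hxA v hv => ?_⟩
  rw [norm_smul, Complex.norm_real, Real.norm_of_nonneg hs.le, mul_assoc, mul_assoc,
    ← Real.mul_rpow hs.le hv.1.le]
  exact mul_le_mul_of_nonneg_left (hC _ (mul_pos hs hv.1)
    ((mul_le_of_le_one_right hs.le hv.2.le).trans (le_max_left _ _)) x hx.le
    (hxA.trans (le_max_right _ _))) hs.le

/-- Cauchy–Schwarz, since v^{-1/4} is square integrable on (0,1). The generality of `h` in L² is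
needed for uniqueness among square integrable solutions. -/
lemma integrableOn_mul_smul_kap (hb : IsSingular b) {s x : ℝ} (hs : 0 < s) (hx : 0 < x) {h : ℝ → ℂ}
    (hh : MemLp h 2 (volume.restrict (Ioo 0 1))) :
    IntegrableOn (fun v => h v • (s : ℂ) • kap a b (s * v) x) (Ioo 0 1) := by
  obtain ⟨C, h0, hC⟩ := exists_norm_smul_kap_le (a := a) hb (A := x) hs
  have hm : AEStronglyMeasurable (fun v : ℝ => (s : ℂ) • kap a b (s * v) x)
      (volume.restrict (Ioo 0 1)) :=
    ((continuousOn_smul_kap hb hs hx).mono fun v hv => hv.1).aestronglyMeasurable measurableSet_Ioo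
  have hw : MemLp (fun v : ℝ => v ^ (-1 / 4 : ℝ)) 2 (volume.restrict (Ioo 0 1)) := by
    rw [memLp_two_iff_integrable_sq integrableOn_rpow_quarter.aestronglyMeasurable]
    refine ((intervalIntegrable_iff_integrableOn_Ioo_of_le zero_le_one).1
      (intervalIntegral.intervalIntegrable_rpow' (r := -1 / 2) (by norm_num))).congr ?_
    refine (ae_restrict_mem measurableSet_Ioo).mono fun v hv => ?_
    beta_reduce
    rw [← Real.rpow_natCast, ← Real.rpow_mul hv.1.le]
    norm_num
  refine Integrable.mono' ((hh.norm.integrable_mul hw).const_mul C) (hh.1.smul hm) ?_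
  refine (ae_restrict_mem measurableSet_Ioo).mono fun v hv => ?_
  rw [norm_smul]
  refine (mul_le_mul_of_nonneg_left (hC x hx le_rfl v hv) (norm_nonneg _)).trans (le_of_eq ?_)
  simp only [Pi.mul_apply]
  ring

lemma memLp_ext (e : E) : MemLp (ext e) 2 (volume.restrict (Ioo 0 1)) :=
  MemLp.of_bound (continuous_ext e).aestronglyMeasurable ‖e‖ (ae_of_all _ fun v => norm_ext_le e v)

lemma clm_opK_apply (hb : IsSingular b) {W : Type*} [NormedAddCommGroup W] [NormedSpace ℂ W]
    [CompleteSpace W]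
    {s : ℝ} (hs : 0 < s) (e : E) (L : E →L[ℂ] W) :
    L (opK a b s e) = ∫ v in Ioo (0 : ℝ) 1, ext e v • L ((s : ℂ) • kap a b (s * v) s) := by
  rw [opK_apply hb hs, ← L.integral_comp_comm (integrableOn_mul_smul_kap hb hs hs (memLp_ext e))]
  simp only [map_smul]

end Operator

end

section

/-! ### Fredholm's inversion formula on `C([0,1])` -/

/-- The Lebesgue measure on `(0,1)`. -/
abbrev unitMeasure : Measure ℝ := volume.restrict (Ioo 0 1)

/-- The weight `v^{-1/4}` on `(0,1)`. -/
def weight : ℝ → ℝ := (Ioo (0 : ℝ) 1).indicator fun v => v ^ (-1 / 4 : ℝ)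

/-- The kernel of the operator `opK a b s`. -/
def kern (a : C(ℝ, ℂ)) (b : ℝ → ℂ) (s u : ℝ) : ℝ → ℂ :=
  (Ioo (0 : ℝ) 1).indicator fun v => ext ((s : ℂ) • kap a b (s * v) s) u

/-- The function `b(s v)` on `(0,1)`. -/
def cutDil (b : ℝ → ℂ) (s : ℝ) : ℝ → ℂ := (Ioo (0 : ℝ) 1).indicator fun v => b (s * v)

lemma weight_nonneg (v : ℝ) : 0 ≤ weight v :=
  indicator_nonneg (fun _ hv => Real.rpow_nonneg hv.1.le _) v

lemma integrable_weight : Integrable weight unitMeasure :=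
  (integrableOn_rpow_quarter.integrable_indicator measurableSet_Ioo).restrict

lemma hasDerivAt_clm_comp {V W : Type*} [NormedAddCommGroup V] [NormedSpace ℂ V]
    [NormedAddCommGroup W] [NormedSpace ℂ W] (L : V →L[ℂ] W) {h : ℝ → V} {h' : V} {s : ℝ}
    (hh : HasDerivAt h h' s) : HasDerivAt (fun s => L (h s)) (L h') s :=
  (L.restrictScalars ℝ).hasFDerivAt.comp_hasDerivAt s hh

lemma measurable_indicator_of_continuousOn {X : Type*} [TopologicalSpace X] [MeasurableSpace X]
    [BorelSpace X] {h : X → ℂ} {S : Set X} (hS : MeasurableSet S) (hh : ContinuousOn h S) :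
    Measurable (S.indicator h) := by
  classical
  rw [← piecewise_eq_indicator]
  exact hh.measurable_piecewise continuousOn_const hS

section Operator

variable {a : C(ℝ, ℂ)} {b : ℝ → ℂ}

lemma measurable_cutDil (hb : IsSingular b) {s : ℝ} (hs : 0 < s) : Measurable (cutDil b s) :=
  measurable_indicator_of_continuousOn measurableSet_Ioo
    (hb.cont.comp (by fun_prop) fun _ hv => mul_pos hs hv.1)

lemma measurable_kern (hb : IsSingular b) {s : ℝ} (hs : 0 < s) : Measurable
    (Function.uncurry (kern a b s)) := by
  have h : Function.uncurry (kern a b s) = (univ ×ˢ Ioo (0 : ℝ) 1).indicator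
      fun p : ℝ × ℝ => ext ((s : ℂ) • kap a b (s * p.2) s) p.1 := by
    ext p
    by_cases hp : p.2 ∈ Ioo (0 : ℝ) 1
    · rw [indicator_of_mem (by exact ⟨mem_univ _, hp⟩), Function.uncurry, kern, indicator_of_mem hp]
    · rw [indicator_of_notMem (fun h => hp h.2), Function.uncurry, kern, indicator_of_notMem hp]
  rw [h]
  refine measurable_indicator_of_continuousOn (MeasurableSet.univ.prod measurableSet_Ioo) ?_
  have h1 : ContinuousOn (fun p : ℝ × ℝ => (s : ℂ) • kap a b (s * p.2) s) (univ ×ˢ Ioo (0 : ℝ) 1) :=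
    (continuousOn_smul_kap hb hs hs).comp continuous_snd.continuousOn fun p hp => hp.2.1
  have h2 : ContinuousOn (fun p : ℝ × ℝ => projIcc (0 : ℝ) 1 zero_le_one p.1)
      (univ ×ˢ Ioo (0 : ℝ) 1) := (continuous_projIcc.comp continuous_fst).continuousOn
  exact (ContinuousEval.continuous_eval (F := E)).comp_continuousOn (h1.prodMk h2)

/-- The power s^{3/4} arises from s · (sv)^{-1/4}. It makes every term of the Fredholm series but
the first tend to 0 with s. -/
lemma exists_isFredholmKernel (hb : IsSingular b) (A : ℝ) : ∃ C, 0 ≤ C ∧ ∀ s, 0 < s → s ≤ A →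
    IsFredholmKernel unitMeasure (kern a b s) (C * s ^ (3 / 4 : ℝ)) weight := by
  obtain ⟨C, h0, hC⟩ := exists_norm_kap_le (a := a) hb A
  refine ⟨C, h0, fun s hs hsA => ⟨measurable_kern hb hs, by positivity, weight_nonneg,
    integrable_weight, fun u v => ?_⟩⟩
  by_cases hv : v ∈ Ioo (0 : ℝ) 1
  · rw [kern, weight, indicator_of_mem hv, indicator_of_mem hv]
    refine (norm_ext_le _ _).trans ?_
    rw [norm_smul, Complex.norm_real, Real.norm_of_nonneg hs.le]
    have h1 := hC (s * v) (mul_pos hs hv.1) ((mul_le_of_le_one_right hs.le hv.2.le).trans hsA)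
      s hs.le hsA
    refine (mul_le_mul_of_nonneg_left h1 hs.le).trans (le_of_eq ?_)
    rw [Real.mul_rpow hs.le hv.1.le, show (3 / 4 : ℝ) = 1 + -1 / 4 by norm_num, Real.rpow_add hs,
      Real.rpow_one]
    ring
  · rw [kern, indicator_of_notMem hv, weight, indicator_of_notMem hv, norm_zero, mul_zero]

lemma exists_norm_cutDil_le (hb : IsSingular b) {s : ℝ} (hs : 0 < s) : ∃ C, 0 ≤ C ∧ ∀ r ∈ Ioo
    (s / 2) (2 * s), ∀ v,
    ‖cutDil b r v‖ ≤ C * weight v := by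
  obtain ⟨C, h0, hC⟩ := hb.exists_bound_near hs
  refine ⟨C, h0, fun r hr v => ?_⟩
  by_cases hv : v ∈ Ioo (0 : ℝ) 1
  · rw [cutDil, weight, indicator_of_mem hv, indicator_of_mem hv]
    exact hC r hr v hv
  · rw [cutDil, weight, indicator_of_notMem hv, indicator_of_notMem hv, norm_zero, mul_zero]

lemma exists_isFredholmFamily (hb : IsSingular b) {s : ℝ} (hs : 0 < s) : ∃ C c₁ c₂,
    IsFredholmFamily unitMeasure (kern a b) (fun s => ext (dil a s)) (cutDil b) C c₁ c₂ weight
      (Ioo (s / 2) (2 * s)) := by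
  obtain ⟨C, h0, hC⟩ := exists_isFredholmKernel (a := a) hb (2 * s)
  obtain ⟨c₁, h1, hc₁⟩ := exists_norm_dil_le a (2 * s)
  obtain ⟨c₂, h2, hc₂⟩ := exists_norm_cutDil_le hb hs
  have hpos : ∀ r ∈ Ioo (s / 2) (2 * s), 0 < r := fun r hr => lt_trans (by linarith) hr.1
  refine ⟨C * (2 * s) ^ (3 / 4 : ℝ), c₁, c₂, fun r hr => ?_,
    fun r hr => (continuous_ext _).measurable, fun r hr => measurable_cutDil hb (hpos r hr),
    fun r hr u => (norm_ext_le _ _).trans (hc₁ r (hpos r hr).le hr.2.le), hc₂, h2, fun r hr u v =>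
      ?_⟩
  · have h := hC r (hpos r hr) hr.2.le
    refine ⟨h.meas, by positivity, h.w_nonneg, h.w_int, fun u v => (h.bound u v).trans ?_⟩
    have h3 : r ^ (3 / 4 : ℝ) ≤ (2 * s) ^ (3 / 4 : ℝ) :=
      Real.rpow_le_rpow (hpos r hr).le hr.2.le (by norm_num)
    have := weight_nonneg v
    gcongr
  · by_cases hv : v ∈ Ioo (0 : ℝ) 1
    · simp only [kern, cutDil, indicator_of_mem hv]
      have h := hasDerivAt_clm_comp (evalE (projIcc 0 1 zero_le_one u))
        (hasDerivAt_smul_kap (a := a) hb (hpos r hr) hv.1)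
      refine h.congr_deriv ?_
      rw [map_smul, smul_eq_mul, mul_comm]
      rfl
    · simp only [kern, cutDil, indicator_of_notMem hv, mul_zero]
      exact hasDerivAt_const _ _

lemma ext_opK (hb : IsSingular b) {s : ℝ} (hs : 0 < s) (e : E) (u : ℝ) :
    ext (opK a b s e) u = ∫ v, kern a b s u v * ext e v ∂unitMeasure := by
  have h := clm_opK_apply (a := a) hb hs e (evalE (projIcc 0 1 zero_le_one u))
  refine h.trans (setIntegral_congr_fun measurableSet_Ioo fun v hv => ?_)
  simp only [kern, indicator_of_mem hv, smul_eq_mul]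
  rw [mul_comm]
  rfl

end Operator

/-- The operators whose kernels are the Fredholm minors. -/
def minorOp (d : ℕ → ℂ) (k : E →L[ℂ] E) : ℕ → E →L[ℂ] E
  | 0 => k
  | n + 1 => d (n + 1) • k - ((n : ℂ) + 1) • (k * minorOp d k n)

lemma commute_minorOp (d : ℕ → ℂ) (k : E →L[ℂ] E) (n : ℕ) : Commute k (minorOp d k n) := by
  induction n with
  | zero => exact Commute.refl k
  | succ n ih =>
    exact ((Commute.refl k).smul_right _).sub_right (((Commute.refl k).mul_right ih).smul_right _)

section Minor

variable {k : ℝ → ℝ → ℂ} {C : ℝ} {T : E →L[ℂ] E}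

lemma integrable_mul_ext {r : ℝ → ℂ} {c : ℝ} (hrm : Measurable r) (hr : ∀ y, ‖r y‖ ≤ c * weight y)
    (e : E) : Integrable (fun v => r v * ext e v) unitMeasure := by
  refine Integrable.mul_bdd (c := ‖e‖) ?_ (continuous_ext e).aestronglyMeasurable
    (ae_of_all _ fun v => norm_ext_le e v)
  exact (integrable_weight.const_mul c).mono' hrm.aestronglyMeasurable (ae_of_all _ hr)

lemma measurable_row (hk : IsFredholmKernel unitMeasure k C weight) (u : ℝ) : Measurable (k u) :=
    hk.meas.comp measurable_prodMk_left

/-- Fredholm's recursion integrated against `e`, with Fubini applied to the double integral. The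
bordering row `r` is arbitrary: rows of `k` give the minor operators, and the functional b(s·) gives
the derivative of the determinant. -/
lemma integral_bInt_succ (hk : IsFredholmKernel unitMeasure k C weight) {n : ℕ} {N : E →L[ℂ] E}
    (hN : ∀ (e : E) (u : ℝ),
      ext (N e) u = ∫ v, bInt unitMeasure k (k u) n v * ext e v ∂unitMeasure)
    {r : ℝ → ℂ} {c : ℝ} (hrm : Measurable r) (hr : ∀ y, ‖r y‖ ≤ c * weight y) (e : E) :
    ∫ v, bInt unitMeasure k r (n + 1) v * ext e v ∂unitMeasure =
      fInt unitMeasure k (n + 1) * (∫ v, r v * ext e v ∂unitMeasure) -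
        (n + 1) * ∫ z, r z * ext (N e) z ∂unitMeasure := by
  have hm : StronglyMeasurable fun p : ℝ × ℝ => bInt unitMeasure k (k p.1) n p.2 :=
    hk.stronglyMeasurable_bInt (r := fun p : ℝ × ℝ => k p.1)
      (hk.meas.comp ((measurable_fst.comp measurable_fst).prodMk measurable_snd)) measurable_snd n
  have hinteg : Integrable (Function.uncurry fun z v : ℝ =>
      r z * (bInt unitMeasure k (k z) n v * ext e v)) (unitMeasure.prod unitMeasure) := by
    have hdom := ((integrable_weight.mul_prod integrable_weight).const_mul
      (c * (((Real.sqrt (n + 1 : ℕ)) ^ (n + 1) * (C * C ^ n) * (∫ x, weight x ∂unitMeasure) ^ n)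
        * ‖e‖)))
    refine hdom.mono' ?_ (ae_of_all _ fun p => ?_)
    · exact ((hrm.comp measurable_fst).aestronglyMeasurable).mul
        (hm.aestronglyMeasurable.mul ((continuous_ext e).comp continuous_snd).aestronglyMeasurable)
    · rw [Function.uncurry, norm_mul, norm_mul]
      have h1 := hk.norm_bInt_le hk.nonneg (hk.bound p.1) n p.2
      have h2 := norm_ext_le e p.2
      have h3 := hr p.1
      calc _ ≤ (c * weight p.1) * (((Real.sqrt (n + 1 : ℕ)) ^ (n + 1) * (C * C ^ n) *
            (∫ x, weight x ∂unitMeasure) ^ n * weight p.2) * ‖e‖) := by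
            gcongr
            · exact (norm_nonneg _).trans h3
            · exact (norm_nonneg _).trans h1
        _ = _ := by ring
  have hswap := integral_integral_swap hinteg
  have h1 : ∀ z, ∫ v, r z * (bInt unitMeasure k (k z) n v * ext e v) ∂unitMeasure =
      r z * ext (N e) z := fun z => by rw [integral_const_mul, hN]
  simp only [h1] at hswap
  rw [hswap, ← integral_const_mul, ← integral_const_mul, ← integral_sub]
  · refine integral_congr_ae (ae_of_all _ fun v => ?_)
    beta_reduce
    rw [hk.bInt_succ hrm hr, sub_mul, mul_assoc (_ + _ : ℂ), ← integral_mul_const]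
    simp only [mul_assoc]
    ring
  · exact (integrable_mul_ext hrm hr e).const_mul _
  · exact hinteg.integral_prod_right.const_mul _

lemma ext_minorOp (hk : IsFredholmKernel unitMeasure k C weight)
    (hT : ∀ (e : E) (u : ℝ), ext (T e) u = ∫ v, k u v * ext e v ∂unitMeasure) (n : ℕ) (e : E)
      (u : ℝ) :
    ext (minorOp (fInt unitMeasure k) T n e) u =
      ∫ v, bInt unitMeasure k (k u) n v * ext e v ∂unitMeasure := by
  induction n generalizing e u with
  | zero =>
    simp only [bInt_zero]
    exact hT e u
  | succ n ih =>
    rw [integral_bInt_succ hk ih (measurable_row hk u) (hk.bound u), ← hT, ← hT]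
    rfl

lemma norm_minorOp_le (hk : IsFredholmKernel unitMeasure k C weight)
    (hT : ∀ (e : E) (u : ℝ), ext (T e) u = ∫ v, k u v * ext e v ∂unitMeasure) (n : ℕ) : ‖minorOp
      (fInt unitMeasure k) T n‖ ≤
    (Real.sqrt (n + 1 : ℕ)) ^ (n + 1) * (C * C ^ n) * (∫ x, weight x ∂unitMeasure) ^ n *
      ∫ x, weight x ∂unitMeasure := by
  have hW := hk.integral_nonneg
  have hC := hk.nonneg
  refine ContinuousLinearMap.opNorm_le_bound _ (by positivity) fun e => ?_
  refine (BoundedContinuousFunction.norm_le (by positivity)).2 fun u => ?_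
  have h : minorOp (fInt unitMeasure k) T n e u = ext (minorOp (fInt unitMeasure k) T n e) u := by
    rw [ext, projIcc_val]
  rw [h, ext_minorOp hk hT, mul_assoc, mul_comm (∫ x, weight x ∂unitMeasure), ← mul_assoc,
    ← integral_const_mul]
  refine norm_integral_le_of_norm_le (integrable_weight.const_mul _) (ae_of_all _ fun v => ?_)
  rw [norm_mul]
  have h1 := hk.norm_bInt_le hk.nonneg (hk.bound u) n v
  refine (mul_le_mul h1 (norm_ext_le e v) (norm_nonneg _) ((norm_nonneg _).trans h1)).trans
    (le_of_eq (by ring))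

lemma summable_minorOp (hk : IsFredholmKernel unitMeasure k C weight)
    (hT : ∀ (e : E) (u : ℝ), ext (T e) u = ∫ v, k u v * ext e v ∂unitMeasure) : Summable fun n : ℕ
      =>
    ((-1) ^ n / (n ! : ℂ)) • minorOp (fInt unitMeasure k) T n := by
  have hW := hk.integral_nonneg
  refine Summable.of_norm_bounded ((summable_hadamard_succ C C _ hk.nonneg hk.nonneg hW).mul_right
    (∫ x, weight x ∂unitMeasure)) fun n => ?_
  rw [norm_smul, norm_neg_one_pow_div, one_div_mul_eq_div, div_mul_eq_mul_div]
  gcongr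
  exact norm_minorOp_le hk hT n

/-- Fredholm's identity. -/
lemma one_sub_mul_minor (hk : IsFredholmKernel unitMeasure k C weight)
    (hT : ∀ (e : E) (u : ℝ), ext (T e) u = ∫ v, k u v * ext e v ∂unitMeasure) :
    (1 - T) * ((∑' n, fTerm unitMeasure k n) • 1 +
      ∑' n : ℕ, ((-1) ^ n / (n ! : ℂ)) • minorOp (fInt unitMeasure k) T n) =
      (∑' n, fTerm unitMeasure k n) • 1 := by
  have hs := summable_minorOp hk hT
  have hd := hk.summable_fTerm
  set N := ∑' n : ℕ, ((-1) ^ n / (n ! : ℂ)) • minorOp (fInt unitMeasure k) T n with hN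
  set D := ∑' n, fTerm unitMeasure k n with hD
  -- By the recursion of `minorOp`, T times the n-th term of N is the (n+1)-st term of N minus the
  -- (n+1)-st term of D times T. Summing omits the terms of index 0, which are T in both sums and
  -- cancel.
  have h1 : T * N = N - D • T := by
    have e0 : ∀ n : ℕ, T * (((-1) ^ n / (n ! : ℂ)) • minorOp (fInt unitMeasure k) T n) =
        ((-1) ^ (n + 1) / ((n + 1)! : ℂ)) • minorOp (fInt unitMeasure k) T (n + 1) -
          fTerm unitMeasure k (n + 1) • T := by
      intro n
      have hf : (((n + 1)! : ℕ) : ℂ) = ((n : ℂ) + 1) * (n ! : ℂ) := by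
        rw [Nat.factorial_succ]
        push_cast
        rfl
      have hn : (n ! : ℂ) ≠ 0 := by exact_mod_cast n.factorial_ne_zero
      have hn1 : (n : ℂ) + 1 ≠ 0 := by exact_mod_cast n.succ_ne_zero
      rw [minorOp, fTerm, smul_sub, smul_smul, smul_smul, sub_right_comm, sub_self, zero_sub,
        mul_smul_comm, ← neg_smul]
      congr 1
      rw [hf]
      field_simp
      ring
    have e1 := hs.tsum_mul_left T
    have hs' : Summable fun n : ℕ => ((-1) ^ (n + 1) / ((n + 1)! : ℂ)) •
        minorOp (fInt unitMeasure k) T (n + 1) := (summable_nat_add_iff 1).2 hs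
    have hd' : Summable fun n : ℕ => fTerm unitMeasure k (n + 1) • T :=
      ((summable_nat_add_iff 1).2 hd).smul_const T
    rw [hN, ← e1, tsum_congr e0, hs'.tsum_sub hd', hs.tsum_eq_zero_add, hD, hd.tsum_eq_zero_add,
      ((summable_nat_add_iff 1).2 hd).tsum_smul_const]
    have e2 : fTerm unitMeasure k 0 = 1 := by simp [fTerm, fInt_zero]
    rw [e2, add_smul, one_smul]
    simp only [pow_zero, Nat.factorial_zero, Nat.cast_one, div_one, one_smul, minorOp]
    abel
  rw [sub_mul, one_mul, mul_add, h1, mul_smul_comm, mul_one]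
  abel

lemma commute_tsum_minorOp (hk : IsFredholmKernel unitMeasure k C weight)
    (hT : ∀ (e : E) (u : ℝ), ext (T e) u = ∫ v, k u v * ext e v ∂unitMeasure) :
    Commute T (∑' n : ℕ, ((-1) ^ n / (n ! : ℂ)) • minorOp (fInt unitMeasure k) T n) := by
  have hs := summable_minorOp hk hT
  rw [Commute, SemiconjBy, ← hs.tsum_mul_left, ← hs.tsum_mul_right]
  refine tsum_congr fun n => ?_
  exact ((commute_minorOp _ T n).smul_right _).eq

/-- Fredholm's identity yields a right inverse. The minors are polynomials in T, so it commutes with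
T and is two-sided; no compactness argument is needed. -/
lemma isUnit_one_sub (hk : IsFredholmKernel unitMeasure k C weight)
    (hT : ∀ (e : E) (u : ℝ), ext (T e) u = ∫ v, k u v * ext e v ∂unitMeasure)
      (h0 : (∑' n, fTerm unitMeasure k n) ≠ 0) : IsUnit (1 - T) := by
  have h1 := one_sub_mul_minor hk hT
  have hcomm : Commute (1 - T) ((∑' n, fTerm unitMeasure k n) • 1 +
      ∑' n : ℕ, ((-1) ^ n / (n ! : ℂ)) • minorOp (fInt unitMeasure k) T n) := by
    refine (Commute.one_left _).sub_left (Commute.add_right ?_ (commute_tsum_minorOp hk hT))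
    exact (Commute.one_right T).smul_right _
  refine ⟨⟨1 - T, (∑' n, fTerm unitMeasure k n)⁻¹ • ((∑' n, fTerm unitMeasure k n) • 1 +
      ∑' n : ℕ, ((-1) ^ n / (n ! : ℂ)) • minorOp (fInt unitMeasure k) T n), ?_, ?_⟩, rfl⟩
  · rw [mul_smul_comm, h1, smul_smul, inv_mul_cancel₀ h0, one_smul]
  · rw [smul_mul_assoc, ← hcomm.eq, h1, smul_smul, inv_mul_cancel₀ h0, one_smul]

/-- The logarithmic derivative of the Fredholm determinant. -/
lemma tsum_integral_bInt (hk : IsFredholmKernel unitMeasure k C weight)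
    (hT : ∀ (e : E) (u : ℝ), ext (T e) u = ∫ v, k u v * ext e v ∂unitMeasure) {r : ℝ → ℂ} {c : ℝ}
      (hrm : Measurable r)
    (hr : ∀ y, ‖r y‖ ≤ c * weight y) {L : E →L[ℂ] ℂ}
    (hL : ∀ e : E, L e = ∫ v, r v * ext e v ∂unitMeasure) (e : E) :
    ∑' n : ℕ, (-1) ^ n / (n ! : ℂ) * ∫ v, ext e v * bInt unitMeasure k r n v ∂unitMeasure =
      L (((∑' n, fTerm unitMeasure k n) • (1 : E →L[ℂ] E) +
      ∑' n : ℕ, ((-1) ^ n / (n ! : ℂ)) • minorOp (fInt unitMeasure k) T n) e) := by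
  have hs := summable_minorOp hk hT
  have hd := hk.summable_fTerm
  have hLs : Summable fun n : ℕ =>
      L ((((-1) ^ n / (n ! : ℂ)) • minorOp (fInt unitMeasure k) T n) e) :=
        (hs.mapL (ContinuousLinearMap.apply ℂ E e)).mapL L
  have e0 : ∀ n : ℕ, (-1) ^ (n + 1) / ((n + 1)! : ℂ) *
      ∫ v, ext e v * bInt unitMeasure k r (n + 1) v ∂unitMeasure =
      fTerm unitMeasure k (n + 1) * L e +
        L ((((-1) ^ n / (n ! : ℂ)) • minorOp (fInt unitMeasure k) T n) e) := by
    intro n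
    have hf : (((n + 1)! : ℕ) : ℂ) = ((n : ℂ) + 1) * (n ! : ℂ) := by
      rw [Nat.factorial_succ]
      push_cast
      rfl
    have hn : (n ! : ℂ) ≠ 0 := by exact_mod_cast n.factorial_ne_zero
    have hn1 : (n : ℂ) + 1 ≠ 0 := by exact_mod_cast n.succ_ne_zero
    simp only [mul_comm (ext e _)]
    rw [integral_bInt_succ hk (ext_minorOp hk hT n) hrm hr, ← hL, ← hL, smul_apply, map_smul, fTerm,
      smul_eq_mul, hf]
    field_simp
    ring
  have hs1 : Summable fun n => fTerm unitMeasure k (n + 1) * L e :=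
    ((summable_nat_add_iff 1).2 hd).mul_right _
  have hsum : Summable fun n : ℕ => (-1) ^ n / (n ! : ℂ) *
      ∫ v, ext e v * bInt unitMeasure k r n v ∂unitMeasure := by
    rw [← summable_nat_add_iff 1]
    simp only [e0]
    exact hs1.add hLs
  rw [hsum.tsum_eq_zero_add, tsum_congr e0, hs1.tsum_add hLs, tsum_mul_right, add_apply, map_add,
    smul_apply, map_smul, hd.tsum_eq_zero_add]
  have e2 : fTerm unitMeasure k 0 = 1 := by simp [fTerm, fInt_zero]
  have e3 : L ((∑' n : ℕ, ((-1) ^ n / (n ! : ℂ)) • minorOp (fInt unitMeasure k) T n) e) =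
      ∑' n : ℕ, L ((((-1) ^ n / (n ! : ℂ)) • minorOp (fInt unitMeasure k) T n) e) := by
    exact (ContinuousLinearMap.map_tsum (L.comp (ContinuousLinearMap.apply ℂ E e)) hs)
  rw [e2, e3, hL e]
  simp only [bInt_zero, pow_zero, Nat.factorial_zero, Nat.cast_one, div_one, one_mul, smul_eq_mul,
    mul_comm (ext e _), one_apply_eq_self, hL e]
  ring

end Minor

/-- The Fredholm determinant of the operator `opK a b s`. -/
def detK (a : C(ℝ, ℂ)) (b : ℝ → ℂ) (s : ℝ) : ℂ := ∑' n, fTerm unitMeasure (kern a b s) n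

/-- The resolvent `(1 - opK a b s)⁻¹`. -/
def res (a : C(ℝ, ℂ)) (b : ℝ → ℂ) (s : ℝ) : E →L[ℂ] E := Ring.inverse (1 - opK a b s)

section Determinant

variable {a : C(ℝ, ℂ)} {b : ℝ → ℂ}

lemma isUnit_one_sub_opK (hb : IsSingular b) {s : ℝ} (hs : 0 < s) (h0 : detK a b s ≠ 0) : IsUnit
    (1 - opK a b s) := by
  obtain ⟨C, -, hC⟩ := exists_isFredholmKernel (a := a) hb s
  exact isUnit_one_sub (hC s hs le_rfl) (ext_opK hb hs) h0

lemma hasDerivAt_detK (hb : IsSingular b) {s : ℝ} (hs : 0 < s) (h0 : detK a b s ≠ 0) :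
    HasDerivAt (detK a b) (-(detK a b s * dual (fun v => b (s * v)) (res a b s (dil a s)))) s := by
  obtain ⟨C, c₁, c₂, hfam⟩ := exists_isFredholmFamily (a := a) hb hs
  have hmem : s ∈ Ioo (s / 2) (2 * s) := ⟨by linarith, by linarith⟩
  have hk := hfam.kernel s hmem
  refine (hfam.hasDerivAt_tsum isOpen_Ioo isPreconnected_Ioo hmem).congr_deriv ?_
  rw [tsum_integral_bInt hk (ext_opK hb hs) (hfam.meas_b s hmem) (hfam.bound_b s hmem)
    (L := dual fun v => b (s * v))]
  · have h1 := one_sub_mul_minor hk (ext_opK hb hs)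
    -- Multiplying Fredholm's identity on the left by the resolvent R gives D + N = D · R.
    have h2 := congrArg (fun T => res a b s * T) h1
    simp only [res, ← mul_assoc, Ring.inverse_mul_cancel _ (isUnit_one_sub_opK hb hs h0), one_mul,
      mul_smul_comm, mul_one] at h2
    rw [h2, smul_apply, map_smul]
    rfl
  · intro e
    rw [dual_apply (hb.integrableOn_dil hs)]
    refine setIntegral_congr_fun measurableSet_Ioo fun v hv => ?_
    simp only [cutDil, indicator_of_mem hv]

lemma tendsto_detK (hb : IsSingular b) : Tendsto (detK a b) (𝓝[>] 0) (𝓝 1) := by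
  obtain ⟨C, h0, hC⟩ := exists_isFredholmKernel (a := a) hb 1
  have hW : 0 ≤ ∫ x, weight x ∂unitMeasure := MeasureTheory.integral_nonneg weight_nonneg
  set W := ∫ x, weight x ∂unitMeasure with hWdef
  have h1 : (1 : ℂ) = ∑' n : ℕ, if n = 0 then 1 else 0 := by rw [tsum_ite_eq]
  rw [h1]
  have hnear : ∀ᶠ s : ℝ in 𝓝[>] 0, s ∈ Ioo (0 : ℝ) 1 := Ioo_mem_nhdsGT one_pos
  refine tendsto_tsum_of_dominated_convergence
    (bound := fun n => (Real.sqrt n) ^ n * (C * W) ^ n / (n ! : ℝ))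
    (summable_hadamard _ (mul_nonneg h0 hW)) (fun n => ?_) ?_
  · rcases Nat.eq_zero_or_pos n with rfl | hn
    · simp [fTerm, fInt_zero]
    · rw [if_neg hn.ne']
      have hlim : Tendsto
        (fun s : ℝ => (Real.sqrt n) ^ n * ((C * s ^ (3 / 4 : ℝ)) * W) ^ n / (n ! : ℝ))
          (𝓝[>] 0) (𝓝 ((Real.sqrt n) ^ n * (0 * W) ^ n / (n ! : ℝ))) :=
        ((((tendsto_mul_rpow_zero C (by norm_num)).mul_const W).pow n).const_mul _).div_const _
      rw [zero_mul, zero_pow hn.ne', mul_zero, zero_div] at hlim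
      refine squeeze_zero_norm' ?_ hlim
      filter_upwards [hnear] with s hs
      exact (hC s hs.1 hs.2.le).norm_fTerm_le n
  · filter_upwards [hnear] with s hs n
    refine ((hC s hs.1 hs.2.le).norm_fTerm_le n).trans ?_
    have h2 : s ^ (3 / 4 : ℝ) ≤ 1 := Real.rpow_le_one hs.1.le hs.2.le (by norm_num)
    have h3 : C * s ^ (3 / 4 : ℝ) ≤ C := mul_le_of_le_one_right h0 h2
    have h4 := Real.rpow_nonneg hs.1.le (3 / 4)
    gcongr

lemma hasDerivAt_res (hb : IsSingular b) {s : ℝ} (hs : 0 < s) (h0 : detK a b s ≠ 0) :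
    HasDerivAt (res a b) (res a b s * rankOne a b s * res a b s) s := by
  obtain ⟨x, hx⟩ := isUnit_one_sub_opK hb hs h0
  have h1 : HasDerivAt (fun s => 1 - opK a b s) (-rankOne a b s) s := (hasDerivAt_opK hb hs).const_sub 1
  have h2 := hasFDerivAt_ringInverse (𝕜 := ℝ) x
  rw [hx] at h2
  refine (h2.comp_hasDerivAt s h1).congr_deriv ?_
  have h3 : res a b s = ↑x⁻¹ := by rw [res, ← hx, Ring.inverse_unit]
  simp [h3]

lemma tendsto_res (hb : IsSingular b) : Tendsto (res a b) (𝓝[>] 0) (𝓝 1) := by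
  have h1 : Tendsto (fun s => 1 - opK a b s) (𝓝[>] 0) (𝓝 (1 - 0)) :=
    tendsto_const_nhds.sub (tendsto_opK_zero hb)
  rw [sub_zero] at h1
  have h2 := (NormedRing.inverse_continuousAt (1 : (E →L[ℂ] E)ˣ)).tendsto
  rw [Units.val_one, Ring.inverse_one] at h2
  exact h2.comp h1

end Determinant

end

section

/-! ### The solutions of the integral equations on the half line -/

/-- The kernel `∫_0^1 a(t x) b(t y) dt`. -/
def kfun (a : C(ℝ, ℂ)) (b : ℝ → ℂ) (x y : ℝ) : ℂ := kap a b y x 1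

/-- The functional `e ↦ ∫_0^1 h(s v) e(v) dv`. -/
def dualDil (h : ℝ → ℂ) (s : ℝ) : E →L[ℂ] ℂ := dual fun v => h (s * v)

/-- The solution of `u(x) - ∫_0^s k(x,y) u(y) dy = p(x)`. -/
def solQ (a : C(ℝ, ℂ)) (b : ℝ → ℂ) (p : C(ℝ, ℂ)) (s x : ℝ) : ℂ :=
  p x + ∫ v in Ioo (0 : ℝ) 1, ext (res a b s (dil p s)) v * (s * kfun a b x (s * v))

/-- The solution of `u(x) - ∫_0^s k(y,x) u(y) dy = h(x)`. -/
def solP (a : C(ℝ, ℂ)) (b h : ℝ → ℂ) (s x : ℝ) : ℂ :=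
  h x + s * dualDil h s (res a b s (kap a b x s))

lemma setIntegral_Ioo_comp_mul {W : Type*} [NormedAddCommGroup W] [NormedSpace ℝ W] (h : ℝ → W)
    {s : ℝ} (hs : 0 < s) : s • ∫ v in Ioo (0 : ℝ) 1, h (s * v) = ∫ y in Ioo 0 s, h y := by
  have := intervalIntegral.smul_integral_comp_mul_left h s (a := 0) (b := 1)
  rwa [mul_zero, mul_one, intervalIntegral.integral_of_le zero_le_one,
    intervalIntegral.integral_of_le hs.le, integral_Ioc_eq_integral_Ioo,
    integral_Ioc_eq_integral_Ioo] at this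

lemma memLp_comp_mul {h : ℝ → ℂ} {s : ℝ} (hs : 0 < s)
    (hh : MemLp h 2 (volume.restrict (Ioo 0 s))) :
    MemLp (fun v => h (s * v)) 2 unitMeasure := by
  have hemb : MeasurableEmbedding (fun v : ℝ => s * v) :=
    (Homeomorph.mulLeft₀ s hs.ne').measurableEmbedding
  have hpre : (fun v : ℝ => s * v) ⁻¹' (Ioo 0 s) = Ioo 0 1 := by
    ext v
    simp only [mem_preimage, mem_Ioo, mul_pos_iff_of_pos_left hs, mul_lt_iff_lt_one_right hs]
  have h1 := hemb.restrict_map (μ := volume) (Ioo 0 s)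
  rw [hpre, Real.map_volume_mul_left hs.ne', Measure.restrict_smul] at h1
  have h2 : MemLp h 2 (Measure.map (fun v : ℝ => s * v) unitMeasure) := by
    rw [← h1]
    exact hh.smul_measure ENNReal.ofReal_ne_top
  exact (hemb.memLp_map_measure_iff).1 h2

section Kernel

variable {a : C(ℝ, ℂ)} {b : ℝ → ℂ}

lemma kfun_eq (hb : IsSingular b) {x y : ℝ} (hx : 0 ≤ x) (hy : 0 < y) :
    kfun a b x y = ∫ t in (0 : ℝ)..1, a (t * x) * b (t * y) := by
  rw [kfun, kap_apply hb hy hx]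
  simp

lemma kap_apply_eq_kfun (hb : IsSingular b) {y s : ℝ} (hy : 0 < y) (hs : 0 ≤ s) (u : unitInterval) :
    kap a b y s u = kfun a b (s * u) y := by
  rw [kfun_eq hb (mul_nonneg hs u.2.1) hy, kap_apply hb hy hs]

lemma ext_kap (hb : IsSingular b) {y s v : ℝ} (hy : 0 < y) (hs : 0 ≤ s) (hv : v ∈ Ioo (0 : ℝ) 1) :
    ext (kap a b y s) v = kfun a b (s * v) y := by
  rw [ext_of_mem _ (Ioo_subset_Icc_self hv), kap_apply_eq_kfun hb hy hs]

lemma continuousAt_kfun (hb : IsSingular b) {x y : ℝ} (hx : 0 < x) (hy : 0 < y) :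
    ContinuousAt (fun p : ℝ × ℝ => kfun a b p.1 p.2) (x, y) := by
  have h : ContinuousAt (fun p : ℝ × ℝ => kap a b p.2 p.1) (x, y) :=
    ContinuousAt.comp (f := fun p : ℝ × ℝ => (p.2, p.1)) (x := (x, y)) (continuousAt_kap hb hy hx)
      (by fun_prop)
  exact (evalE 1).continuous.continuousAt.comp h

lemma exists_norm_kfun_le (hb : IsSingular b) (A : ℝ) : ∃ C, 0 ≤ C ∧ ∀ x : ℝ, 0 < x → x ≤ A → ∀ y :
    ℝ, 0 < y →
    y ≤ A → ‖kfun a b x y‖ ≤ C * y ^ (-1 / 4 : ℝ) := by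
  obtain ⟨C, h0, hC⟩ := exists_norm_kap_le (a := a) hb A
  exact ⟨C, h0, fun x hx hxA y hy hyA =>
    (BoundedContinuousFunction.norm_coe_le_norm _ _).trans (hC y hy hyA x hx.le hxA)⟩

lemma integrableOn_mul_kfun (hb : IsSingular b) {s x : ℝ} (hs : 0 < s) (hx : 0 < x) {h : ℝ → ℂ}
    (hh : MemLp h 2 unitMeasure) :
    IntegrableOn (fun v => h v * (s * kfun a b x (s * v))) (Ioo 0 1) :=
  (evalE 1).integrable_comp (integrableOn_mul_smul_kap (a := a) hb hs hx hh)

/-- This is R = 1 + T R. On (0,s] the function `solQ` is the rescaled resolvent; beyond s it is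
continued by the integral equation itself. -/
lemma solQ_mul (hb : IsSingular b) {p : C(ℝ, ℂ)} {s : ℝ} (hs : 0 < s) (h0 : detK a b s ≠ 0) {v : ℝ}
    (hv : v ∈ Ioc (0 : ℝ) 1) : solQ a b p s (s * v) = ext (res a b s (dil p s)) v := by
  have hI : v ∈ Icc (0 : ℝ) 1 := Ioc_subset_Icc_self hv
  have h1 : res a b s (dil p s) = dil p s + opK a b s (res a b s (dil p s)) := by
    have := congrArg (fun T : E →L[ℂ] E => T (dil p s))
      (Ring.mul_inverse_cancel _ (isUnit_one_sub_opK hb hs h0))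
    simp only [mul_apply_eq_comp, sub_apply, one_apply_eq_self] at this
    exact sub_eq_iff_eq_add.1 this
  have h2 : ext (res a b s (dil p s)) v =
      ext (dil p s) v + ext (opK a b s (res a b s (dil p s))) v := by
    conv_lhs => rw [h1]
    rfl
  rw [h2, ext_opK hb hs, ext_of_mem _ hI, solQ, dil_apply]
  congr 1
  refine setIntegral_congr_fun measurableSet_Ioo fun v' hv' => ?_
  simp only [kern, indicator_of_mem hv']
  rw [mul_comm, ext_of_mem _ hI, BoundedContinuousFunction.coe_smul]
  simp only [smul_eq_mul, kap_apply_eq_kfun hb (mul_pos hs hv'.1) hs.le]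

lemma solQ_eq (hb : IsSingular b) {p : C(ℝ, ℂ)} {s : ℝ} (hs : 0 < s) (h0 : detK a b s ≠ 0) (x : ℝ) :
    solQ a b p s x - ∫ y in Ioo 0 s, kfun a b x y * solQ a b p s y = p x := by
  rw [← setIntegral_Ioo_comp_mul _ hs, solQ, add_sub_assoc, add_eq_left, sub_eq_zero,
    ← integral_smul]
  refine setIntegral_congr_fun measurableSet_Ioo fun v hv => ?_
  simp only [Complex.real_smul]
  rw [solQ_mul hb hs h0 (Ioo_subset_Ioc_self hv)]
  ring

lemma continuousOn_solQ (hb : IsSingular b) (p : C(ℝ, ℂ)) {s : ℝ} (hs : 0 < s) :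
    ContinuousOn (solQ a b p s) (Ioi 0) := by
  intro x hx
  refine ContinuousAt.continuousWithinAt (p.continuous.continuousAt.add ?_)
  have hx' : 0 < x := hx
  obtain ⟨C, hC0, hC⟩ := exists_norm_smul_kap_le (a := a) hb (A := 2 * x) hs
  refine continuousAt_of_dominated
    (bound := fun v => ‖res a b s (dil p s)‖ * (C * v ^ (-1 / 4 : ℝ))) ?_ ?_ ?_ ?_
  · filter_upwards [Ioi_mem_nhds hx'] with z hz
    exact (integrableOn_mul_kfun hb hs hz (memLp_ext _)).aestronglyMeasurable
  · filter_upwards [Ioo_mem_nhds hx' (show x < 2 * x by linarith)] with z hz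
    refine (ae_restrict_mem measurableSet_Ioo).mono fun v hv => ?_
    rw [norm_mul]
    refine mul_le_mul (norm_ext_le _ _) ?_ (norm_nonneg _) (norm_nonneg _)
    exact (BoundedContinuousFunction.norm_coe_le_norm ((s : ℂ) • kap a b (s * v) z) 1).trans
      (hC z hz.1 hz.2.le v hv)
  · exact (integrableOn_rpow_quarter.const_mul C).const_mul _
  · refine (ae_restrict_mem measurableSet_Ioo).mono fun v hv => ?_
    have : ContinuousAt (fun z => kfun a b z (s * v)) x :=
      ContinuousAt.comp (f := fun z : ℝ => (z, s * v)) (x := x)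
        (continuousAt_kfun hb hx' (mul_pos hs hv.1)) (by fun_prop)
    exact (this.const_mul _).const_mul _

lemma exists_norm_solQ_le (hb : IsSingular b) (p : C(ℝ, ℂ)) {s : ℝ} (hs : 0 < s) (A : ℝ) : ∃ C, 0 ≤
    C ∧ ∀ x, 0 < x →
    x ≤ A → ‖solQ a b p s x‖ ≤ C := by
  obtain ⟨C, hC0, hC⟩ := exists_norm_smul_kap_le (a := a) hb (A := A) hs
  obtain ⟨C', hC'⟩ := (isCompact_Icc (a := (0 : ℝ)) (b := A)).exists_bound_of_continuousOn
    p.continuous.continuousOn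
  have hW : 0 ≤ ∫ v in Ioo (0 : ℝ) 1, ‖res a b s (dil p s)‖ * (C * v ^ (-1 / 4 : ℝ)) :=
    setIntegral_nonneg measurableSet_Ioo fun v hv =>
      mul_nonneg (norm_nonneg _) (mul_nonneg hC0 (Real.rpow_nonneg hv.1.le _))
  refine ⟨max C' 0 + ∫ v in Ioo (0 : ℝ) 1, ‖res a b s (dil p s)‖ * (C * v ^ (-1 / 4 : ℝ)),
    by positivity, fun x hx hxA => ?_⟩
  refine (norm_add_le _ _).trans (add_le_add ((hC' x ⟨hx.le, hxA⟩).trans (le_max_left _ _)) ?_)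
  refine norm_integral_le_of_norm_le ((integrableOn_rpow_quarter.const_mul C).const_mul _) ?_
  refine (ae_restrict_mem measurableSet_Ioo).mono fun v hv => ?_
  rw [norm_mul]
  refine mul_le_mul (norm_ext_le _ _) ?_ (norm_nonneg _) (norm_nonneg _)
  exact (BoundedContinuousFunction.norm_coe_le_norm ((s : ℂ) • kap a b (s * v) x) 1).trans
    (hC x hx hxA v hv)

lemma isSingular_solQ (hb : IsSingular b) (p : C(ℝ, ℂ)) {s : ℝ} (hs : 0 < s) : IsSingular
    (solQ a b p s) := by
  refine ⟨continuousOn_solQ hb p hs, fun A => ?_⟩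
  obtain ⟨C, h0, hC⟩ := exists_norm_solQ_le hb p hs A
  -- For y ≤ max A 1 the product (max A 1)^{1/4} y^{-1/4} is at least 1, so a bounded function
  -- satisfies the singular bound.
  refine ⟨C * (max A 1) ^ (1 / 4 : ℝ), by positivity, fun y hy hyA => (hC y hy hyA).trans ?_⟩
  rw [mul_assoc]
  refine le_mul_of_one_le_right h0 ?_
  have h1 : (max A 1) ^ (-1 / 4 : ℝ) ≤ y ^ (-1 / 4 : ℝ) :=
    rpow_quarter_anti hy (hyA.trans (le_max_left _ _))
  have h2 : (max A 1) ^ (1 / 4 : ℝ) * (max A 1) ^ (-1 / 4 : ℝ) = 1 := by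
    rw [← Real.rpow_add (by positivity)]
    norm_num
  exact h2.symm.le.trans (mul_le_mul_of_nonneg_left h1 (by positivity))

/-- Uniqueness for the equation with kernel `k(x,y)`. -/
lemma eq_zero_of_eq_integral (hb : IsSingular b) {s : ℝ} (hs : 0 < s) (h0 : detK a b s ≠ 0)
    {u : ℝ → ℂ}
    (hu : MemLp u 2 (volume.restrict (Ioo 0 s)))
    (hux : ∀ x, 0 < x → u x = ∫ y in Ioo 0 s, kfun a b x y * u y) {x : ℝ} (hx : 0 < x) :
    u x = 0 := by
  have hu' := memLp_comp_mul hs hu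
  -- `u` is only square integrable, but the right side of its equation is continuous up to 0. This
  -- is its continuous version on [0,1], a fixed point of the operator.
  set e : E := ∫ v in Ioo (0 : ℝ) 1, u (s * v) • (s : ℂ) • kap a b (s * v) s with he
  have hux' : ∀ x, 0 < x → u x = ∫ v in Ioo (0 : ℝ) 1, u (s * v) * (s * kfun a b x (s * v)) := by
    intro x hx
    rw [hux x hx, ← setIntegral_Ioo_comp_mul _ hs, ← integral_smul]
    refine integral_congr_ae (ae_of_all _ fun v => ?_)
    simp only [Complex.real_smul]
    ring
  have h1 : ∀ v ∈ Ioo (0 : ℝ) 1, ext e v = u (s * v) := by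
    intro v hv
    rw [hux' _ (mul_pos hs hv.1), ext_of_mem _ (Ioo_subset_Icc_self hv), he]
    change evalE _ _ = _
    rw [← (evalE ⟨v, Ioo_subset_Icc_self hv⟩).integral_comp_comm (integrableOn_mul_smul_kap hb hs hs hu')]
    refine setIntegral_congr_fun measurableSet_Ioo fun v' hv' => ?_
    simp only [map_smul, evalE_apply, smul_eq_mul, kap_apply_eq_kfun hb (mul_pos hs hv'.1) hs.le]
  have h2 : opK a b s e = e := by
    rw [opK_apply hb hs]
    conv_rhs => rw [he]
    refine setIntegral_congr_fun measurableSet_Ioo fun v hv => ?_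
    simp only [h1 v hv]
  have h3 : e = 0 := by
    have := congrArg (fun T : E →L[ℂ] E => T e)
      (Ring.inverse_mul_cancel _ (isUnit_one_sub_opK hb hs h0))
    simpa only [mul_apply_eq_comp, sub_apply, one_apply_eq_self, h2, sub_self, map_zero,
      eq_comm] using this
  rw [hux' x hx]
  refine setIntegral_eq_zero_of_forall_eq_zero fun v hv => ?_
  rw [← h1 v hv, h3]
  exact zero_mul _

/-- Uniqueness for the equation with kernel `k(y,x)`. -/
lemma eq_zero_of_eq_integral_transpose (hb : IsSingular b) {s : ℝ} (hs : 0 < s)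
    (h0 : detK a b s ≠ 0) {u : ℝ → ℂ}
    (hu : MemLp u 2 (volume.restrict (Ioo 0 s)))
    (hux : ∀ x, 0 < x → u x = ∫ y in Ioo 0 s, kfun a b y x * u y) {x : ℝ} (hx : 0 < x) :
    u x = 0 := by
  have hu' : IntegrableOn (fun v => u (s * v)) (Ioo 0 1) :=
    (memLp_comp_mul hs hu).integrable one_le_two
  have hux' : ∀ x, 0 < x → u x = dualDil u s ((s : ℂ) • kap a b x s) := by
    intro x hx
    rw [hux x hx, ← setIntegral_Ioo_comp_mul _ hs, dualDil, dual_apply hu', ← integral_smul]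
    refine setIntegral_congr_fun measurableSet_Ioo fun v hv => ?_
    have h1 : ext ((s : ℂ) • kap a b x s) v = (s : ℂ) * ext (kap a b x s) v := rfl
    simp only [Complex.real_smul]
    rw [h1, ext_kap hb hx hs.le hv]
    ring
  -- As a functional, `u` annihilates the range of 1 - T, which is the whole space.
  have h1 : (dualDil u s).comp (1 - opK a b s) = 0 := by
    ext e
    rw [ContinuousLinearMap.comp_apply, sub_apply, one_apply_eq_self, map_sub,
      clm_opK_apply hb hs, dualDil, dual_apply hu']
    refine sub_eq_zero.2 (setIntegral_congr_fun measurableSet_Ioo fun v hv => ?_)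
    rw [hux' _ (mul_pos hs hv.1), smul_eq_mul, mul_comm]
    rfl
  have h2 : dualDil u s = 0 := by
    have h3 := congrArg (fun T : E →L[ℂ] E => (dualDil u s).comp T)
      (Ring.mul_inverse_cancel _ (isUnit_one_sub_opK hb hs h0))
    have h4 : (dualDil u s).comp ((1 - opK a b s) * Ring.inverse (1 - opK a b s)) =
        ((dualDil u s).comp (1 - opK a b s)).comp (Ring.inverse (1 - opK a b s)) := rfl
    simp only [h4, h1, ContinuousLinearMap.zero_comp] at h3
    exact h3.symm
  rw [hux' x hx, h2]
  rfl

lemma isSingular_solP (hb : IsSingular b) {h : ℝ → ℂ} (hh : IsSingular h) {s : ℝ} (hs : 0 < s) :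
    IsSingular (solP a b h s) := by
  refine ⟨hh.cont.add fun x hx => ?_, fun A => ?_⟩
  · have h1 : ContinuousAt (fun x : ℝ => kap a b x s) x :=
      ContinuousAt.comp (f := fun x : ℝ => (x, s)) (continuousAt_kap hb hx hs) (by fun_prop)
    exact (((dualDil h s).continuous.continuousAt.comp
      ((res a b s).continuous.continuousAt.comp h1)).const_mul _).continuousWithinAt
  · obtain ⟨C, h0, hC⟩ := hh.bound A
    obtain ⟨C', h0', hC'⟩ := exists_norm_kap_le (a := a) hb (max A s)
    refine ⟨C + s * (‖dualDil h s‖ * (‖res a b s‖ * C')), by positivity, fun y hy hyA => ?_⟩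
    refine (norm_add_le _ _).trans ?_
    rw [add_mul]
    refine add_le_add (hC y hy hyA) ?_
    rw [norm_mul, Complex.norm_real, Real.norm_of_nonneg hs.le]
    have h1 := hC' y hy (hyA.trans (le_max_left _ _)) s hs.le (le_max_right _ _)
    have h2 := (res a b s).le_opNorm (kap a b y s)
    have h3 := (dualDil h s).le_opNorm (res a b s (kap a b y s))
    calc s * ‖dualDil h s (res a b s (kap a b y s))‖
        ≤ s * (‖dualDil h s‖ * (‖res a b s‖ * (C' * y ^ (-1 / 4 : ℝ)))) := by
          refine mul_le_mul_of_nonneg_left (h3.trans ?_) hs.le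
          refine mul_le_mul_of_nonneg_left (h2.trans ?_) (norm_nonneg _)
          exact mul_le_mul_of_nonneg_left h1 (norm_nonneg _)
      _ = _ := by ring

/-- The transposed equation needs the resolvent identity in the order R = 1 + R T, applied to the
column of the kernel at x. -/
lemma solP_eq (hb : IsSingular b) {h : ℝ → ℂ} (hh : IsSingular h) {s : ℝ} (hs : 0 < s)
    (h0 : detK a b s ≠ 0) {x : ℝ}
    (hx : 0 < x) :
    solP a b h s x - ∫ y in Ioo 0 s, kfun a b y x * solP a b h s y = h x := by
  have hres : res a b s (kap a b x s) = kap a b x s + res a b s (opK a b s (kap a b x s)) := by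
    have := congrArg (fun T : E →L[ℂ] E => T (kap a b x s))
      (Ring.inverse_mul_cancel _ (isUnit_one_sub_opK hb hs h0))
    simp only [mul_apply_eq_comp, sub_apply, one_apply_eq_self, map_sub] at this
    exact sub_eq_iff_eq_add.1 this
  have h1 := clm_opK_apply (a := a) hb hs (kap a b x s) ((dualDil h s).comp (res a b s))
  have h2 : dualDil h s (kap a b x s) =
      ∫ v in Ioo (0 : ℝ) 1, h (s * v) * ext (kap a b x s) v := dual_apply (hh.integrableOn_dil hs) _
  have hi1 := integrableOn_mul_ext (hh.integrableOn_dil hs) (kap a b x s)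
  have hi2 : IntegrableOn (fun v => ext (kap a b x s) v •
      ((dualDil h s).comp (res a b s)) ((s : ℂ) • kap a b (s * v) s)) (Ioo 0 1) := by
    have := ((dualDil h s).comp (res a b s)).integrable_comp
      (integrableOn_mul_smul_kap (a := a) hb hs hs (memLp_ext (kap a b x s)))
    simpa only [map_smul, IntegrableOn] using this
  have h3 : dualDil h s (res a b s (kap a b x s)) = ∫ v in Ioo (0 : ℝ) 1,
      kfun a b (s * v) x * solP a b h s (s * v) := by
    rw [hres, map_add, h2]
    change _ + ((dualDil h s).comp (res a b s)) (opK a b s (kap a b x s)) = _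
    rw [h1, ← integral_add hi1 hi2]
    refine setIntegral_congr_fun measurableSet_Ioo fun v hv => ?_
    simp only [ext_kap hb hx hs.le hv, solP, map_smul, smul_eq_mul,
      ContinuousLinearMap.comp_apply]
    ring
  rw [← setIntegral_Ioo_comp_mul _ hs, ← h3, solP, Complex.real_smul, add_sub_cancel_right]

end Kernel

end

section

/-! ### The pairing `∫_0^s p (1 - K')⁻¹ h` and its derivative -/

/-- If the increments of `W` are integrals of `G(x, s')`, then `W' (s) = G(s, s)`. -/
lemma hasDerivAt_of_increment {W : ℝ → ℂ} {G : ℝ → ℝ → ℂ} {s : ℝ} (hs : 0 < s)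
    (hG : ContinuousAt (fun p : ℝ × ℝ => G p.1 p.2) (s, s))
    (hc : ∀ t, 0 < t → ContinuousOn (fun x => G x t) (Ioi 0))
    (hW : ∀ᶠ t in 𝓝 s, W t - W s = ∫ x in s..t, G x t) : HasDerivAt W (G s s) s := by
  rw [hasDerivAt_iff_isLittleO, Asymptotics.isLittleO_iff]
  intro c hc0
  obtain ⟨δ, hδ, hball⟩ := Metric.continuousAt_iff.1 hG c hc0
  filter_upwards [hW, Metric.ball_mem_nhds s hδ, Ioi_mem_nhds hs] with t ht htδ ht0
  have hinteg : IntervalIntegrable (fun x => G x t) volume s t :=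
    ((hc t ht0).mono fun x hx => lt_of_lt_of_le (lt_min hs ht0) hx.1).intervalIntegrable
  have h1 : W t - W s - (t - s) • G s s = ∫ x in s..t, (G x t - G s s) := by
    rw [ht, intervalIntegral.integral_sub hinteg intervalIntegrable_const,
      intervalIntegral.integral_const]
  rw [h1, Real.norm_eq_abs]
  refine intervalIntegral.norm_integral_le_of_norm_le_const fun x hx => ?_
  have hx' : dist x s < δ := by
    have h2 : |x - s| ≤ |t - s| := by
      rcases le_total s t with hst | hst
      · rw [uIoc_of_le hst] at hx
        rw [abs_of_nonneg (by linarith [hx.1]), abs_of_nonneg (by linarith)]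
        linarith [hx.2]
      · rw [uIoc_of_ge hst] at hx
        rw [abs_of_nonpos (by linarith [hx.2]), abs_of_nonpos (by linarith)]
        linarith [hx.1]
    exact lt_of_le_of_lt h2 htδ
  have := hball (x := (x, t)) (by rw [Prod.dist_eq]; exact max_lt hx' htδ)
  rw [dist_eq_norm] at this
  exact this.le

section Pairing

variable {a : C(ℝ, ℂ)} {b : ℝ → ℂ}

lemma integrable_kfun_mul (hb : IsSingular b) {q r : ℝ → ℂ} {C D : ℝ} {s s' : ℝ} (hs : 0 < s)
    (hs' : 0 < s')
    (hq : ContinuousOn q (Ioi 0)) (hqb : ∀ y, 0 < y → y ≤ s → ‖q y‖ ≤ C)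
    (hr : ContinuousOn r (Ioi 0)) (hrb : ∀ y, 0 < y → y ≤ s' → ‖r y‖ ≤ D * y ^ (-1 / 4 : ℝ)) :
    Integrable (Function.uncurry fun x y : ℝ => kfun a b x y * q y * r x)
      ((volume.restrict (Ioo 0 s')).prod (volume.restrict (Ioo 0 s))) := by
  obtain ⟨B, h0, hB⟩ := exists_norm_kfun_le (a := a) hb (max s s')
  have hw : ∀ {A : ℝ}, 0 < A → IntegrableOn (fun v : ℝ => v ^ (-1 / 4 : ℝ)) (Ioo 0 A) := fun hA =>
    (intervalIntegrable_iff_integrableOn_Ioo_of_le hA.le).1 (intervalIntegrable_rpow_quarter 0 _)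
  have hdom : Integrable (fun p : ℝ × ℝ => (B * C * D) * (p.1 ^ (-1 / 4 : ℝ) * p.2 ^ (-1 / 4 : ℝ)))
      ((volume.restrict (Ioo 0 s')).prod (volume.restrict (Ioo 0 s))) :=
    (Integrable.mul_prod (hw hs') (hw hs)).const_mul _
  rw [Measure.prod_restrict] at hdom ⊢
  refine hdom.mono' ?_ ?_
  · refine ContinuousOn.aestronglyMeasurable ?_ (measurableSet_Ioo.prod measurableSet_Ioo)
    have h1 : ContinuousOn (fun p : ℝ × ℝ => kfun a b p.1 p.2) (Ioo 0 s' ×ˢ Ioo 0 s) :=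
      fun p hp => (continuousAt_kfun hb hp.1.1 hp.2.1).continuousWithinAt
    exact (h1.mul (hq.comp continuous_snd.continuousOn fun p hp => hp.2.1)).mul
      (hr.comp continuous_fst.continuousOn fun p hp => hp.1.1)
  · refine (ae_restrict_mem (measurableSet_Ioo.prod measurableSet_Ioo)).mono fun p hp => ?_
    have h1 := hB p.1 hp.1.1 (hp.1.2.le.trans (le_max_right _ _)) p.2 hp.2.1
      (hp.2.2.le.trans (le_max_left _ _))
    have h2 := hqb p.2 hp.2.1 hp.2.2.le
    have h3 := hrb p.1 hp.1.1 hp.1.2.le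
    rw [Function.uncurry, norm_mul, norm_mul]
    calc _ ≤ (B * p.2 ^ (-1 / 4 : ℝ)) * C * (D * p.1 ^ (-1 / 4 : ℝ)) := by
          gcongr
          · exact mul_nonneg ((norm_nonneg _).trans h1) ((norm_nonneg _).trans h2)
          · exact (norm_nonneg _).trans h1
      _ = _ := by ring

lemma integrableOn_solQ_mul (hb : IsSingular b) {p : C(ℝ, ℂ)} {r : ℝ → ℂ} (hr : IsSingular r)
    {s A : ℝ} (hs : 0 < s)
    (hA : 0 ≤ A) : IntegrableOn (fun x => solQ a b p s x * r x) (Ioo 0 A) := by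
  obtain ⟨C, h0, hC⟩ := exists_norm_solQ_le (a := a) hb p hs A
  refine Integrable.bdd_mul (c := C) (hr.integrableOn hA) ?_ ?_
  · exact ((continuousOn_solQ hb p hs).mono fun x hx => hx.1).aestronglyMeasurable measurableSet_Ioo
  · exact (ae_restrict_mem measurableSet_Ioo).mono fun x hx => hC x hx.1 hx.2.le

/-- Write p = Q - K Q with the solution Q for s, and h = P - K' P with the solution P for s'. The
two double integrals over (0,s') × (0,s) agree by Fubini, and the difference of ∫ Q P over (0,s')
and (0,s) remains. -/
lemma integral_mul_solP_sub (hb : IsSingular b) {p : C(ℝ, ℂ)} {h : ℝ → ℂ} (hh : IsSingular h)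
    {s s' : ℝ} (hs : 0 < s)
    (hs' : 0 < s') (h0 : detK a b s ≠ 0) (h0' : detK a b s' ≠ 0) :
    (∫ x in Ioo 0 s', p x * solP a b h s' x) - ∫ y in Ioo 0 s, solQ a b p s y * h y =
      ∫ x in s..s', solQ a b p s x * solP a b h s' x := by
  have hP := isSingular_solP (a := a) hb hh hs'
  obtain ⟨C, -, hC⟩ := exists_norm_solQ_le (a := a) hb p hs s
  obtain ⟨D, -, hD⟩ := hP.bound s'
  have hinteg := integrable_kfun_mul (a := a) hb hs hs' (continuousOn_solQ (a := a) hb p hs) hC hP.cont hD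
  have hl := hinteg.integral_prod_left
  have hr := hinteg.integral_prod_right
  simp only [Function.uncurry_apply_pair] at hl hr
  have hQP : ∀ {A : ℝ}, 0 < A → IntegrableOn (fun x => solQ a b p s x * solP a b h s' x) (Ioo 0 A) :=
    fun hA => integrableOn_solQ_mul hb hP hs hA.le
  have e1 : ∫ x in Ioo 0 s', p x * solP a b h s' x =
      (∫ x in Ioo 0 s', solQ a b p s x * solP a b h s' x) -
        ∫ x in Ioo 0 s', ∫ y in Ioo 0 s, kfun a b x y * solQ a b p s y * solP a b h s' x := by
    rw [← integral_sub (hQP hs') hl]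
    refine setIntegral_congr_fun measurableSet_Ioo fun x hx => ?_
    rw [integral_mul_const, ← sub_mul, solQ_eq hb hs h0]
  have e2 : ∫ y in Ioo 0 s, solQ a b p s y * h y =
      (∫ x in Ioo 0 s, solQ a b p s x * solP a b h s' x) -
        ∫ y in Ioo 0 s, ∫ x in Ioo 0 s', kfun a b x y * solQ a b p s y * solP a b h s' x := by
    rw [← integral_sub (hQP hs) hr]
    refine setIntegral_congr_fun measurableSet_Ioo fun y hy => ?_
    have := solP_eq (a := a) hb hh hs' h0' hy.1
    rw [← this, mul_sub, ← integral_const_mul]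
    congr 1
    refine integral_congr_ae (ae_of_all _ fun x => ?_)
    ring
  rw [e1, e2, integral_integral_swap hinteg, sub_sub_sub_cancel_right]
  have hI : ∀ {A : ℝ}, 0 < A →
      IntervalIntegrable (fun x => solQ a b p s x * solP a b h s' x) volume 0 A := fun hA =>
    (intervalIntegrable_iff_integrableOn_Ioo_of_le hA.le).2 (hQP hA)
  rw [← intervalIntegral.integral_interval_sub_left (hI hs') (hI hs),
    intervalIntegral.integral_of_le hs.le, intervalIntegral.integral_of_le hs'.le,
    integral_Ioc_eq_integral_Ioo, integral_Ioc_eq_integral_Ioo]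

lemma integral_solQ_mul (hb : IsSingular b) {p : C(ℝ, ℂ)} {h : ℝ → ℂ} (hh : IsSingular h) {s : ℝ}
    (hs : 0 < s)
    (h0 : detK a b s ≠ 0) : ∫ y in Ioo 0 s, solQ a b p s y * h y =
      s * dualDil h s (res a b s (dil p s)) := by
  rw [← setIntegral_Ioo_comp_mul _ hs, dualDil, dual_apply (hh.integrableOn_dil hs),
    Complex.real_smul]
  congr 1
  refine setIntegral_congr_fun measurableSet_Ioo fun v hv => ?_
  simp only [solQ_mul hb hs h0 (Ioo_subset_Ioc_self hv)]
  ring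

lemma integral_mul_solP (hb : IsSingular b) {p : C(ℝ, ℂ)} {h : ℝ → ℂ} (hh : IsSingular h) {s : ℝ}
    (hs : 0 < s)
    (h0 : detK a b s ≠ 0) : ∫ x in Ioo 0 s, p x * solP a b h s x =
      s * dualDil h s (res a b s (dil p s)) := by
  have h1 := integral_mul_solP_sub (a := a) (p := p) hb hh hs hs h0 h0
  rw [intervalIntegral.integral_same, sub_eq_zero] at h1
  rw [h1, integral_solQ_mul hb hh hs h0]

lemma continuousAt_solP (hb : IsSingular b) {h : ℝ → ℂ} (hh : IsSingular h) {s x : ℝ} (hs : 0 < s)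
    (hx : 0 < x)
    (h0 : detK a b s ≠ 0) :
    ContinuousAt (fun p : ℝ × ℝ => solP a b h p.2 p.1) (x, s) := by
  have h1 : ContinuousAt (fun p : ℝ × ℝ => h p.1) (x, s) :=
    ContinuousAt.comp (f := fun p : ℝ × ℝ => p.1) (x := (x, s))
      (hh.cont.continuousAt (Ioi_mem_nhds hx)) continuousAt_fst
  have h2 : ContinuousAt (fun p : ℝ × ℝ => dualDil h p.2) (x, s) :=
    ContinuousAt.comp (f := fun p : ℝ × ℝ => p.2) (x := (x, s)) (g := dualDil h)
      (hh.continuousOn_dual.continuousAt (Ioi_mem_nhds hs)) continuousAt_snd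
  have h3 : ContinuousAt (fun p : ℝ × ℝ => res a b p.2) (x, s) :=
    ContinuousAt.comp (f := fun p : ℝ × ℝ => p.2) (x := (x, s)) (g := res a b)
      (hasDerivAt_res hb hs h0).continuousAt continuousAt_snd
  have h4 : ContinuousAt (fun p : ℝ × ℝ => (p.2 : ℂ)) (x, s) := by fun_prop
  exact h1.add (h4.mul (h2.clm_apply (h3.clm_apply (continuousAt_kap hb hx hs))))

/-- The derivative of `∫_0^s p (1 - K')⁻¹ h`. -/
lemma hasDerivAt_pairing (hb : IsSingular b) {p : C(ℝ, ℂ)} {h : ℝ → ℂ} (hh : IsSingular h) {s : ℝ}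
    (hs : 0 < s)
    (h0 : detK a b s ≠ 0) :
    HasDerivAt (fun s : ℝ => s * dualDil h s (res a b s (dil p s)))
      (evalE 1 (res a b s (dil p s)) * solP a b h s s) s := by
  have hev : evalE 1 (res a b s (dil p s)) = solQ a b p s s := by
    have := solQ_mul (a := a) (p := p) hb hs h0 (v := 1) (by simp)
    rw [mul_one, ext_of_mem _ (by simp)] at this
    rw [this]
    rfl
  rw [hev]
  -- The first solution is kept at the fixed length s, so joint continuity in point and length is
  -- needed for the second factor only.
  refine hasDerivAt_of_increment (G := fun x t => solQ a b p s x * solP a b h t x) hs ?_ ?_ ?_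
  · have h1 : ContinuousAt (fun q : ℝ × ℝ => solQ a b p s q.1) (s, s) :=
      ContinuousAt.comp (f := fun p : ℝ × ℝ => p.1) (x := (s, s))
        ((continuousOn_solQ hb p hs).continuousAt (Ioi_mem_nhds hs)) continuousAt_fst
    exact h1.mul (continuousAt_solP hb hh hs hs h0)
  · intro t ht
    exact (continuousOn_solQ hb p hs).mul (isSingular_solP hb hh ht).cont
  · have h1 := (hasDerivAt_detK (a := a) hb hs h0).continuousAt.eventually_ne h0
    filter_upwards [h1, Ioi_mem_nhds hs] with t ht ht0
    rw [← integral_mul_solP (p := p) hb hh ht0 ht, ← integral_solQ_mul (p := p) hb hh hs h0]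
    exact integral_mul_solP_sub hb hh hs ht0 h0 ht

end Pairing

end

section

/-! ### The differential equations -/

/-- Multiplication by the coordinate on `C([0,1])`. -/
def mulX : E →L[ℂ] E :=
  ContinuousLinearMap.mul ℂ E (BoundedContinuousFunction.mkOfCompact ⟨fun u => ((u : ℝ) : ℂ), by fun_prop⟩)

lemma mulX_apply (e : E) (u : unitInterval) : mulX e u = ((u : ℝ) : ℂ) * e u := rfl

lemma ext_mulX (e : E) {v : ℝ} (hv : v ∈ Ioo (0 : ℝ) 1) : ext (mulX e) v = v * ext e v := by
  rw [ext_of_mem _ (Ioo_subset_Icc_self hv), ext_of_mem _ (Ioo_subset_Icc_self hv), mulX_apply]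

lemma evalE_one_mulX (e : E) : evalE 1 (mulX e) = evalE 1 e := by
  rw [evalE_apply, mulX_apply]
  simp

variable {M : ℕ} {ν : Fin (M + 1) → ℕ} (hν : ν 0 = 0)

/-- The function `φ_j(s u)` on `[0,1]`. -/
def Phi (j : ℕ) (s : ℝ) : E := dil (phiC hν j) s

/-- The functional `e ↦ ∫_0^1 ψ_j(s v) e(v) dv`. -/
def Psi (ν : Fin (M + 1) → ℕ) (j : ℕ) (s : ℝ) : E →L[ℂ] ℂ := dualDil (psi ν j) s

/-- The operator `K_M` on `(0,s)`, rescaled to `(0,1)`. -/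
def opM (s : ℝ) : E →L[ℂ] E := opK (fC hν) (g ν) s

/-- Its Fredholm determinant. -/
def detM (s : ℝ) : ℂ := detK (fC hν) (g ν) s

/-- Its resolvent. -/
def Res (s : ℝ) : E →L[ℂ] E := res (fC hν) (g ν) s

/-- The value of `(1 - K_M)⁻¹ φ_j` at `s`. -/
def valX (j : ℕ) (s : ℝ) : ℂ := evalE 1 (Res hν s (Phi hν j s))

/-- The value of `(1 - K_M')⁻¹ ψ_j` at `s`. -/
def valY (j : ℕ) (s : ℝ) : ℂ := solP (fC hν) (g ν) (psi ν j) s s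

/-- The pairing `∫_0^s φ_i (1 - K_M')⁻¹ ψ_j`. -/
def pairing (i j : ℕ) (s : ℝ) : ℂ := s * Psi ν j s (Res hν s (Phi hν i s))

lemma dil_fC (s : ℝ) : dil (fC hν) s = (-1 : ℂ) ^ (M + 1) • Phi hν 0 s := rfl

lemma dualDil_g (hν : ν 0 = 0) {s : ℝ} (hs : 0 < s) : (dual fun v => g ν (s * v)) = Psi ν M s :=
  dual_congr fun _ hv => (psi_last hν (mul_pos hs hv.1)).symm

lemma rankOne_apply {s : ℝ} (hs : 0 < s) (e : E) :
    rankOne (fC hν) (g ν) s e = ((-1) ^ (M + 1) * Psi ν M s e) • Phi hν 0 s := by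
  rw [rankOne, ContinuousLinearMap.smulRight_apply, dualDil_g hν hs, dil_fC, smul_smul, mul_comm]

/-- Multiplying the column of the kernel at y by su - y clears the denominator and leaves the finite
sum Σ φ_j(su) ψ_j(y). -/
lemma smul_mulX_kap_sub {y s : ℝ} (hy : 0 < y) (hs : 0 < s) :
    (s : ℂ) • mulX (kap (fC hν) (g ν) y s) - (y : ℂ) • kap (fC hν) (g ν) y s =
      ∑ j ∈ Finset.range (M + 1), psi ν j y • Phi hν j s := by
  rw [← sub_eq_zero]
  refine eq_zero_of_forall_pos fun u hu => ?_
  have h1 := sum_phi_psi_eq hν (mul_pos hs hu) hy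
  have h2 : (∑ j ∈ Finset.range (M + 1), psi ν j y • Phi hν j s) u =
      ∑ j ∈ Finset.range (M + 1), phi ν j (s * u) * psi ν j y := by
    change evalE u _ = _
    rw [map_sum]
    refine Finset.sum_congr rfl fun j _ => ?_
    rw [map_smul, evalE_apply, Phi, dil_apply, phiC_apply hν j (mul_pos hs hu), smul_eq_mul, mul_comm]
  change (s : ℂ) * (((u : ℝ) : ℂ) * kap (fC hν) (g ν) y s u) - (y : ℂ) * kap (fC hν) (g ν) y s u
    - (∑ j ∈ Finset.range (M + 1), psi ν j y • Phi hν j s) u = 0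
  rw [h2, h1, kap_apply (isSingular_g hν) hy hs.le]
  push_cast
  ring

/-- The commutator of `K_M` with the multiplication operator. -/
lemma commutator_apply {s : ℝ} (hs : 0 < s) (e : E) :
    mulX (opM hν s e) - opM hν s (mulX e) =
      ∑ j ∈ Finset.range (M + 1), Psi ν j s e • Phi hν j s := by
  have hg := isSingular_g hν
  have h1 := clm_opK_apply (a := fC hν) hg hs e mulX
  have h2 := opK_apply (a := fC hν) hg hs (mulX e)
  have i1 : IntegrableOn (fun v => ext e v • mulX ((s : ℂ) • kap (fC hν) (g ν) (s * v) s)) (Ioo 0 1) := by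
    have := mulX.integrable_comp (integrableOn_mul_smul_kap (a := fC hν) hg hs hs (memLp_ext e))
    simpa only [map_smul, IntegrableOn] using this
  have i2 := integrableOn_mul_smul_kap (a := fC hν) hg hs hs (memLp_ext (mulX e))
  rw [opM, h1, h2, ← integral_sub i1 i2]
  have h3 : ∀ v ∈ Ioo (0 : ℝ) 1, ext e v • mulX ((s : ℂ) • kap (fC hν) (g ν) (s * v) s) -
      ext (mulX e) v • (s : ℂ) • kap (fC hν) (g ν) (s * v) s =
      ∑ j ∈ Finset.range (M + 1), (psi ν j (s * v) * ext e v) • Phi hν j s := by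
    intro v hv
    have h4 := smul_mulX_kap_sub hν (mul_pos hs hv.1) hs
    calc _ = ext e v • ((s : ℂ) • mulX (kap (fC hν) (g ν) (s * v) s) -
          ((s * v : ℝ) : ℂ) • kap (fC hν) (g ν) (s * v) s) := by
          rw [ext_mulX e hv, map_smul, smul_sub]
          congr 1
          simp only [smul_smul]
          push_cast
          congr 1
          ring
      _ = _ := by
          rw [h4, Finset.smul_sum]
          refine Finset.sum_congr rfl fun j _ => ?_
          rw [smul_smul, mul_comm]
  rw [setIntegral_congr_fun measurableSet_Ioo h3, integral_finsetSum]
  · refine Finset.sum_congr rfl fun j hj => ?_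
    have hj' : j ≤ M := by simpa [Nat.lt_succ_iff] using hj
    rw [integral_smul_const, Psi, dualDil, dual_apply ((isSingular_psi hν hj').integrableOn_dil hs)]
  · intro j hj
    have hj' : j ≤ M := by simpa [Nat.lt_succ_iff] using hj
    exact (integrableOn_mul_ext ((isSingular_psi hν hj').integrableOn_dil hs) e).smul_const _

/-- The identity [X, R] = R [X, T] R for the inverse R of 1 - T, with the commutator of finite rank
inserted. -/
lemma res_mulX {s : ℝ} (hs : 0 < s) (h0 : detM hν s ≠ 0) (e : E) :
    mulX (Res hν s e) = Res hν s (mulX e) +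
      ∑ j ∈ Finset.range (M + 1), Psi ν j s (Res hν s e) • Res hν s (Phi hν j s) := by
  have hu := isUnit_one_sub_opK (a := fC hν) (isSingular_g hν) hs h0
  have hr : ∀ e, Res hν s e - opM hν s (Res hν s e) = e := fun e => by
    have := congrArg (fun T : E →L[ℂ] E => T e) (Ring.mul_inverse_cancel _ hu)
    simp only [mul_apply_eq_comp, sub_apply, one_apply_eq_self] at this
    exact this
  have hl : ∀ e, Res hν s (e - opM hν s e) = e := fun e => by
    have := congrArg (fun T : E →L[ℂ] E => T e) (Ring.inverse_mul_cancel _ hu)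
    simp only [mul_apply_eq_comp, sub_apply, one_apply_eq_self] at this
    exact this
  have h1 : mulX (Res hν s e) - opM hν s (mulX (Res hν s e)) = mulX e +
      ∑ j ∈ Finset.range (M + 1), Psi ν j s (Res hν s e) • Phi hν j s := by
    rw [← commutator_apply hν hs]
    conv_rhs => rw [← hr e]
    rw [map_sub, hr e]
    abel
  rw [← hl (mulX (Res hν s e)), h1, map_add, map_sum]
  simp only [map_smul]

lemma hasDerivAt_Phi {j : ℕ} (hj : j < M) {s : ℝ} (hs : 0 < s) :
    HasDerivAt (Phi hν j) ((s : ℂ)⁻¹ • -Phi hν (j + 1) s) s := by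
  have h := hasDerivAt_dil (h := phiC hν j) (θ := -phiC hν (j + 1)) (fun y hy => ?_) hs
  · exact h
  · have h1 := hasDerivAt_phi hν hj.le hy
    rw [thetaPhi, if_pos hj, ← phiC_apply hν _ hy] at h1
    refine h1.congr_of_eventuallyEq ?_
    filter_upwards [Ioi_mem_nhds hy] with z hz using phiC_apply hν j hz

lemma hasDerivAt_Phi_last {s : ℝ} (hs : 0 < s) :
    HasDerivAt (Phi hν M) ((s : ℂ)⁻¹ • (((-1 : ℂ) ^ (M + 1) * s) • mulX (Phi hν 0 s) +
      ∑ i ∈ Finset.range (M + 1), eps ν i • Phi hν i s)) s := by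
  have h := hasDerivAt_dil (h := phiC hν M) (θ := ⟨fun x => (-1) ^ (M + 1) * x * phiC hν 0 x +
    ∑ i ∈ Finset.range (M + 1), eps ν i * phiC hν i x, by fun_prop⟩) (fun y hy => ?_) hs
  · refine h.congr_deriv ?_
    congr 1
    ext u
    have h2 : (∑ i ∈ Finset.range (M + 1), eps ν i • Phi hν i s) u =
        ∑ i ∈ Finset.range (M + 1), eps ν i * phiC hν i (s * u) := by
      change evalE u _ = _
      rw [map_sum]
      rfl
    change (-1 : ℂ) ^ (M + 1) * ((s * u : ℝ) : ℂ) * phiC hν 0 (s * u) +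
      ∑ i ∈ Finset.range (M + 1), eps ν i * phiC hν i (s * u) = ((-1 : ℂ) ^ (M + 1) * s) *
        (((u : ℝ) : ℂ) * phiC hν 0 (s * u)) + (∑ i ∈ Finset.range (M + 1), eps ν i • Phi hν i s) u
    rw [h2]
    push_cast
    ring
  · have h1 := hasDerivAt_phi hν le_rfl hy
    rw [thetaPhi, if_neg (lt_irrefl M)] at h1
    simp only [← phiC_apply hν _ hy] at h1
    refine h1.congr_of_eventuallyEq ?_
    filter_upwards [Ioi_mem_nhds hy] with z hz using phiC_apply hν M hz

lemma hasDerivAt_Psi (hν : ν 0 = 0) {j : ℕ} (hj1 : 1 ≤ j) (hj : j ≤ M) {s : ℝ} (hs : 0 < s) :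
    HasDerivAt (Psi ν j) ((s : ℂ)⁻¹ • (Psi ν (j - 1) s - eps ν j • Psi ν M s)) s := by
  have hs1 := isSingular_psi hν (show j - 1 ≤ M by omega)
  have hs2 := isSingular_psi hν (le_refl M)
  have h := (isSingular_psi hν hj).hasDerivAt_dual (hs1.sub (hs2.const_mul (eps ν j)))
    (fun y hy => by
      have := hasDerivAt_psi hν hj hy
      rwa [thetaPsi, if_neg (by omega)] at this) hs
  rw [dual_sub (hs1.integrableOn_dil hs) ((hs2.integrableOn_dil hs).const_mul _),
    dual_const_mul (hs2.integrableOn_dil hs)] at h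
  exact h

lemma hasDerivAt_Psi_zero (hν : ν 0 = 0) {s : ℝ} (hs : 0 < s) :
    HasDerivAt (Psi ν 0) ((s : ℂ)⁻¹ • (((-1 : ℂ) ^ M * s) • (Psi ν M s).comp mulX)) s := by
  have hs2 := isSingular_psi hν (le_refl M)
  have hθ : IsSingular fun y => (-1) ^ M * y * psi ν M y :=
    hs2.mul_continuous (k := fun y : ℝ => (-1) ^ M * (y : ℂ)) (by fun_prop)
  have h := (isSingular_psi hν M.zero_le).hasDerivAt_dual hθ (fun y hy => by
      have := hasDerivAt_psi hν M.zero_le hy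
      rwa [thetaPsi, if_pos rfl] at this) hs
  have h1 : (dual fun v => (-1) ^ M * ((s * v : ℝ) : ℂ) * psi ν M (s * v)) =
      ((-1 : ℂ) ^ M * s) • (Psi ν M s).comp mulX := by
    ext e
    rw [dual_apply (hθ.integrableOn_dil hs), smul_apply, ContinuousLinearMap.comp_apply, Psi, dualDil,
      dual_apply (hs2.integrableOn_dil hs), smul_eq_mul, ← integral_const_mul]
    refine setIntegral_congr_fun measurableSet_Ioo fun v hv => ?_
    simp only [ext_mulX e hv]
    push_cast
    ring
  rw [h1] at h
  exact h

lemma hasDerivAt_Res {s : ℝ} (hs : 0 < s) (h0 : detM hν s ≠ 0) :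
    HasDerivAt (Res hν) (Res hν s * rankOne (fC hν) (g ν) s * Res hν s) s :=
  hasDerivAt_res (isSingular_g hν) hs h0

lemma hasDerivAt_clm_apply {V W : Type*} [NormedAddCommGroup V] [NormedSpace ℂ V]
    [NormedAddCommGroup W] [NormedSpace ℂ W] {T : ℝ → V →L[ℂ] W} {T' : V →L[ℂ] W} {h : ℝ → V}
    {h' : V} {s : ℝ} (hT : HasDerivAt T T' s) (hh : HasDerivAt h h' s) :
    HasDerivAt (fun s => T s (h s)) (T' (h s) + T s h') s := by
  have h1 : HasDerivAt (fun s => (T s).restrictScalars ℝ) (T'.restrictScalars ℝ) s :=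
    (ContinuousLinearMap.restrictScalarsL ℂ V W ℝ ℝ).hasFDerivAt.comp_hasDerivAt s hT
  exact h1.clm_apply hh

/-- Since R' = R T' R and T' is of rank one with range spanned by Φ_0, the derivative of the
resolvent contributes a multiple of x_0, with η_j as coefficient up to sign. -/
lemma hasDerivAt_valX_aux {j : ℕ} {s : ℝ} (hs : 0 < s) (h0 : detM hν s ≠ 0) {d : E}
    (hd : HasDerivAt (Phi hν j) ((s : ℂ)⁻¹ • d) s) :
    HasDerivAt (valX hν j) ((s : ℂ)⁻¹ * ((-1) ^ (M + 1) * pairing hν j M s * valX hν 0 s +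
      evalE 1 (Res hν s d))) s := by
  have hs' : (s : ℂ) ≠ 0 := by exact_mod_cast hs.ne'
  refine (hasDerivAt_clm_comp (evalE 1)
    (hasDerivAt_clm_apply (hasDerivAt_Res hν hs h0) hd)).congr_deriv ?_
  rw [map_add, mul_apply_eq_comp, mul_apply_eq_comp, rankOne_apply hν hs, map_smul, map_smul,
    map_smul, map_smul, pairing, valX, smul_eq_mul, smul_eq_mul]
  field_simp

lemma hasDerivAt_valX {j : ℕ} (hj : j < M) {s : ℝ} (hs : 0 < s) (h0 : detM hν s ≠ 0) :
    HasDerivAt (valX hν j) ((s : ℂ)⁻¹ * ((-1) ^ (M + 1) * pairing hν j M s * valX hν 0 s -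
      valX hν (j + 1) s)) s := by
  refine (hasDerivAt_valX_aux hν hs h0 (hasDerivAt_Phi hν hj hs)).congr_deriv ?_
  rw [map_neg, map_neg, ← sub_eq_add_neg]
  rfl

/-- The derivative of Φ_M contains X Φ_0. Moving X to the left of R costs the pairings of φ_0 with
the ψ_i, which join the constants `eps ν i` to form ξ_i; at u = 1 the factor X then disappears. -/
lemma hasDerivAt_valX_last {s : ℝ} (hs : 0 < s) (h0 : detM hν s ≠ 0) :
    HasDerivAt (valX hν M) ((s : ℂ)⁻¹ * ((-1) ^ (M + 1) * pairing hν M M s * valX hν 0 s +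
      (-1) ^ (M + 1) * s * valX hν 0 s +
      ∑ i ∈ Finset.range (M + 1), ((-1) ^ M * pairing hν 0 i s + eps ν i) * valX hν i s)) s := by
  refine (hasDerivAt_valX_aux hν hs h0 (hasDerivAt_Phi_last hν hs)).congr_deriv ?_
  have h1 := congrArg (evalE 1) (res_mulX hν hs h0 (Phi hν 0 s))
  rw [evalE_one_mulX, map_add, map_sum, ← sub_eq_iff_eq_add] at h1
  rw [map_add, map_smul, map_sum, map_add, map_smul, map_sum, ← h1, add_assoc ((-1) ^ (M + 1) * _ * _)]
  congr 2
  simp only [map_smul, smul_eq_mul, add_mul, Finset.sum_add_distrib]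
  change (-1) ^ (M + 1) * (s : ℂ) * (valX hν 0 s -
    ∑ j ∈ Finset.range (M + 1), Psi ν j s (Res hν s (Phi hν 0 s)) * valX hν j s) +
    ∑ j ∈ Finset.range (M + 1), eps ν j * valX hν j s = _
  rw [mul_sub, Finset.mul_sum, sub_add_eq_add_sub, add_sub_assoc, add_comm (∑ j ∈ _, _) (∑ j ∈ _, _),
    ← sub_neg_eq_add _ (∑ j ∈ Finset.range (M + 1), (-1) ^ M * pairing hν 0 j s * _),
    ← Finset.sum_neg_distrib]
  congr 2
  refine Finset.sum_congr rfl fun j _ => ?_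
  rw [pairing, pow_succ]
  ring

/-- The factor s is moved onto the column, written at s · 1, because in this form its derivative in
s is of rank one by `hasDerivAt_smul_kap`. -/
lemma valY_eq (j : ℕ) (s : ℝ) : valY hν j s =
    psi ν j s + Psi ν j s (Res hν s ((s : ℂ) • kap (fC hν) (g ν) (s * 1) s)) := by
  rw [valY, solP, mul_one, map_smul, map_smul, smul_eq_mul]
  rfl

lemma hasDerivAt_valY_aux {j : ℕ} {s : ℝ} (hs : 0 < s) (h0 : detM hν s ≠ 0) {d : ℂ} {D : E →L[ℂ] ℂ}
    (hd : HasDerivAt (psi ν j) ((s : ℂ)⁻¹ * d) s) (hD : HasDerivAt (Psi ν j) ((s : ℂ)⁻¹ • D) s) :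
    HasDerivAt (valY hν j) ((s : ℂ)⁻¹ * (d +
      D (Res hν s ((s : ℂ) • kap (fC hν) (g ν) (s * 1) s)) +
        (-1) ^ (M + 1) * pairing hν 0 j s * valY hν M s)) s := by
  have hs' : (s : ℂ) ≠ 0 := by exact_mod_cast hs.ne'
  have h1 := hd.add (hasDerivAt_clm_apply hD (hasDerivAt_clm_apply (hasDerivAt_Res hν hs h0)
    (hasDerivAt_smul_kap (a := fC hν) (isSingular_g hν) hs one_pos)))
  have h2 := h1.congr_of_eventuallyEq (Eventually.of_forall (valY_eq hν j))
  refine h2.congr_deriv ?_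
  rw [valY_eq hν M, mul_apply_eq_comp, mul_apply_eq_comp, rankOne_apply hν hs, dil_fC,
    psi_last hν hs, mul_one, pairing, smul_apply]
  simp only [map_add, map_smul, smul_eq_mul]
  field_simp
  ring

lemma hasDerivAt_valY {j : ℕ} (hj1 : 1 ≤ j) (hj : j ≤ M) {s : ℝ} (hs : 0 < s)
    (h0 : detM hν s ≠ 0) :
    HasDerivAt (valY hν j) ((s : ℂ)⁻¹ * (valY hν (j - 1) s -
      ((-1) ^ M * pairing hν 0 j s + eps ν j) * valY hν M s)) s := by
  have hd := hasDerivAt_psi hν hj hs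
  rw [thetaPsi, if_neg (by omega)] at hd
  refine (hasDerivAt_valY_aux hν hs h0 hd (hasDerivAt_Psi hν hj1 hj hs)).congr_deriv ?_
  rw [sub_apply, smul_apply, smul_eq_mul, valY_eq hν (j - 1), valY_eq hν M, pow_succ]
  ring

/-- The derivative of Ψ_0 is a multiple of Ψ_M X. Moving X past R, and then applying it to the
column κ at y = s where X κ = κ + Σ ψ_j(s) Φ_j, gives two sums whose terms combine to the values of
(1 - K')⁻¹ ψ_j at s. -/
lemma hasDerivAt_valY_zero {s : ℝ} (hs : 0 < s) (h0 : detM hν s ≠ 0) :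
    HasDerivAt (valY hν 0) ((s : ℂ)⁻¹ * ((-1) ^ M * s * valY hν M s +
      ∑ i ∈ Finset.range (M + 1), (-1) ^ M * pairing hν i M s * valY hν i s -
      (-1) ^ M * pairing hν 0 0 s * valY hν M s)) s := by
  have hd := hasDerivAt_psi hν M.zero_le hs
  rw [thetaPsi, if_pos rfl] at hd
  refine (hasDerivAt_valY_aux hν hs h0 hd (hasDerivAt_Psi_zero hν hs)).congr_deriv ?_
  set κ : E := (s : ℂ) • kap (fC hν) (g ν) (s * 1) s with hκ
  have h1 : mulX κ = κ + ∑ j ∈ Finset.range (M + 1), psi ν j s • Phi hν j s := by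
    rw [← smul_mulX_kap_sub hν hs hs, hκ, map_smul, mul_one]
    abel
  have h2 : Psi ν M s (mulX (Res hν s κ)) = Psi ν M s (Res hν s κ) +
      ∑ j ∈ Finset.range (M + 1), Psi ν M s (Res hν s (Phi hν j s)) * valY hν j s := by
    rw [res_mulX hν hs h0, h1, map_add, map_sum, map_add, map_add, map_sum, map_sum, add_assoc,
      ← Finset.sum_add_distrib]
    congr 1
    refine Finset.sum_congr rfl fun j _ => ?_
    rw [map_smul, map_smul, map_smul, smul_eq_mul, smul_eq_mul, valY_eq hν j, ← hκ]
    ring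
  have h3 : ∑ j ∈ Finset.range (M + 1), (-1) ^ M * pairing hν j M s * valY hν j s =
      (-1) ^ M * (s : ℂ) *
        ∑ j ∈ Finset.range (M + 1), Psi ν M s (Res hν s (Phi hν j s)) * valY hν j s := by
    rw [Finset.mul_sum]
    refine Finset.sum_congr rfl fun j _ => ?_
    rw [pairing]
    ring
  rw [smul_apply, ContinuousLinearMap.comp_apply, h2, h3, smul_eq_mul, valY_eq hν M, ← hκ, pow_succ]
  ring

lemma hasDerivAt_pairing_phi_psi {i j : ℕ} (hj : j ≤ M) {s : ℝ} (hs : 0 < s)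
    (h0 : detM hν s ≠ 0) :
    HasDerivAt (pairing hν i j) (valX hν i s * valY hν j s) s :=
  hasDerivAt_pairing (isSingular_g hν) (isSingular_psi hν hj) hs h0

lemma hasDerivAt_detM {s : ℝ} (hs : 0 < s) (h0 : detM hν s ≠ 0) :
    HasDerivAt (detM hν) ((s : ℂ)⁻¹ * ((-1) ^ M * pairing hν 0 M s * detM hν s)) s := by
  have hs' : (s : ℂ) ≠ 0 := by exact_mod_cast hs.ne'
  refine (hasDerivAt_detK (isSingular_g hν) hs h0).congr_deriv ?_
  rw [dualDil_g hν hs, dil_fC, map_smul, map_smul, smul_eq_mul, pairing, pow_succ]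
  field_simp
  exact mul_comm _ _

end

section

/-! ### The Fredholm determinant and the resolvents on the half line -/

variable {M : ℕ} {ν : Fin (M + 1) → ℕ} (hν : ν 0 = 0)

lemma K_eq_kfun {x y : ℝ} (hx : 0 < x) (hy : 0 < y) : K ν x y = kfun (fC hν) (g ν) x y := by
  rw [K_eq_integral hν hx hy, kfun_eq (isSingular_g hν) hx.le hy]

/-- Indicators allow the dilation t ↦ st on all of ℝ^n. If some t_j ≥ 1, the cutoff makes the j-th
column zero, so the integral over the orthant reduces to the unit cube; s^n comes from the n rows.
-/
lemma indicator_fredholmIntegrand_smul {s : ℝ} (hs : 0 < s) (n : ℕ) (t : Fin n → ℝ) :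
    (univ.pi fun _ : Fin n => Ioi (0 : ℝ)).indicator (fredholmIntegrand (KJ ν s) n) (s • t) =
      ((s : ℂ) ^ n)⁻¹ * (univ.pi fun _ : Fin n => Ioo (0 : ℝ) 1).indicator
        (fdet (kern (fC hν) (g ν) s)) t := by
  have hs' : (s : ℂ) ^ n ≠ 0 := pow_ne_zero _ (by exact_mod_cast hs.ne')
  by_cases h0 : ∀ i, 0 < t i
  · have hmem : s • t ∈ univ.pi fun _ : Fin n => Ioi (0 : ℝ) := fun i _ => mul_pos hs (h0 i)
    rw [indicator_of_mem hmem]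
    by_cases h1 : ∀ i, t i < 1
    · have hmem' : t ∈ univ.pi fun _ : Fin n => Ioo (0 : ℝ) 1 := fun i _ => ⟨h0 i, h1 i⟩
      rw [indicator_of_mem hmem', eq_inv_mul_iff_mul_eq₀ hs', fredholmIntegrand, fdet]
      have h2 := Matrix.det_smul (Matrix.of fun i j => KJ ν s ((s • t) i) ((s • t) j)) (s : ℂ)
      rw [Fintype.card_fin] at h2
      rw [← h2]
      congr 1
      ext i j
      have hj : s * t j ∈ Ioo 0 s := ⟨mul_pos hs (h0 j), mul_lt_of_lt_one_right hs (h1 j)⟩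
      have hti : t i ∈ Ioo (0 : ℝ) 1 := ⟨h0 i, h1 i⟩
      have htj : t j ∈ Ioo (0 : ℝ) 1 := ⟨h0 j, h1 j⟩
      have h3 : ext ((s : ℂ) • kap (fC hν) (g ν) (s * t j) s) (t i) =
        s * ext (kap (fC hν) (g ν) (s * t j) s) (t i) := rfl
      simp only [Matrix.smul_apply, Matrix.of_apply, Pi.smul_apply, smul_eq_mul, KJ,
        indicator_of_mem hj, Pi.one_apply, mul_one, kern, indicator_of_mem htj]
      rw [h3, ext_kap (isSingular_g hν) (mul_pos hs (h0 j)) hs.le hti,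
        K_eq_kfun hν (mul_pos hs (h0 i)) (mul_pos hs (h0 j))]
    · push Not at h1
      obtain ⟨j, hj⟩ := h1
      have hmem' : t ∉ univ.pi fun _ : Fin n => Ioo (0 : ℝ) 1 := fun h =>
        absurd (h j (mem_univ j)).2 (not_lt.2 hj)
      rw [indicator_of_notMem hmem', mul_zero, fredholmIntegrand]
      refine Matrix.det_eq_zero_of_column_eq_zero j fun i => ?_
      have hj' : s * t j ∉ Ioo 0 s := fun h =>
        absurd h.2 (not_lt.2 (le_mul_of_one_le_right hs.le hj))
      simp only [Matrix.of_apply, Pi.smul_apply, smul_eq_mul, KJ, indicator_of_notMem hj', mul_zero]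
  · push Not at h0
    obtain ⟨i, hi⟩ := h0
    have hmem : s • t ∉ univ.pi fun _ : Fin n => Ioi (0 : ℝ) := fun h =>
      absurd (h i (mem_univ i)) (not_lt.2 (mul_nonpos_of_nonneg_of_nonpos hs.le hi))
    have hmem' : t ∉ univ.pi fun _ : Fin n => Ioo (0 : ℝ) 1 := fun h =>
      absurd (h i (mem_univ i)).1 (not_lt.2 hi)
    rw [indicator_of_notMem hmem, indicator_of_notMem hmem', mul_zero]

lemma pi_unitMeasure (n : ℕ) : (Measure.pi fun _ : Fin n => unitMeasure) =
    (volume : Measure (Fin n → ℝ)).restrict (univ.pi fun _ => Ioo (0 : ℝ) 1) := by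
  rw [volume_pi, Measure.restrict_pi_pi]

lemma measurableSet_pi_Ioo (n : ℕ) :
    MeasurableSet (univ.pi fun _ : Fin n => Ioo (0 : ℝ) 1) :=
  MeasurableSet.univ_pi fun _ => measurableSet_Ioo

lemma measurableSet_pi_Ioi (n : ℕ) :
    MeasurableSet (univ.pi fun _ : Fin n => Ioi (0 : ℝ)) :=
  MeasurableSet.univ_pi fun _ => measurableSet_Ioi

lemma integrableOn_fredholmIntegrand (hν : ν 0 = 0) {s : ℝ} (hs : 0 < s) (n : ℕ) :
    IntegrableOn (fredholmIntegrand (KJ ν s) n) (univ.pi fun _ : Fin n => Ioi (0 : ℝ)) := by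
  obtain ⟨C, -, hC⟩ := exists_isFredholmKernel (a := fC hν) (isSingular_g hν) s
  have h1 := (hC s hs le_rfl).integrable_fdet n
  rw [pi_unitMeasure] at h1
  rw [← integrable_indicator_iff (measurableSet_pi_Ioi n), ← integrable_comp_smul_iff volume _ hs.ne']
  simp only [indicator_fredholmIntegrand_smul hν hs]
  exact ((integrable_indicator_iff (measurableSet_pi_Ioo n)).2 h1).const_mul _

lemma fredholmTerm_eq {s : ℝ} (hs : 0 < s) (n : ℕ) :
    fredholmTerm (KJ ν s) n = fTerm unitMeasure (kern (fC hν) (g ν) s) n := by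
  have hs' : (s : ℂ) ^ n ≠ 0 := pow_ne_zero _ (by exact_mod_cast hs.ne')
  rw [fredholmTerm, fTerm, fInt, pi_unitMeasure, ← integral_indicator (measurableSet_pi_Ioi n),
    ← integral_indicator (measurableSet_pi_Ioo n)]
  congr 1
  have h1 := Measure.integral_comp_smul (volume : Measure (Fin n → ℝ))
    ((univ.pi fun _ : Fin n => Ioi (0 : ℝ)).indicator (fredholmIntegrand (KJ ν s) n)) s
  simp only [indicator_fredholmIntegrand_smul hν hs, integral_const_mul] at h1
  rw [Module.finrank_fin_fun, abs_of_pos (by positivity), Complex.real_smul] at h1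
  push_cast at h1
  exact (mul_left_cancel₀ (inv_ne_zero hs') h1).symm

lemma F_eq_detM {s : ℝ} (hs : 0 < s) : F ν s = detM hν s :=
  tsum_congr (fredholmTerm_eq hν hs)

lemma fredholmDetExists (hν : ν 0 = 0) {s : ℝ} (hs : 0 < s) : FredholmDetExists (KJ ν s) := by
  refine ⟨integrableOn_fredholmIntegrand hν hs, ?_⟩
  obtain ⟨C, -, hC⟩ := exists_isFredholmKernel (a := fC hν) (isSingular_g hν) s
  exact (hC s hs le_rfl).summable_fTerm.congr fun n => (fredholmTerm_eq hν hs n).symm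

lemma integral_KJ (s : ℝ) {x : ℝ} (hx : 0 < x) (u : ℝ → ℂ) :
    ∫ y in Ioi (0 : ℝ), KJ ν s x y * u y = ∫ y in Ioo 0 s, kfun (fC hν) (g ν) x y * u y := by
  have h1 : ∀ y, KJ ν s x y * u y = (Ioo 0 s).indicator (fun y => K ν x y * u y) y := fun y => by
    by_cases hy : y ∈ Ioo 0 s <;> simp [KJ, hy]
  simp only [h1]
  rw [setIntegral_indicator measurableSet_Ioo, inter_eq_right.2 fun y hy => hy.1]
  refine setIntegral_congr_fun measurableSet_Ioo fun y hy => ?_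
  simp only [K_eq_kfun hν hx hy.1]

lemma integral_KJ' (s : ℝ) {x : ℝ} (hx : 0 < x) (u : ℝ → ℂ) :
    ∫ y in Ioi (0 : ℝ), KJ' ν s x y * u y = ∫ y in Ioo 0 s, kfun (fC hν) (g ν) y x * u y := by
  have h1 : ∀ y, KJ' ν s x y * u y = (Ioo 0 s).indicator (fun y => K ν y x * u y) y := fun y => by
    by_cases hy : y ∈ Ioo 0 s <;> simp [KJ', hy]
  simp only [h1]
  rw [setIntegral_indicator measurableSet_Ioo, inter_eq_right.2 fun y hy => hy.1]
  refine setIntegral_congr_fun measurableSet_Ioo fun y hy => ?_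
  simp only [K_eq_kfun hν hy.1 hx]

lemma isSingular_kfun {a : C(ℝ, ℂ)} {b : ℝ → ℂ} (hb : IsSingular b) {x : ℝ} (hx : 0 < x) :
    IsSingular (kfun a b x) := by
  refine ⟨fun y hy => ?_, fun A => ?_⟩
  · exact (ContinuousAt.comp (f := fun y : ℝ => (x, y)) (continuousAt_kfun hb hx hy)
      (by fun_prop)).continuousWithinAt
  · obtain ⟨C, h0, hC⟩ := exists_norm_kfun_le (a := a) hb (max A x)
    exact ⟨C, h0, fun y hy hyA => hC x hx (le_max_right _ _) y hy (hyA.trans (le_max_left _ _))⟩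

lemma memLp_kfun_left {a : C(ℝ, ℂ)} {b : ℝ → ℂ} (hb : IsSingular b) {x : ℝ} (hx : 0 < x) (s : ℝ) :
    MemLp (fun y => kfun a b y x) 2 (volume.restrict (Ioo 0 s)) := by
  obtain ⟨C, -, hC⟩ := exists_norm_kfun_le (a := a) hb (max s x)
  refine MemLp.of_bound ?_ (C * x ^ (-1 / 4 : ℝ)) ?_
  · refine ContinuousOn.aestronglyMeasurable (fun y hy => ?_) measurableSet_Ioo
    exact (ContinuousAt.comp (f := fun y : ℝ => (y, x)) (continuousAt_kfun hb hy.1 hx)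
      (by fun_prop)).continuousWithinAt
  · refine (ae_restrict_mem measurableSet_Ioo).mono fun y hy => ?_
    exact hC y hy.1 (hy.2.le.trans (le_max_left _ _)) x hx (le_max_right _ _)

lemma isResolventSol_KJ {p : C(ℝ, ℂ)} {h : ℝ → ℂ} (hp : ∀ x, 0 < x → p x = h x) {s : ℝ}
    (hs : 0 < s) (h0 : detM hν s ≠ 0) :
    IsResolventSol (KJ ν s) s h (solQ (fC hν) (g ν) p s) := by
  refine ⟨(isSingular_solQ (isSingular_g hν) p hs).memLp hs.le, fun x hx => ?_⟩
  rw [integral_KJ hν s hx, solQ_eq (isSingular_g hν) hs h0, hp x hx]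

lemma isResolventSol_KJ' {h : ℝ → ℂ} (hh : IsSingular h) {s : ℝ}
    (hs : 0 < s) (h0 : detM hν s ≠ 0) :
    IsResolventSol (KJ' ν s) s h (solP (fC hν) (g ν) h s) := by
  refine ⟨(isSingular_solP (isSingular_g hν) hh hs).memLp hs.le, fun x hx => ?_⟩
  rw [integral_KJ' hν s hx, solP_eq (isSingular_g hν) hh hs h0 hx]

lemma IsResolventSol.eqOn_KJ {h u u' : ℝ → ℂ} {s : ℝ} (hs : 0 < s) (h0 : detM hν s ≠ 0)
    (hu : IsResolventSol (KJ ν s) s h u) (hu' : IsResolventSol (KJ ν s) s h u') :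
    EqOn u u' (Ioi 0) := by
  intro x hx
  rw [← sub_eq_zero]
  refine eq_zero_of_eq_integral (a := fC hν) (isSingular_g hν) hs h0 (u := fun x => u x - u' x)
    (hu.1.sub hu'.1) (fun x hx => ?_) hx
  have h1 := hu.2 x hx
  rw [← hu'.2 x hx, integral_KJ hν s hx, integral_KJ hν s hx, sub_eq_sub_iff_sub_eq_sub] at h1
  have hm := (isSingular_kfun (a := fC hν) (isSingular_g hν) hx).memLp hs.le
  have h2 := integral_sub (hm.integrable_mul hu.1) (hm.integrable_mul hu'.1)
  simp only [Pi.mul_apply] at h2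
  rw [h1, ← h2]
  simp only [mul_sub]

lemma IsResolventSol.eqOn_KJ' {h u u' : ℝ → ℂ} {s : ℝ} (hs : 0 < s) (h0 : detM hν s ≠ 0)
    (hu : IsResolventSol (KJ' ν s) s h u) (hu' : IsResolventSol (KJ' ν s) s h u') :
    EqOn u u' (Ioi 0) := by
  intro x hx
  rw [← sub_eq_zero]
  refine eq_zero_of_eq_integral_transpose (a := fC hν) (isSingular_g hν) hs h0
    (u := fun x => u x - u' x) (hu.1.sub hu'.1) (fun x hx => ?_) hx
  have h1 := hu.2 x hx
  rw [← hu'.2 x hx, integral_KJ' hν s hx, integral_KJ' hν s hx, sub_eq_sub_iff_sub_eq_sub] at h1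
  have hm := memLp_kfun_left (a := fC hν) (isSingular_g hν) hx s
  have h2 := integral_sub (hm.integrable_mul hu.1) (hm.integrable_mul hu'.1)
  simp only [Pi.mul_apply] at h2
  rw [h1, ← h2]
  simp only [mul_sub]

lemma isResolventSol_Q (j : ℕ) {s : ℝ} (hs : 0 < s) (h0 : detM hν s ≠ 0) :
    IsResolventSol (KJ ν s) s (phi ν j) (Q ν j s) :=
  Classical.epsilon_spec ⟨_, isResolventSol_KJ hν (fun _ hx => phiC_apply hν j hx) hs h0⟩

lemma isResolventSol_P {j : ℕ} (hj : j ≤ M) {s : ℝ} (hs : 0 < s) (h0 : detM hν s ≠ 0) :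
    IsResolventSol (KJ' ν s) s (psi ν j) (P ν j s) :=
  Classical.epsilon_spec ⟨_, isResolventSol_KJ' hν (isSingular_psi hν hj) hs h0⟩

lemma Q_eq (j : ℕ) {s : ℝ} (hs : 0 < s) (h0 : detM hν s ≠ 0) :
    EqOn (Q ν j s) (solQ (fC hν) (g ν) (phiC hν j) s) (Ioi 0) :=
  (isResolventSol_Q hν j hs h0).eqOn_KJ hν hs h0
    (isResolventSol_KJ hν (fun _ hx => phiC_apply hν j hx) hs h0)

lemma P_eq {j : ℕ} (hj : j ≤ M) {s : ℝ} (hs : 0 < s) (h0 : detM hν s ≠ 0) :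
    EqOn (P ν j s) (solP (fC hν) (g ν) (psi ν j) s) (Ioi 0) :=
  (isResolventSol_P hν hj hs h0).eqOn_KJ' hν hs h0
    (isResolventSol_KJ' hν (isSingular_psi hν hj) hs h0)

lemma valX_eq_solQ (j : ℕ) {s : ℝ} (hs : 0 < s) (h0 : detM hν s ≠ 0) :
    valX hν j s = solQ (fC hν) (g ν) (phiC hν j) s s := by
  have := solQ_mul (a := fC hν) (p := phiC hν j) (isSingular_g hν) hs h0 (v := 1) (by simp)
  rw [mul_one, ext_of_mem _ (by simp)] at this
  rw [this]
  rfl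

lemma tendsto_Q (j : ℕ) {s : ℝ} (hs : 0 < s) (h0 : detM hν s ≠ 0) :
    Tendsto (Q ν j s) (𝓝[Ioo 0 s] s) (𝓝 (valX hν j s)) := by
  rw [valX_eq_solQ hν j hs h0]
  have h1 := (continuousOn_solQ (a := fC hν) (isSingular_g hν) (phiC hν j) hs).continuousAt
    (Ioi_mem_nhds hs)
  refine (h1.tendsto.mono_left nhdsWithin_le_nhds).congr' ?_
  filter_upwards [self_mem_nhdsWithin] with x hx using (Q_eq hν j hs h0 hx.1).symm

lemma tendsto_P {j : ℕ} (hj : j ≤ M) {s : ℝ} (hs : 0 < s) (h0 : detM hν s ≠ 0) :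
    Tendsto (P ν j s) (𝓝[Ioo 0 s] s) (𝓝 (valY hν j s)) := by
  have h1 := (isSingular_solP (a := fC hν) (isSingular_g hν) (isSingular_psi hν hj) hs).cont.continuousAt
    (Ioi_mem_nhds hs)
  refine (h1.tendsto.mono_left nhdsWithin_le_nhds).congr' ?_
  filter_upwards [self_mem_nhdsWithin] with x hx using (P_eq hν hj hs h0 hx.1).symm

lemma xf_eq (j : ℕ) {s : ℝ} (hs : 0 < s) (h0 : detM hν s ≠ 0) :
    xf ν j s = Complex.I * valX hν j s := by
  have := right_nhdsWithin_Ioo_neBot hs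
  rw [xf, (tendsto_Q hν j hs h0).limUnder_eq]

lemma yf_eq {j : ℕ} (hj : j ≤ M) {s : ℝ} (hs : 0 < s) (h0 : detM hν s ≠ 0) :
    yf ν j s = Complex.I * valY hν j s := by
  have := right_nhdsWithin_Ioo_neBot hs
  rw [yf, (tendsto_P hν hj hs h0).limUnder_eq]

lemma integral_phi_mul_P (i : ℕ) {j : ℕ} (hj : j ≤ M) {s : ℝ} (hs : 0 < s) (h0 : detM hν s ≠ 0) :
    ∫ x in Ioo 0 s, phi ν i x * P ν j s x = pairing hν i j s := by
  rw [pairing, Psi, Res, Phi, ← integral_mul_solP (isSingular_g hν) (isSingular_psi hν hj) hs h0]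
  refine setIntegral_congr_fun measurableSet_Ioo fun x hx => ?_
  simp only [P_eq hν hj hs h0 hx.1, phiC_apply hν i hx.1]

lemma integrableOn_phi_mul_P (i : ℕ) {j : ℕ} (hj : j ≤ M) {s : ℝ} (hs : 0 < s)
    (h0 : detM hν s ≠ 0) : IntegrableOn (fun x => phi ν i x * P ν j s x) (Ioo 0 s) := by
  refine IntegrableOn.congr_fun (((isSingular_solP (a := fC hν) (isSingular_g hν)
    (isSingular_psi hν hj) hs).mul_continuous (phiC hν i).continuous).integrableOn hs.le)
    (fun x hx => ?_) measurableSet_Ioo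
  simp only [P_eq hν hj hs h0 hx.1, phiC_apply hν i hx.1]

lemma xi_eq {j : ℕ} (hj : j ≤ M) {s : ℝ} (hs : 0 < s) (h0 : detM hν s ≠ 0) :
    xi ν j s = (-1) ^ M * pairing hν 0 j s + eps ν j := by
  rw [xi, integral_phi_mul_P hν 0 hj hs h0, eps]

lemma eta_eq (j : ℕ) {s : ℝ} (hs : 0 < s) (h0 : detM hν s ≠ 0) :
    eta ν j s = (-1) ^ M * pairing hν j M s := by
  rw [eta, integral_phi_mul_P hν j le_rfl hs h0]

lemma wellDefinedAt (hν : ν 0 = 0) {s : ℝ} (hs : 0 < s) (h0 : detM hν s ≠ 0) : WellDefinedAt ν s :=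
    by
  intro j hj
  refine ⟨⟨isResolventSol_Q hν j hs h0, fun u hu => ?_, _, tendsto_Q hν j hs h0⟩,
    ⟨isResolventSol_P hν hj hs h0, fun u hu => ?_, _, tendsto_P hν hj hs h0⟩,
    integrableOn_phi_mul_P hν 0 hj hs h0, integrableOn_phi_mul_P hν j le_rfl hs h0⟩
  · exact hu.eqOn_KJ hν hs h0 (isResolventSol_Q hν j hs h0)
  · exact hu.eqOn_KJ' hν hs h0 (isResolventSol_P hν hj hs h0)

lemma eventually_detM_ne_zero {s : ℝ} (hs : 0 < s) (h0 : detM hν s ≠ 0) :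
    ∀ᶠ t in 𝓝 s, 0 < t ∧ detM hν t ≠ 0 :=
  (lt_mem_nhds hs).and ((hasDerivAt_detM hν hs h0).continuousAt.eventually_ne h0)

/-- Nonvanishing of the determinant is an open condition, so the formulas for x_j, y_j, ξ_j, η_j
hold near s and may be differentiated. The two factors √-1 in x_i y_j multiply to -1, which turns
(-1)^M into (-1)^{M+1}. -/
lemma satisfiesODE (hν : ν 0 = 0) {s : ℝ} (hs : 0 < s) (h0 : detM hν s ≠ 0) :
    SatisfiesODE M (xf ν) (yf ν) (xi ν) (eta ν) s := by
  have hs' : (s : ℂ) ≠ 0 := by exact_mod_cast hs.ne'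
  have hI : Complex.I * Complex.I = -1 := Complex.I_mul_I
  have hnear := eventually_detM_ne_zero hν hs h0
  have hx : ∀ {j : ℕ} {d : ℂ}, HasDerivAt (valX hν j) d s → HasDerivAt (xf ν j) (Complex.I * d) s :=
    fun {j d} h => (h.const_mul Complex.I).congr_of_eventuallyEq
      (hnear.mono fun t ht => xf_eq hν j ht.1 ht.2)
  have hy : ∀ {j : ℕ} {d : ℂ}, j ≤ M → HasDerivAt (valY hν j) d s →
      HasDerivAt (yf ν j) (Complex.I * d) s :=
    fun {j d} hj h => (h.const_mul Complex.I).congr_of_eventuallyEq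
      (hnear.mono fun t ht => yf_eq hν hj ht.1 ht.2)
  have hxi : ∀ j ≤ M, HasDerivAt (xi ν j) ((-1) ^ M * (valX hν 0 s * valY hν j s)) s := fun j hj =>
    (((hasDerivAt_pairing_phi_psi hν hj hs h0).const_mul _).add_const (eps ν j)).congr_of_eventuallyEq
      (hnear.mono fun t ht => xi_eq hν hj ht.1 ht.2)
  have heta : ∀ j, HasDerivAt (eta ν j) ((-1) ^ M * (valX hν j s * valY hν M s)) s := fun j =>
    ((hasDerivAt_pairing_phi_psi hν le_rfl hs h0).const_mul _).congr_of_eventuallyEq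
      (hnear.mono fun t ht => eta_eq hν j ht.1 ht.2)
  have hX : ∀ j, xf ν j s = Complex.I * valX hν j s := fun j => xf_eq hν j hs h0
  have hY : ∀ j ≤ M, yf ν j s = Complex.I * valY hν j s := fun j hj => yf_eq hν hj hs h0
  refine ⟨fun j hj => ⟨?_, ?_, (hxi j hj).differentiableAt, (heta j).differentiableAt⟩, ?_, ?_, ?_,
    ?_, ?_, ?_⟩
  · rcases hj.lt_or_eq with hj' | rfl
    · exact (hx (hasDerivAt_valX hν hj' hs h0)).differentiableAt
    · exact (hx (hasDerivAt_valX_last hν hs h0)).differentiableAt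
  · rcases Nat.eq_zero_or_pos j with rfl | hj'
    · exact (hy hj (hasDerivAt_valY_zero hν hs h0)).differentiableAt
    · exact (hy hj (hasDerivAt_valY hν hj' hj hs h0)).differentiableAt
  · intro j hj
    rw [(hx (hasDerivAt_valX hν hj hs h0)).deriv, hX, hX, eta_eq hν j hs h0, pow_succ]
    field_simp
  · rw [(hx (hasDerivAt_valX_last hν hs h0)).deriv, hX, eta_eq hν M hs h0]
    have h1 : ∑ i ∈ Finset.range (M + 1), xi ν i s * xf ν i s = Complex.I *
        ∑ i ∈ Finset.range (M + 1), ((-1) ^ M * pairing hν 0 i s + eps ν i) * valX hν i s := by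
      rw [Finset.mul_sum]
      refine Finset.sum_congr rfl fun i hi => ?_
      rw [hX, xi_eq hν (by simpa [Nat.lt_succ_iff] using hi) hs h0]
      ring
    rw [h1, pow_succ]
    field_simp
  · intro j hj1 hj
    rw [(hy hj (hasDerivAt_valY hν hj1 hj hs h0)).deriv, hY _ le_rfl, hY _ (by omega),
      xi_eq hν hj hs h0]
    field_simp
    ring
  · rw [(hy M.zero_le (hasDerivAt_valY_zero hν hs h0)).deriv, hY _ le_rfl,
      xi_eq hν M.zero_le hs h0, eps_zero hν]
    have h1 : ∑ i ∈ Finset.range (M + 1), eta ν i s * yf ν i s = Complex.I *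
        ∑ i ∈ Finset.range (M + 1), (-1) ^ M * pairing hν i M s * valY hν i s := by
      rw [Finset.mul_sum]
      refine Finset.sum_congr rfl fun i hi => ?_
      rw [hY i (by simpa [Nat.lt_succ_iff] using hi), eta_eq hν i hs h0]
      ring
    rw [h1]
    field_simp
    ring
  · intro j hj
    rw [(hxi j hj).deriv, hX, hY j hj, pow_succ]
    linear_combination ((-1) ^ M * valX hν 0 s * valY hν j s) * hI
  · intro j hj
    rw [(heta j).deriv, hX, hY M le_rfl, pow_succ]
    linear_combination ((-1) ^ M * valX hν j s * valY hν M s) * hI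

end

section

/-! ### Initial conditions -/

variable {M : ℕ} {ν : Fin (M + 1) → ℕ} (hν : ν 0 = 0)

lemma eventually_detM : ∀ᶠ s : ℝ in 𝓝[>] 0, (0 < s ∧ s ≤ 1) ∧ detM hν s ≠ 0 ∧ ‖Res hν s‖ ≤ 2 := by
  have h1 : ∀ᶠ s : ℝ in 𝓝[>] 0, s ∈ Ioo (0 : ℝ) 1 := Ioo_mem_nhdsGT one_pos
  have h2 : ∀ᶠ s : ℝ in 𝓝[>] 0, detM hν s ≠ 0 :=
    (tendsto_detK (a := fC hν) (isSingular_g hν)).eventually_ne one_ne_zero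
  have h3 : ∀ᶠ s : ℝ in 𝓝[>] 0, ‖Res hν s‖ < 2 := by
    refine (tendsto_res (a := fC hν) (isSingular_g hν)).norm.eventually_lt_const ?_
    exact lt_of_le_of_lt ContinuousLinearMap.norm_id_le one_lt_two
  filter_upwards [h1, h2, h3] with s hs hs2 hs3
  exact ⟨⟨hs.1, hs.2.le⟩, hs2, hs3.le⟩

lemma tendsto_phi_phiC (j : ℕ) : Tendsto (phi ν j) (𝓝[>] 0) (𝓝 (phiC hν j 0)) := by
  refine (((phiC hν j).continuous.tendsto 0).mono_left nhdsWithin_le_nhds).congr' ?_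
  filter_upwards [self_mem_nhdsWithin] with x hx using phiC_apply hν j hx

lemma tendsto_valX (j : ℕ) : Tendsto (valX hν j) (𝓝[>] 0) (𝓝 (phiC hν j 0)) := by
  have h1 : Tendsto (Phi hν j) (𝓝[>] 0) (𝓝 (dil (phiC hν j) 0)) :=
    ((continuous_dil (phiC hν j)).tendsto 0).mono_left nhdsWithin_le_nhds
  have h2 := ((isBoundedBilinearMap_apply (𝕜 := ℂ) (E := E) (F := E)).continuous.tendsto
    (1, dil (phiC hν j) 0)).comp ((tendsto_res (a := fC hν) (isSingular_g hν)).prodMk_nhds h1)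
  have h3 := ((evalE 1).continuous.tendsto _).comp h2
  simp only [one_apply_eq_self, evalE_apply, dil_apply, zero_mul] at h3
  exact h3

lemma exists_norm_Psi_res_le {j : ℕ} (hj : j ≤ M) : ∃ C, 0 ≤ C ∧ ∀ᶠ s : ℝ in 𝓝[>] 0, ∀ e : E,
    ‖(s : ℂ) * Psi ν j s (Res hν s e)‖ ≤ C * s ^ (3 / 4 : ℝ) * ‖e‖ := by
  obtain ⟨C, h0, hC⟩ := (isSingular_psi hν hj).norm_dual_dil_le 1
  refine ⟨C * 2, by positivity, ?_⟩
  filter_upwards [eventually_detM hν] with s hs e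
  have h1 : ‖Psi ν j s‖ ≤ C * s ^ (-1 / 4 : ℝ) := hC s hs.1.1 hs.1.2
  rw [norm_mul, Complex.norm_real, Real.norm_of_nonneg hs.1.1.le]
  calc s * ‖Psi ν j s (Res hν s e)‖ ≤ s * ((C * s ^ (-1 / 4 : ℝ)) * (2 * ‖e‖)) := by
        refine mul_le_mul_of_nonneg_left ?_ hs.1.1.le
        exact ((Psi ν j s).le_of_opNorm_le h1 _).trans (mul_le_mul_of_nonneg_left
          ((Res hν s).le_of_opNorm_le hs.2.2 e) ((norm_nonneg _).trans h1))
    _ = C * 2 * s ^ (3 / 4 : ℝ) * ‖e‖ := by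
        rw [show (3 / 4 : ℝ) = 1 + -1 / 4 by norm_num, Real.rpow_add hs.1.1, Real.rpow_one]
        ring

lemma exists_norm_pairing_le (i : ℕ) {j : ℕ} (hj : j ≤ M) : ∃ C, 0 ≤ C ∧ ∀ᶠ s : ℝ in 𝓝[>] 0,
    ‖pairing hν i j s‖ ≤ C * s ^ (3 / 4 : ℝ) := by
  obtain ⟨C, h0, hC⟩ := exists_norm_Psi_res_le hν hj
  obtain ⟨C', h0', hC'⟩ := exists_norm_dil_le (phiC hν i) 1
  refine ⟨C * C', by positivity, ?_⟩
  filter_upwards [hC, eventually_detM hν] with s hs hs'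
  have := Real.rpow_nonneg hs'.1.1.le (3 / 4)
  calc _ ≤ C * s ^ (3 / 4 : ℝ) * ‖Phi hν i s‖ := hs _
    _ ≤ C * s ^ (3 / 4 : ℝ) * C' := by
        gcongr
        exact hC' s hs'.1.1.le hs'.1.2
    _ = _ := by ring

lemma tendsto_pairing (i : ℕ) {j : ℕ} (hj : j ≤ M) : Tendsto (pairing hν i j) (𝓝[>] 0) (𝓝 0) := by
  obtain ⟨C, -, hC⟩ := exists_norm_pairing_le hν i hj
  exact squeeze_zero_norm' hC (tendsto_mul_rpow_zero C (by norm_num))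

/-- The exponent is 3/4 - 1/4: s^{3/4} from s times the functional Ψ_j, and s^{-1/4} from the column
of the kernel. Thus the correction vanishes even where ψ_j itself is unbounded. -/
lemma exists_norm_valY_sub_le {j : ℕ} (hj : j ≤ M) : ∃ C, 0 ≤ C ∧ ∀ᶠ s : ℝ in 𝓝[>] 0,
    ‖valY hν j s - psi ν j s‖ ≤ C * s ^ (1 / 2 : ℝ) := by
  obtain ⟨C, h0, hC⟩ := exists_norm_Psi_res_le hν hj
  obtain ⟨C', h0', hC'⟩ := exists_norm_kap_le (a := fC hν) (isSingular_g hν) 1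
  refine ⟨C * C', by positivity, ?_⟩
  filter_upwards [hC, eventually_detM hν] with s hs hs'
  have := Real.rpow_nonneg hs'.1.1.le (3 / 4)
  rw [valY, solP, add_sub_cancel_left]
  calc _ ≤ C * s ^ (3 / 4 : ℝ) * ‖kap (fC hν) (g ν) s s‖ := hs _
    _ ≤ C * s ^ (3 / 4 : ℝ) * (C' * s ^ (-1 / 4 : ℝ)) := by
        gcongr
        exact hC' s hs'.1.1 hs'.1.2 s hs'.1.1.le hs'.1.2
    _ = _ := by
        rw [show (1 / 2 : ℝ) = 3 / 4 + -1 / 4 by norm_num, Real.rpow_add hs'.1.1]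
        ring

lemma tendsto_valY_sub {j : ℕ} (hj : j ≤ M) :
    Tendsto (fun s => valY hν j s - psi ν j s) (𝓝[>] 0) (𝓝 0) := by
  obtain ⟨C, -, hC⟩ := exists_norm_valY_sub_le hν hj
  exact squeeze_zero_norm' hC (tendsto_mul_rpow_zero C (by norm_num))

lemma exists_norm_valY_le {j : ℕ} (hj : j ≤ M) : ∃ C, 0 ≤ C ∧ ∀ᶠ s : ℝ in 𝓝[>] 0,
    ‖valY hν j s‖ ≤ C * s ^ (-1 / 4 : ℝ) := by
  obtain ⟨C, h0, hC⟩ := exists_norm_valY_sub_le hν hj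
  obtain ⟨C', h0', hC'⟩ := norm_psi_le hν j 1
  refine ⟨C + C', by positivity, ?_⟩
  filter_upwards [hC, eventually_detM hν] with s hs hs'
  have h1 : s ^ (1 / 2 : ℝ) ≤ s ^ (-1 / 4 : ℝ) :=
    Real.rpow_le_rpow_of_exponent_ge hs'.1.1 hs'.1.2 (by norm_num)
  have h2 := hC' s hs'.1.1 hs'.1.2
  calc ‖valY hν j s‖ = ‖(valY hν j s - psi ν j s) + psi ν j s‖ := by rw [sub_add_cancel]
    _ ≤ C * s ^ (1 / 2 : ℝ) + C' * s ^ (-1 / 4 : ℝ) := (norm_add_le _ _).trans (add_le_add hs h2)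
    _ ≤ (C + C') * s ^ (-1 / 4 : ℝ) := by
        rw [add_mul]
        gcongr

lemma tendsto_xf (j : ℕ) : Tendsto (xf ν j) (𝓝[>] 0) (𝓝 (Complex.I * phiC hν j 0)) := by
  refine ((tendsto_valX hν j).const_mul Complex.I).congr' ?_
  filter_upwards [eventually_detM hν] with s hs using (xf_eq hν j hs.1.1 hs.2.1).symm

lemma tendsto_yf_sub (hν : ν 0 = 0) {j : ℕ} (hj : j ≤ M) :
    Tendsto (fun s => yf ν j s - Complex.I * psi ν j s) (𝓝[>] 0) (𝓝 0) := by
  have h := (tendsto_valY_sub hν hj).const_mul Complex.I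
  rw [mul_zero] at h
  refine h.congr' ?_
  filter_upwards [eventually_detM hν] with s hs
  rw [yf_eq hν hj hs.1.1 hs.2.1, mul_sub]

lemma tendsto_yf (hν : ν 0 = 0) {j : ℕ} (hj : j ≤ M) {l : ℂ} (hl : Tendsto (psi ν j) (𝓝[>] 0) (𝓝 l))
    :
    Tendsto (yf ν j) (𝓝[>] 0) (𝓝 (Complex.I * l)) := by
  have h := (tendsto_yf_sub hν hj).add (hl.const_mul Complex.I)
  simpa using h

lemma tendsto_eta (hν : ν 0 = 0) (j : ℕ) : Tendsto (eta ν j) (𝓝[>] 0) (𝓝 0) := by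
  have h := (tendsto_pairing hν j le_rfl).const_mul ((-1 : ℂ) ^ M)
  rw [mul_zero] at h
  refine h.congr' ?_
  filter_upwards [eventually_detM hν] with s hs using (eta_eq hν j hs.1.1 hs.2.1).symm

lemma tendsto_xi (hν : ν 0 = 0) {j : ℕ} (hj : j ≤ M) : Tendsto (xi ν j) (𝓝[>] 0) (𝓝 (eps ν j)) := by
  have h := ((tendsto_pairing hν 0 hj).const_mul ((-1 : ℂ) ^ M)).add_const (eps ν j)
  rw [mul_zero, zero_add] at h
  refine h.congr' ?_
  filter_upwards [eventually_detM hν] with s hs using (xi_eq hν hj hs.1.1 hs.2.1).symm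

/-! ### The formula for the Fredholm determinant -/

lemma intervalIntegrable_of_eventually_le {q : ℝ → ℂ} {r C s : ℝ} (hr : -1 < r) (hs : 0 < s)
    (hq : ContinuousOn q (Ioc 0 s)) (hb : ∀ᶠ t in 𝓝[>] 0, ‖q t‖ ≤ C * t ^ r) :
    IntervalIntegrable q volume 0 s := by
  obtain ⟨δ, hδ, hball⟩ := (mem_nhdsGT_iff_exists_Ioc_subset).1 hb
  have hδ0 : (0 : ℝ) < δ := hδ
  set c := min δ s with hc
  have hc0 : 0 < c := lt_min hδ0 hs
  have h1 : IntervalIntegrable q volume 0 c := by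
    rw [intervalIntegrable_iff_integrableOn_Ioc_of_le hc0.le]
    refine Integrable.mono' (g := fun t => C * t ^ r) ?_ ?_ ?_
    · exact ((intervalIntegrable_iff_integrableOn_Ioc_of_le hc0.le).1
        (intervalIntegral.intervalIntegrable_rpow' hr)).const_mul C
    · exact (hq.mono (Ioc_subset_Ioc_right (min_le_right _ _))).aestronglyMeasurable
        measurableSet_Ioc
    · exact (ae_restrict_mem measurableSet_Ioc).mono fun t ht =>
        hball ⟨ht.1, ht.2.trans (min_le_left _ _)⟩
  refine h1.trans (ContinuousOn.intervalIntegrable (hq.mono fun t ht => ?_))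
  rw [uIcc_of_le (min_le_right _ _)] at ht
  exact ⟨hc0.trans_le ht.1, ht.2⟩

lemma abs_log_div_le {s t : ℝ} (ht : 0 < t) (hts : t ≤ s) :
    |Real.log (s / t)| ≤ 4 * s ^ (1 / 4 : ℝ) * t ^ (-1 / 4 : ℝ) := by
  have hs : 0 < s := ht.trans_le hts
  rw [abs_of_nonneg (Real.log_nonneg ((one_le_div ht).2 hts))]
  refine (Real.log_le_rpow_div (div_pos hs ht).le (by norm_num : (0 : ℝ) < 1 / 4)).trans (le_of_eq ?_)
  rw [Real.div_rpow hs.le ht.le, show (-1 / 4 : ℝ) = -(1 / 4) by norm_num, Real.rpow_neg ht.le]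
  field_simp

section Formula

variable {s : ℝ}

/-- Near 0 the logarithm and the second value are each O(t^{-1/4}) and the first value is bounded,
so the product is O(t^{-1/2}). -/
lemma intervalIntegrable_log_mul (hs : 0 < s) (h0 : ∀ t ∈ Ioc 0 s, detM hν t ≠ 0) :
    IntervalIntegrable
    (fun t : ℝ => (Real.log (s / t) : ℂ) * (valX hν 0 t * valY hν M t)) volume 0 s := by
  obtain ⟨C, hC0, hC⟩ := exists_norm_valY_le hν (le_refl M)
  refine intervalIntegrable_of_eventually_le (r := -1 / 2)
    (C := 4 * s ^ (1 / 4 : ℝ) * ((‖phiC hν 0 0‖ + 1) * C)) (by norm_num) hs (fun t ht => ?_) ?_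
  · have h1 : ContinuousAt (valX hν 0) t := by
      rcases Nat.eq_zero_or_pos M with hM | hM
      · subst hM
        exact (hasDerivAt_valX_last hν ht.1 (h0 t ht)).continuousAt
      · exact (hasDerivAt_valX hν hM ht.1 (h0 t ht)).continuousAt
    have h2 : ContinuousAt (valY hν M) t := by
      rcases Nat.eq_zero_or_pos M with hM | hM
      · subst hM
        exact (hasDerivAt_valY_zero hν ht.1 (h0 t ht)).continuousAt
      · exact (hasDerivAt_valY hν hM le_rfl ht.1 (h0 t ht)).continuousAt
    have h3 : ContinuousAt (fun t : ℝ => Real.log (s / t)) t :=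
      (continuousAt_const.div continuousAt_id ht.1.ne').log (div_pos hs ht.1).ne'
    exact ((Complex.continuous_ofReal.continuousAt.comp h3).mul (h1.mul h2)).continuousWithinAt
  · have hX : ∀ᶠ t in 𝓝[>] 0, ‖valX hν 0 t‖ < ‖phiC hν 0 0‖ + 1 :=
      (tendsto_valX hν 0).norm.eventually_lt_const (lt_add_one _)
    filter_upwards [hC, hX, Ioo_mem_nhdsGT hs] with t hCt hXt ht
    rw [norm_mul, norm_mul, Complex.norm_real, Real.norm_eq_abs]
    calc _ ≤ (4 * s ^ (1 / 4 : ℝ) * t ^ (-1 / 4 : ℝ)) *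
          ((‖phiC hν 0 0‖ + 1) * (C * t ^ (-1 / 4 : ℝ))) := by
          have := abs_log_div_le ht.1 ht.2.le
          gcongr
          exact (abs_nonneg _).trans this
      _ = _ := by
          rw [show (-1 / 2 : ℝ) = -1 / 4 + -1 / 4 by norm_num, Real.rpow_add ht.1]
          ring

lemma intervalIntegrable_pairing_div (hs : 0 < s) (h0 : ∀ t ∈ Ioc 0 s, detM hν t ≠ 0) :
    IntervalIntegrable
    (fun t : ℝ => (t : ℂ)⁻¹ * pairing hν 0 M t) volume 0 s := by
  obtain ⟨C, hC0, hC⟩ := exists_norm_pairing_le hν 0 (le_refl M)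
  refine intervalIntegrable_of_eventually_le (r := -1 / 4) (C := C) (by norm_num) hs
    (fun t ht => ?_) ?_
  · have h1 := (hasDerivAt_pairing_phi_psi hν (i := 0) le_rfl ht.1 (h0 t ht)).continuousAt
    have h2 : ContinuousAt (fun t : ℝ => (t : ℂ)⁻¹) t :=
      continuousOn_ofReal_inv.continuousAt (Ioi_mem_nhds ht.1)
    exact (h2.mul h1).continuousWithinAt
  · filter_upwards [hC, self_mem_nhdsWithin] with t hCt ht
    have ht' : 0 < t := ht
    rw [norm_mul, norm_inv, Complex.norm_real, Real.norm_of_nonneg ht'.le, inv_mul_le_iff₀ ht']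
    refine hCt.trans (le_of_eq ?_)
    rw [show (3 / 4 : ℝ) = 1 + -1 / 4 by norm_num, Real.rpow_add ht', Real.rpow_one]
    ring

lemma hasDerivAt_integral_pairing (h0 : ∀ t ∈ Ioc 0 s, detM hν t ≠ 0) {t : ℝ} (ht : t ∈ Ioc 0 s) :
    HasDerivAt (fun t => ∫ r in (0 : ℝ)..t, (r : ℂ)⁻¹ * pairing hν 0 M r)
      ((t : ℂ)⁻¹ * pairing hν 0 M t) t := by
  have hU : IsOpen {t : ℝ | 0 < t ∧ detM hν t ≠ 0} :=
    isOpen_iff_mem_nhds.2 fun t ht => eventually_detM_ne_zero hν ht.1 ht.2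
  have hc : ContinuousOn (fun t : ℝ => (t : ℂ)⁻¹ * pairing hν 0 M t)
      {t : ℝ | 0 < t ∧ detM hν t ≠ 0} := by
    intro t ht
    have h1 := (hasDerivAt_pairing_phi_psi hν (i := 0) le_rfl ht.1 ht.2).continuousAt
    have h2 : ContinuousAt (fun t : ℝ => (t : ℂ)⁻¹) t :=
      continuousOn_ofReal_inv.continuousAt (Ioi_mem_nhds ht.1)
    exact (h2.mul h1).continuousWithinAt
  have hmem : t ∈ {t : ℝ | 0 < t ∧ detM hν t ≠ 0} := ⟨ht.1, h0 t ht⟩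
  refine intervalIntegral.integral_hasDerivAt_right ?_ (hc.stronglyMeasurableAtFilter hU t hmem)
    (hc.continuousAt (hU.mem_nhds hmem))
  exact intervalIntegrable_pairing_div hν ht.1 fun r hr => h0 r ⟨hr.1, hr.2.trans ht.2⟩

/-- Integration by parts: the pairing of φ_0 and ψ_M has derivative `valX` times `valY`, and
log(s/t) has derivative -1/t. The boundary terms vanish, at s because log 1 = 0 and at 0 because the
pairing is O(t^{3/4}). -/
lemma integral_log_mul (hs : 0 < s) (h0 : ∀ t ∈ Ioc 0 s, detM hν t ≠ 0) : ∫ t in (0 : ℝ)..s,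
    (Real.log (s / t) : ℂ) * (valX hν 0 t * valY hν M t) =
      ∫ t in (0 : ℝ)..s, (t : ℂ)⁻¹ * pairing hν 0 M t := by
  have hder : ∀ t ∈ Ioc 0 s, HasDerivAt (fun t : ℝ => (Real.log (s / t) : ℂ) * pairing hν 0 M t +
      ∫ r in (0 : ℝ)..t, (r : ℂ)⁻¹ * pairing hν 0 M r)
      ((Real.log (s / t) : ℂ) * (valX hν 0 t * valY hν M t)) t := by
    intro t ht
    have ht' : (t : ℂ) ≠ 0 := by exact_mod_cast ht.1.ne'
    have h1 : HasDerivAt (fun t : ℝ => Real.log (s / t)) (-t⁻¹) t := by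
      have h2 : HasDerivAt (fun t : ℝ => Real.log s - Real.log t) (-t⁻¹) t :=
        (Real.hasDerivAt_log ht.1.ne').const_sub _
      refine h2.congr_of_eventuallyEq ?_
      filter_upwards [Ioi_mem_nhds ht.1] with r hr
      exact Real.log_div hs.ne' (ne_of_gt hr)
    refine ((h1.ofReal_comp.mul (hasDerivAt_pairing_phi_psi hν (i := 0) le_rfl ht.1 (h0 t ht))).add
      (hasDerivAt_integral_pairing hν h0 ht)).congr_deriv ?_
    push_cast
    ring
  have hzero : Tendsto (fun t : ℝ => (Real.log (s / t) : ℂ) * pairing hν 0 M t +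
      ∫ r in (0 : ℝ)..t, (r : ℂ)⁻¹ * pairing hν 0 M r) (𝓝[>] 0) (𝓝 (0 + 0)) := by
    refine Tendsto.add ?_ (tendsto_primitive_zero hs (intervalIntegrable_pairing_div hν hs h0))
    obtain ⟨C, hC0, hC⟩ := exists_norm_pairing_le hν 0 (le_refl M)
    refine squeeze_zero_norm' ?_
      (tendsto_mul_rpow_zero (4 * s ^ (1 / 4 : ℝ) * C) (by norm_num : (0 : ℝ) < 1 / 2))
    filter_upwards [hC, Ioo_mem_nhdsGT hs] with t hCt ht
    rw [norm_mul, Complex.norm_real, Real.norm_eq_abs]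
    calc _ ≤ (4 * s ^ (1 / 4 : ℝ) * t ^ (-1 / 4 : ℝ)) * (C * t ^ (3 / 4 : ℝ)) := by
          have := abs_log_div_le ht.1 ht.2.le
          gcongr
          exact (abs_nonneg _).trans this
      _ = _ := by
          rw [show (1 / 2 : ℝ) = -1 / 4 + 3 / 4 by norm_num, Real.rpow_add ht.1]
          ring
  have h1 := intervalIntegral.integral_eq_sub_of_hasDerivAt_of_tendsto hs
    (fun t ht => hder t (Ioo_subset_Ioc_self ht)) (intervalIntegrable_log_mul hν hs h0) hzero
    ((hder s ⟨hs, le_rfl⟩).continuousAt.tendsto.mono_left nhdsWithin_le_nhds)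
  rw [h1, div_self hs.ne', Real.log_one]
  simp

/-- The determinant times the exponential of minus the exponent has derivative 0 and limit 1 at the
origin. This avoids choosing a logarithm of a complex-valued determinant. -/
lemma detM_eq_exp (hs : 0 < s) (h0 : ∀ t ∈ Ioc 0 s, detM hν t ≠ 0) : detM hν s = Complex.exp
    ((-1) ^ M *
    ∫ t in (0 : ℝ)..s, (t : ℂ)⁻¹ * pairing hν 0 M t) := by
  set A : ℝ → ℂ := fun t => ∫ r in (0 : ℝ)..t, (r : ℂ)⁻¹ * pairing hν 0 M r with hA
  have hder : ∀ t ∈ Ioc 0 s,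
      HasDerivAt (fun t => detM hν t * Complex.exp (-((-1) ^ M * A t))) 0 t := by
    intro t ht
    refine ((hasDerivAt_detM hν ht.1 (h0 t ht)).mul
      ((hasDerivAt_integral_pairing hν h0 ht).const_mul ((-1) ^ M)).neg.cexp).congr_deriv ?_
    ring
  have hzero : Tendsto (fun t => detM hν t * Complex.exp (-((-1) ^ M * A t))) (𝓝[>] 0)
      (𝓝 (1 * Complex.exp (-((-1) ^ M * 0)))) :=
    (tendsto_detK (a := fC hν) (isSingular_g hν)).mul
      ((tendsto_primitive_zero hs (intervalIntegrable_pairing_div hν hs h0)).const_mul _).neg.cexp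
  have h1 := intervalIntegral.integral_eq_sub_of_hasDerivAt_of_tendsto hs
    (fun t ht => hder t (Ioo_subset_Ioc_self ht)) intervalIntegrable_const hzero
    ((hder s ⟨hs, le_rfl⟩).continuousAt.tendsto.mono_left nhdsWithin_le_nhds)
  rw [intervalIntegral.integral_zero, mul_zero, neg_zero, Complex.exp_zero, one_mul, eq_comm,
    sub_eq_zero, Complex.exp_neg, mul_inv_eq_one₀ (Complex.exp_ne_zero _)] at h1
  exact h1

end Formula

lemma F_eq_exp (hν : ν 0 = 0) {s : ℝ} (hs : 0 < s) (h0 : ∀ t ∈ Ioc 0 s, F ν t ≠ 0) :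
    IntervalIntegrable (fun t => (Real.log (s / t) : ℂ) * xf ν 0 t * yf ν M t) volume 0 s ∧
      F ν s = Complex.exp ((-1) ^ (M + 1) *
        ∫ t in (0 : ℝ)..s, (Real.log (s / t) : ℂ) * xf ν 0 t * yf ν M t) := by
  have h0' : ∀ t ∈ Ioc 0 s, detM hν t ≠ 0 := fun t ht => by
    rw [← F_eq_detM hν ht.1]
    exact h0 t ht
  have hI : Complex.I * Complex.I = -1 := Complex.I_mul_I
  have heq : EqOn (fun t => -((Real.log (s / t) : ℂ) * (valX hν 0 t * valY hν M t)))
      (fun t => (Real.log (s / t) : ℂ) * xf ν 0 t * yf ν M t) (Ioc 0 s) := by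
    intro t ht
    simp only [xf_eq hν 0 ht.1 (h0' t ht), yf_eq hν le_rfl ht.1 (h0' t ht)]
    linear_combination (-(Real.log (s / t) : ℂ) * valX hν 0 t * valY hν M t) * hI
  refine ⟨(intervalIntegrable_log_mul hν hs h0').neg.congr ?_, ?_⟩
  · rw [uIoc_of_le hs.le]
    exact heq
  · have h1 : ∫ t in (0 : ℝ)..s, (Real.log (s / t) : ℂ) * xf ν 0 t * yf ν M t =
        -∫ t in (0 : ℝ)..s, (t : ℂ)⁻¹ * pairing hν 0 M t := by
      rw [← integral_log_mul hν hs h0', ← intervalIntegral.integral_neg]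
      refine intervalIntegral.integral_congr_ae (ae_of_all _ fun t ht => ?_)
      rw [uIoc_of_le hs.le] at ht
      exact (heq ht).symm
    rw [F_eq_detM hν hs, detM_eq_exp hν hs h0', h1, pow_succ]
    congr 1
    ring

end

end GenBessel

end

theorem proposition3p8 (M : ℕ) (hM : 1 ≤ M) (ν : Fin (M + 1) → ℕ) (hν : ν 0 = 0) :
    -- existence of the Fredholm determinant
    (∀ s : ℝ, 0 < s → GenBessel.FredholmDetExists (GenBessel.KJ ν s)) ∧
    -- the quantities are well defined and satisfy the system of differential equations
    (∀ s : ℝ, 0 < s → GenBessel.F ν s ≠ 0 →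
      GenBessel.WellDefinedAt ν s ∧
      GenBessel.SatisfiesODE M (GenBessel.xf ν) (GenBessel.yf ν) (GenBessel.xi ν)
        (GenBessel.eta ν) s) ∧
    -- initial conditions
    (∀ᶠ s in nhdsWithin (0 : ℝ) (Set.Ioi 0), GenBessel.F ν s ≠ 0) ∧
    (∀ j ≤ M,
      (∃ l : ℂ, Filter.Tendsto (GenBessel.phi ν j) (nhdsWithin 0 (Set.Ioi 0)) (nhds l) ∧
        Filter.Tendsto (GenBessel.xf ν j) (nhdsWithin 0 (Set.Ioi 0)) (nhds (Complex.I * l))) ∧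
      Filter.Tendsto (fun s => GenBessel.yf ν j s - Complex.I * GenBessel.psi ν j s)
        (nhdsWithin 0 (Set.Ioi 0)) (nhds 0) ∧
      ((j ≤ 1 ∨ (Finset.univ.filter (fun l : Fin M => ν l.succ = 0)).card ≤ 1) →
        ∃ l : ℂ, Filter.Tendsto (GenBessel.psi ν j) (nhdsWithin 0 (Set.Ioi 0)) (nhds l) ∧
          Filter.Tendsto (GenBessel.yf ν j) (nhdsWithin 0 (Set.Ioi 0)) (nhds (Complex.I * l))) ∧
      Filter.Tendsto (GenBessel.eta ν j) (nhdsWithin 0 (Set.Ioi 0)) (nhds 0) ∧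
      Filter.Tendsto (GenBessel.xi ν j) (nhdsWithin 0 (Set.Ioi 0))
        (nhds ((-1) ^ (M + 1 - j) * GenBessel.esymmNu ν (M + 1 - j)))) ∧
    -- formula for the Fredholm determinant
    (∀ s : ℝ, 0 < s → (∀ t ∈ Set.Ioc 0 s, GenBessel.F ν t ≠ 0) →
      IntervalIntegrable
        (fun t => (Real.log (s / t) : ℂ) * GenBessel.xf ν 0 t * GenBessel.yf ν M t)
        MeasureTheory.volume 0 s ∧
      GenBessel.F ν s = Complex.exp ((-1) ^ (M + 1) *
        ∫ t in (0 : ℝ)..s,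
          (Real.log (s / t) : ℂ) * GenBessel.xf ν 0 t * GenBessel.yf ν M t)) := by
  refine ⟨fun s hs => GenBessel.fredholmDetExists hν hs, fun s hs h0 => ?_, ?_, fun j hj => ?_,
    fun s hs h0 => GenBessel.F_eq_exp hν hs h0⟩
  · rw [GenBessel.F_eq_detM hν hs] at h0
    exact ⟨GenBessel.wellDefinedAt hν hs h0, GenBessel.satisfiesODE hν hs h0⟩
  · filter_upwards [GenBessel.eventually_detM hν] with s hs
    rw [GenBessel.F_eq_detM hν hs.1.1]
    exact hs.2.1
  · refine ⟨⟨_, GenBessel.tendsto_phi_phiC hν j, GenBessel.tendsto_xf hν j⟩,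
      GenBessel.tendsto_yf_sub hν hj, fun h => ?_, GenBessel.tendsto_eta hν j,
      GenBessel.tendsto_xi hν hj⟩
    obtain ⟨l, hl⟩ := GenBessel.tendsto_psi hν h
    exact ⟨l, hl, GenBessel.tendsto_yf hν hj hl⟩
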